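/- For bounded $B\subset\mathbb R^d$ and $r>0$ let $N(B,r)$ be the least number of closed Euclidean balls of radius $r$ covering $B$; a size-$s$ interval is a box $\prod_{i=1}^d[a_i,a_i+s]$; and $\mathcal L(\mathbb R^d,\mathbb R^d)$ is the space of linear maps with the operator norm. Let $d\in\mathbb N$, $0<\sigma<d$, $\kappa,\kappa',\rho>0$ and a constant $c>0$ be given, and put $\varepsilon_0=\frac1{200}\left(1-\frac\sigma d\right)$. Consider, for $\delta>0$, a set $A\subset[0,1]^d$ with $N(A,\delta)=\delta^{-\sigma}$ such that $$N(A\cap I,\delta)<\delta_1^{\kappa}N(A,\delta)\quad\text{whenever }\delta<\delta_1<\delta^{\varepsilon_0}\text{ and } I\text{ is a size-}\delta_1\text{ interval},\tag{1}$$ and a Borel probability measure $\mu$ on $\mathcal L(\mathbb R^d,\mathbb R^d)$ such that $$\|b\|\le 1\quad\text{for all } b\in\operatorname{supp}\mu,\tag{2}$$ $$\mu\left[\,|bv-w|<\delta_1\right]<c\,\delta_1^{\kappa'}\quad\text{for all }\delta<\delta_1<1\text{ and all } v,w\in\mathbb R^d\text{ with }|v|=1.\tag{3}$$ **Proposition 1.**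 There are $\tau>0$ and $\delta_0>0$, depending only on $\sigma,\kappa,\kappa',\rho$ and the fixed constants $d,c$, such that for all $0<\delta<\delta_0$ and all $A,\mu$ as above which satisfy in addition $$\mu\left[\,|\langle bv,w\rangle|<\rho\right]<\frac1{100d}\left(1-\frac\sigma d\right)\quad\text{for all } v,w\in\mathbb R^d\text{ with }|v|=|w|=1,$$ there is some $b\in\operatorname{supp}\mu$ with $$N(A+A,\delta)+N(A+bA,\delta)>\delta^{-\sigma-\tau}.$$ **Proposition 1′.** There are $\tau>0$ and $\delta_0>0$, depending only on $\sigma,\kappa,\kappa',\rho$ and the fixed constants $d,c$, such that for all $0<\delta<\delta_0$, all $A,\mu$ as above, and all finite families $u_1,\dots,u_r\in\mathcal L(\mathbb R^d,\mathbb R^d)$ with $\|u_s\|\le1$ and $$\max_{1\le s\le r}|\langle u_sv,w\rangle|>\rho\quad\text{for all } v,w\in\mathbb R^d\text{ with }|v|=|w|=1,$$ either $N(A+A,\delta)>\delta^{-\sigma-\tau}$, or $N(A+bA,\delta)>\delta^{-\sigma-\tau}$ for some $b\in\operatorname{supp}\mu$, or $N(A+u_sA,\delta)>\delta^{-\sigma-\tau}$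 for some $s\in\{1,\dots,r\}$. -/

import Mathlib

open MeasureTheory
open scoped Pointwise

noncomputable section

/-- Euclidean space `ℝ^d`, with the Euclidean norm and inner product. -/
abbrev Euc (d : ℕ) : Type := EuclideanSpace ℝ (Fin d)

/-- The space `𝓛(ℝ^d, ℝ^d)` of linear maps, with the operator norm and the Borel σ-algebra. -/
abbrev LinEuc (d : ℕ) : Type := Euc d →L[ℝ] Euc d

/-- The size-`s` interval with corner `a`: the closed box `∏ i, [a i, a i + s]` in `ℝ^d`. -/
def sizeBox {d : ℕ} (a : Euc d) (s : ℝ) : Set (Euc d) :=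
  {x | ∀ i, a i ≤ x i ∧ x i ≤ a i + s}

/-- The unit cube `[0,1]^d`. -/
def unitCube (d : ℕ) : Set (Euc d) := sizeBox 0 1

/-- The metric entropy number `N(B, r)`: the least number of closed Euclidean balls of radius `r`
(with arbitrary centers) that cover `B`. It is used for bounded `B` and `r > 0`, where it is finite
(see `externalCoveringNumber_ne_top_of_isBounded`). -/
def entropyNumber {d : ℕ} (B : Set (Euc d)) (r : ℝ) : ℕ :=
  (Metric.externalCoveringNumber r.toNNReal B).toNat

/-- For bounded `B` and `r > 0` the covering number is finite, so `toNat` loses nothing. -/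
theorem externalCoveringNumber_ne_top_of_isBounded {d : ℕ} {B : Set (Euc d)}
    (hB : Bornology.IsBounded B) {r : ℝ} (hr : 0 < r) :
    Metric.externalCoveringNumber r.toNNReal B ≠ ⊤ := by
  obtain ⟨t, ht, hcov⟩ :=
    Metric.totallyBounded_iff.1 (hB.isCompact_closure.totallyBounded.subset subset_closure) r hr
  have hc : Metric.IsCover r.toNNReal B t := by
    intro x hx
    obtain ⟨y, hy, hxy⟩ := Set.mem_iUnion₂.1 (hcov hx)
    refine ⟨y, hy, ?_⟩
    show edist x y ≤ (r.toNNReal : ENNReal)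
    rw [edist_dist]
    exact ENNReal.ofReal_le_ofReal (Metric.mem_ball.1 hxy).le
  exact ne_top_of_le_ne_top ht.encard_lt_top.ne hc.externalCoveringNumber_le_encard

/-- Non-concentration of a set: `N(A ∩ I, δ) < δ₁^κ N(A, δ)` whenever `δ < δ₁ < δ^ε₀` and `I` is a
size-`δ₁` interval, where `ε₀ = (1 - σ/d)/200`. -/
def NonConcentratedSet {d : ℕ} (σ κ δ : ℝ) (A : Set (Euc d)) : Prop :=
  ∀ δ₁ : ℝ, δ < δ₁ → δ₁ < δ ^ ((1 / 200 : ℝ) * (1 - σ / d)) → ∀ a : Euc d,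
    (entropyNumber (A ∩ sizeBox a δ₁) δ : ℝ) < δ₁ ^ κ * (entropyNumber A δ : ℝ)

/-- `‖b‖ ≤ 1` for all `b` in the support of `μ`. -/
def SupportedInUnitBall {d : ℕ} (μ : Measure (LinEuc d)) : Prop :=
  ∀ b ∈ μ.support, ‖b‖ ≤ 1

/-- Non-concentration of a measure on linear maps: `μ[|bv - w| < δ₁] < c δ₁^κ'` for all unit
vectors `v`, all vectors `w` and all `δ < δ₁ < 1`. -/
def NonConcentratedMeasure {d : ℕ} (c κ' δ : ℝ) (μ : Measure (LinEuc d)) : Prop :=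
  ∀ δ₁ : ℝ, δ < δ₁ → δ₁ < 1 → ∀ v w : Euc d, ‖v‖ = 1 →
    μ.real {b | ‖b v - w‖ < δ₁} < c * δ₁ ^ κ'

/-- Transversality of a measure on linear maps:
`μ[|⟨bv, w⟩| < ρ] < (1 - σ/d)/(100 d)` for all unit vectors `v, w`. -/
def TransversalMeasure {d : ℕ} (σ ρ : ℝ) (μ : Measure (LinEuc d)) : Prop :=
  ∀ v w : Euc d, ‖v‖ = 1 → ‖w‖ = 1 →
    μ.real {b | |inner ℝ (b v) w| < ρ} < 1 / (100 * (d : ℝ)) * (1 - σ / d)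

/-- Transversality of a finite family of linear maps of norm at most `1`: for all unit vectors
`v, w` there is `s` with `|⟨u_s v, w⟩| > ρ`. -/
def TransversalFamily {d r : ℕ} (ρ : ℝ) (u : Fin r → LinEuc d) : Prop :=
  (∀ s, ‖u s‖ ≤ 1) ∧
    ∀ v w : Euc d, ‖v‖ = 1 → ‖w‖ = 1 → ∃ s, ρ < |inner ℝ (u s v) w|

end

/-!
Suppose that `A + A`, `A + b A` and `A + u A` are all at most `δ ^ (-σ - τ)`, for `b` in the support
of `μ` and `u` in a transversal set `U` (the support of `μ`, or the given finite family). Three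
facts are incompatible for small `τ` and `δ`.

*Small sumsets survive ring operations.* By Ruzsa's covering lemma, applied to lattice cells of size
`δ`, the set `f '' A` is covered by `δ ^ (-O(τ))` translates of sums of boundedly many differences
of elements of `A`, for `f` in `supp μ`, in `U`, or `f = 1`. This property passes to sums,
differences and compositions (`CoveredBy.exists_of_mem_generated`). By the Plünnecke-Ruzsa
inequality, `A + f '' A` is at most `δ ^ (-O(τ))` times as large as `A`, for every `f` in the ring
generated by these maps, as long as the number of ring operations is bounded
(`CoveredBy.card_cells_add_le`).

*Boundedly many ring operations produce a well-spread family.* For every `η > 0` there is a finite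
family of generated maps `f ω` such that, for each unit vector `v`, the points `f ω v` fall into a
ball of radius `r ≥ δ` with probability `O(r ^ d δ ^ (-η))` (`exists_spread_family`). The family
consists of sums over many scales of independent digits. A counting argument shows that a
non-concentrated measure charges long binary trees: all nodes of generation `j` split along the same
vector `e j` (`exists_splitsAlong`). Products of differences have norms at all scales, since the
scales of differences have positive density and, by Schnirelmann's theorem, boundedly many of them
add up to everything (`exists_generated_norm_eq`). Multiplying the tree by boundedly many such
products moves its splitting vectors to all but a small proportion of the scales (`exists_shifts`);
transversal maps inserted on both sides and in the middle (`TransversalSet.exists_inner_mul_ge`)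
make the digits of one scale span all directions. Then each scale contributes an almost optimal gain
(`exists_card_digitWalk_le`).

*A well-spread family contains a map with large sumset.* The additive energy between `A` and
`f ω '' A`, averaged over `ω`, is small: pairs `y, y'` in `A` that are not too close contribute little, as
`f ω (y - y')` is spread out, and there are few close pairs, as `A` is not concentrated on small
boxes. By the Cauchy-Schwarz inequality, `A + f ω '' A` is larger than `A` by a fixed power of
`δ⁻¹`, for some `ω` (`exists_card_pow_four_le`).
-/

/-! ### Separated sets and nets in finite-dimensional spaces -/

section Nets

variable {V : Type*} [NormedAddCommGroup V] [NormedSpace ℝ V] [FiniteDimensional ℝ V]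

/-- The number of `s`-separated points in a ball of radius `K * s` is bounded independently of the
scale `s` and of the center. -/
theorem exists_card_le_of_separated (K : ℝ) : ∃ M : ℕ, ∀ (s : ℝ) (c : V) (P : Finset V), 0 < s →
    (∀ p ∈ P, ‖p - c‖ ≤ K * s) → (∀ p ∈ P, ∀ q ∈ P, p ≠ q → s < ‖p - q‖) → P.card ≤ M := by
  obtain ⟨T, hT, hcov⟩ := Metric.totallyBounded_iff.1
    (isCompact_closedBall (0 : V) K).totallyBounded (1 / 2) (by norm_num)
  refine ⟨hT.toFinset.card, fun s c P hs hP hsep => ?_⟩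
  have key : ∀ p ∈ P, ∃ t ∈ T, ‖s⁻¹ • (p - c) - t‖ < 1 / 2 := by
    intro p hp
    have h1 : s⁻¹ • (p - c) ∈ Metric.closedBall (0 : V) K := by
      rw [mem_closedBall_zero_iff, norm_smul, norm_inv, Real.norm_of_nonneg hs.le,
        inv_mul_le_iff₀ hs, mul_comm]
      exact hP p hp
    obtain ⟨t, ht, h2⟩ := Set.mem_iUnion₂.1 (hcov h1)
    exact ⟨t, ht, by rwa [← dist_eq_norm]⟩
  choose! t ht h2 using key
  refine Finset.card_le_card_of_injOn t (fun p hp => by simpa using ht p hp) ?_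
  intro p hp q hq hpq
  by_contra hne
  have h3 := hsep p hp q hq hne
  have h4 : ‖s⁻¹ • (p - q)‖ < 1 := by
    have h5 := h2 p hp
    have h6 := h2 q hq
    have h7 : s⁻¹ • (p - q) = (s⁻¹ • (p - c) - t p) - (s⁻¹ • (q - c) - t q) := by
      rw [hpq, sub_sub_sub_cancel_right, ← smul_sub, sub_sub_sub_cancel_right]
    rw [h7]
    linarith [norm_sub_le (s⁻¹ • (p - c) - t p) (s⁻¹ • (q - c) - t q)]
  rw [norm_smul, norm_inv, Real.norm_of_nonneg hs.le, inv_mul_lt_iff₀ hs, mul_one] at h4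
  exact absurd h3 (not_lt.2 h4.le)

/-- A ball of radius `K * s` has an `s`-separated `s`-net of size bounded independently of the
scale `s` and of the center. -/
theorem exists_separated_net (K : ℝ) : ∃ M : ℕ, ∀ (s : ℝ) (c : V), 0 < s → ∃ P : Finset V,
    P.card ≤ M ∧ (∀ p ∈ P, ∀ q ∈ P, p ≠ q → s < ‖p - q‖) ∧
      ∀ x, ‖x - c‖ ≤ K * s → ∃ p ∈ P, ‖x - p‖ ≤ s := by
  classical
  obtain ⟨M, hM⟩ := exists_card_le_of_separated (V := V) K
  refine ⟨M, fun s c hs => ?_⟩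
  let good : ℕ → Prop := fun n => ∃ P : Finset V, P.card = n ∧ (∀ p ∈ P, ‖p - c‖ ≤ K * s) ∧
    (∀ p ∈ P, ∀ q ∈ P, p ≠ q → s < ‖p - q‖)
  have h0 : good 0 := ⟨∅, by simp⟩
  obtain ⟨P, hPc, hPb, hPs⟩ := Nat.findGreatest_spec (P := good) (Nat.zero_le M) h0
  refine ⟨P, hM s c P hs hPb hPs, hPs, fun x hx => ?_⟩
  by_contra! hfar
  have hxP : x ∉ P := fun h => by
    have := hfar x h
    simp at this
    linarith
  have hbd : ∀ p ∈ insert x P, ‖p - c‖ ≤ K * s := by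
    intro p hp
    rcases Finset.mem_insert.1 hp with rfl | hp
    · exact hx
    · exact hPb p hp
  have hsp : ∀ p ∈ insert x P, ∀ q ∈ insert x P, p ≠ q → s < ‖p - q‖ := by
    intro p hp q hq hpq
    rcases Finset.mem_insert.1 hp with rfl | hp' <;> rcases Finset.mem_insert.1 hq with rfl | hq'
    · exact absurd rfl hpq
    · exact hfar q hq'
    · rw [norm_sub_rev]; exact hfar p hp'
    · exact hPs p hp' q hq' hpq
  have hg : good (P.card + 1) := ⟨insert x P, Finset.card_insert_of_notMem hxP, hbd, hsp⟩
  have hle : P.card + 1 ≤ M := by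
    rw [← Finset.card_insert_of_notMem hxP]
    exact hM s c _ hs hbd hsp
  have := Nat.le_findGreatest hle hg
  omega

end Nets

/-! ### Vectors that span in a quantitative sense -/

section Spanning

/-- If every unit vector has an inner product of size at least `c` with some vector of a bounded
family, then the family contains `d` vectors whose coordinate functionals are bounded, with a bound
that depends only on `d` and the constants. -/
theorem exists_wellConditioned_basis (d : ℕ) (c C : ℝ) (hc : 0 < c) (hC : 0 < C) :
    ∃ K : ℝ, 0 < K ∧ ∀ (ι : Type) (z : ι → Euc d), (∀ i, ‖z i‖ ≤ C) →
      (∀ w : Euc d, ‖w‖ = 1 → ∃ i, c ≤ |inner ℝ (z i) w|) →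
      ∃ t : Fin d → ι, ∀ (a : Fin d → ℝ) (j : Fin d), |a j| ≤ K * ‖∑ i, a i • z (t i)‖ := by
  suffices H : ∀ k ≤ d, ∃ K : ℝ, 0 < K ∧ ∀ (ι : Type) (z : ι → Euc d), (∀ i, ‖z i‖ ≤ C) →
      (∀ w : Euc d, ‖w‖ = 1 → ∃ i, c ≤ |inner ℝ (z i) w|) →
      ∃ t : Fin k → ι, ∀ (a : Fin k → ℝ) (j : Fin k), |a j| ≤ K * ‖∑ i, a i • z (t i)‖ from
    H d le_rfl
  intro k
  induction k with
  | zero => exact fun _ => ⟨1, one_pos, fun ι z _ _ => ⟨Fin.elim0, fun a j => j.elim0⟩⟩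
  | succ k ih =>
    intro hk
    obtain ⟨K, hK, h⟩ := ih (by omega)
    refine ⟨K * (1 + C / c) + 1 / c, by positivity, fun ι z hz hw => ?_⟩
    obtain ⟨t, ht⟩ := h ι z hz hw
    obtain ⟨w, hw1, hwt⟩ : ∃ w : Euc d, ‖w‖ = 1 ∧ ∀ i, inner ℝ (z (t i)) w = 0 := by
      set W := Submodule.span ℝ (Set.range fun i => z (t i)) with hW
      have hlt : Module.finrank ℝ W < Module.finrank ℝ (Euc d) := by
        refine lt_of_le_of_lt (finrank_range_le_card (R := ℝ) fun i => z (t i)) ?_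
        simp; omega
      have hne : W ≠ ⊤ := fun h => by
        rw [h, finrank_top] at hlt; exact lt_irrefl _ hlt
      obtain ⟨x, hx, hx0⟩ := Submodule.exists_mem_ne_zero_of_ne_bot
        (mt Submodule.orthogonal_eq_bot_iff.1 hne)
      refine ⟨‖x‖⁻¹ • x, norm_smul_inv_norm hx0, fun i => ?_⟩
      rw [inner_smul_right, (Submodule.mem_orthogonal W x).1 hx _
        (Submodule.subset_span ⟨i, rfl⟩), mul_zero]
    obtain ⟨i₀, hi₀⟩ := hw w hw1
    refine ⟨Fin.cons i₀ t, fun a => ?_⟩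
    rw [Fin.sum_univ_succ]
    simp only [Fin.cons_zero, Fin.cons_succ]
    set y := ∑ i : Fin k, a i.succ • z (t i) with hy
    have h0 : |a 0| ≤ 1 / c * ‖a 0 • z i₀ + y‖ := by
      have e1 : inner ℝ (a 0 • z i₀ + y) w = a 0 * inner ℝ (z i₀) w := by
        rw [inner_add_left, hy, sum_inner, real_inner_smul_left]
        simp [real_inner_smul_left, hwt]
      have e2 := abs_real_inner_le_norm (a 0 • z i₀ + y) w
      rw [e1, hw1, mul_one, abs_mul] at e2
      rw [one_div, le_inv_mul_iff₀ hc]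
      calc c * |a 0| = |a 0| * c := mul_comm _ _
        _ ≤ |a 0| * |inner ℝ (z i₀) w| := by gcongr
        _ ≤ _ := e2
    have hyb : ‖y‖ ≤ (1 + C / c) * ‖a 0 • z i₀ + y‖ := by
      have e1 : y = (a 0 • z i₀ + y) - a 0 • z i₀ := by abel
      calc ‖y‖ ≤ ‖a 0 • z i₀ + y‖ + ‖a 0 • z i₀‖ := by
              conv_lhs => rw [e1]
              exact norm_sub_le _ _
        _ ≤ ‖a 0 • z i₀ + y‖ + (1 / c * ‖a 0 • z i₀ + y‖) * C := by
              rw [norm_smul, Real.norm_eq_abs]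
              gcongr
              exact hz i₀
        _ = _ := by ring
    intro j
    refine Fin.cases ?_ (fun j => ?_) j
    · refine h0.trans ?_
      have : 0 ≤ K * (1 + C / c) * ‖a 0 • z i₀ + y‖ := by positivity
      linarith
    · refine (ht (fun i => a i.succ) j).trans ?_
      calc K * ‖y‖ ≤ K * ((1 + C / c) * ‖a 0 • z i₀ + y‖) := by gcongr
        _ ≤ _ := by
          have : 0 ≤ 1 / c * ‖a 0 • z i₀ + y‖ := by positivity
          linarith

/-- Digit vectors whose combinations with a spanning family stay in a bounded set lose a factor
comparable to `N ^ d`. -/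
theorem exists_card_digits_le (d : ℕ) (c C D : ℝ) (hc : 0 < c) (hC : 0 < C) :
    ∃ K : ℕ, 0 < K ∧ ∀ (ι : Type) [Fintype ι] [DecidableEq ι] (z : ι → Euc d), (∀ i, ‖z i‖ ≤ C) →
      (∀ w : Euc d, ‖w‖ = 1 → ∃ i, c ≤ |inner ℝ (z i) w|) →
      ∀ (N : ℕ) (Y : Finset (ι → Fin N)),
        (∀ a ∈ Y, ∀ b ∈ Y, ‖∑ i, (((a i : ℕ) : ℝ) - ((b i : ℕ) : ℝ)) • z i‖ ≤ D) →
        Y.card * N ^ d ≤ K ^ d * N ^ Fintype.card ι := by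
  classical
  obtain ⟨K, hK, h⟩ := exists_wellConditioned_basis d c C hc hC
  obtain ⟨K', hK'⟩ := exists_nat_gt (K * D)
  refine ⟨K' + 1, Nat.succ_pos _, fun ι _ _ z hz hw N Y hY => ?_⟩
  obtain ⟨t, ht⟩ := h ι z hz hw
  have tinj : Function.Injective t := by
    intro i j hij
    by_contra hne
    have e := ht (Pi.single i 1 - Pi.single j 1) i
    have : ∑ k, (Pi.single i (1 : ℝ) - Pi.single j 1 : Fin d → ℝ) k • z (t k) = 0 := by
      simp [sub_smul, Finset.sum_sub_distrib, Pi.single_apply, ite_smul, hij]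
    rw [this] at e
    simp [hne] at e
    linarith
  let Φ : (ι → Fin N) × (Fin d → Fin N) → (Fin d → Fin (K' + 1)) × (ι → Fin N) := fun p =>
    (fun i => ⟨(p.1 (t i) : ℕ) % (K' + 1), Nat.mod_lt _ (Nat.succ_pos _)⟩,
      fun k => if hk : ∃ i, t i = k then p.2 hk.choose else p.1 k)
  have hΦ : Set.InjOn Φ (Y ×ˢ (Finset.univ : Finset (Fin d → Fin N)) : Finset _) := by
    rintro ⟨a, b⟩ hab ⟨a', b'⟩ hab' heq
    simp only [Finset.coe_product, Set.mem_prod, Finset.mem_coe] at hab hab'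
    simp only [Φ, Prod.mk.injEq] at heq
    obtain ⟨h1, h2⟩ := heq
    have hb : b = b' := by
      funext i
      have := congrFun h2 (t i)
      have hex : ∃ j, t j = t i := ⟨i, rfl⟩
      rw [dif_pos hex, dif_pos hex, tinj hex.choose_spec] at this
      exact this
    have hoff : ∀ k, (¬ ∃ i, t i = k) → a k = a' k := by
      intro k hk
      have := congrFun h2 k
      rwa [dif_neg hk, dif_neg hk] at this
    have hsum : ∑ i, (((a i : ℕ) : ℝ) - ((a' i : ℕ) : ℝ)) • z i
        = ∑ i, (((a (t i) : ℕ) : ℝ) - ((a' (t i) : ℕ) : ℝ)) • z (t i) := by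
      rw [← Finset.sum_image (s := Finset.univ) (g := t)
        (f := fun k => (((a k : ℕ) : ℝ) - ((a' k : ℕ) : ℝ)) • z k) (fun i _ j _ hij => tinj hij)]
      refine (Finset.sum_subset (Finset.subset_univ _) fun k _ hk => ?_).symm
      rw [hoff k (by simpa using hk), sub_self, zero_smul]
    have hon : ∀ i, a (t i) = a' (t i) := by
      intro i
      have e1 := ht (fun i => ((a (t i) : ℕ) : ℝ) - ((a' (t i) : ℕ) : ℝ)) i
      rw [← hsum] at e1
      have e2 : |((a (t i) : ℕ) : ℝ) - ((a' (t i) : ℕ) : ℝ)| < K' := by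
        refine lt_of_le_of_lt (e1.trans ?_) hK'
        gcongr
        exact hY a hab.1 a' hab'.1
      have e3 : ((a (t i) : ℕ) : ℤ) ≡ ((a' (t i) : ℕ) : ℤ) [ZMOD ((K' + 1 : ℕ) : ℤ)] := by
        rw [Int.natCast_modEq_iff]
        exact congrArg Fin.val (congrFun h1 i)
      have e4 : |((a (t i) : ℕ) : ℤ) - ((a' (t i) : ℕ) : ℤ)| < K' := by exact_mod_cast e2
      have e5 : ((a (t i) : ℕ) : ℤ) - ((a' (t i) : ℕ) : ℤ) = 0 := by
        refine Int.eq_zero_of_abs_lt_dvd e3.symm.dvd (e4.trans ?_)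
        push_cast; omega
      ext
      omega
    have ha : a = a' := by
      funext k
      by_cases hk : ∃ i, t i = k
      · obtain ⟨i, rfl⟩ := hk
        exact hon i
      · exact hoff k hk
    rw [ha, hb]
  have hcard := Finset.card_le_card_of_injOn (t := (Finset.univ : Finset _)) Φ
    (fun _ _ => Finset.mem_coe.2 (Finset.mem_univ _)) hΦ
  simpa using hcard

end Spanning

/-! ### Multiscale digit expansions -/

section Walk

variable {d : ℕ} {ι : Type} [Fintype ι] {N : ℕ}

theorem norm_sum_digit_sub_le (z : ι → Euc d) (B : ℝ) (hz : ∀ i, ‖z i‖ ≤ B) (a b : ι → Fin N) :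
    ‖∑ i, (((a i : ℕ) : ℝ) - ((b i : ℕ) : ℝ)) • z i‖ ≤ Fintype.card ι * (N * B) := by
  refine (norm_sum_le _ _).trans ?_
  rw [← nsmul_eq_mul, ← Finset.card_univ]
  refine Finset.sum_le_card_nsmul _ _ _ fun i _ => ?_
  rw [norm_smul, Real.norm_eq_abs]
  have h1 : |((a i : ℕ) : ℝ) - ((b i : ℕ) : ℝ)| ≤ N := by
    have ha : ((a i : ℕ) : ℝ) ≤ N := by exact_mod_cast (a i).2.le
    have hb : ((b i : ℕ) : ℝ) ≤ N := by exact_mod_cast (b i).2.le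
    rw [abs_le]
    constructor <;> linarith [Nat.cast_nonneg (α := ℝ) (a i : ℕ),
      Nat.cast_nonneg (α := ℝ) (b i : ℕ)]
  exact mul_le_mul h1 (hz i) (norm_nonneg _) (Nat.cast_nonneg _)

/-- If changing the digit at level `t` moves `F` by `O(s N ^ (-t) * N)`, then the geometric series
of all these changes bounds the oscillation of `F`. -/
theorem norm_digitWalk_sub_le (hN : 2 ≤ N) (C : ℝ) (hC : 0 < C) (L : ℕ) :
    ∀ (s : ℝ) (_ : 0 < s) (F : (Fin L → ι → Fin N) → Euc d) (z : Fin L → ι → Euc d),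
      (∀ t i, ‖z t i‖ ≤ C * (s * (N : ℝ)⁻¹ ^ (t : ℕ))) →
      (∀ n t a, ‖F (Function.update n t a) - F n -
        ∑ i, (((a i : ℕ) : ℝ) - ((n t i : ℕ) : ℝ)) • z t i‖ ≤ C * (s * (N : ℝ)⁻¹ ^ (t : ℕ))) →
      ∀ n n', ‖F n - F n'‖ ≤ 2 * (Fintype.card ι + 1) * C * N * s := by
  have hN0 : (0 : ℝ) < N := by positivity
  have hN2 : (2 : ℝ) ≤ N := by exact_mod_cast hN
  induction L with
  | zero =>
    intro s hs F z _ _ n n'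
    rw [Subsingleton.elim n n', sub_self, norm_zero]
    positivity
  | succ L ih =>
    intro s hs F z hz hF n n'
    have e1 := hF n' 0 (n 0)
    have e2 := norm_sum_digit_sub_le (z 0) (C * (s * (N : ℝ)⁻¹ ^ ((0 : Fin (L + 1)) : ℕ)))
      (hz 0) (n 0) (n' 0)
    simp only [Fin.val_zero, pow_zero, mul_one] at e1 e2
    have e3 := ih (s * (N : ℝ)⁻¹) (by positivity) (fun p => F (Fin.cons (n 0) p))
      (fun t => z t.succ) (fun t i => by
        have := hz t.succ i
        rwa [Fin.val_succ, pow_succ', ← mul_assoc s] at this)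
      (fun p t a => by
        have := hF (Fin.cons (n 0) p) t.succ a
        rw [Fin.cons_update]
        rwa [Fin.val_succ, pow_succ', ← mul_assoc s] at this) (Fin.tail n) (Fin.tail n')
    simp only [Fin.cons_self_tail] at e3
    have e4 : Function.update n' 0 (n 0) = Fin.cons (n 0) (Fin.tail n') := by
      conv_lhs => rw [← Fin.cons_self_tail n']
      rw [Fin.update_cons_zero]
    rw [e4] at e1
    set x := F n
    set y := F (Fin.cons (n 0) (Fin.tail n'))
    set x' := F n'
    set S := ∑ i, (((n 0 i : ℕ) : ℝ) - ((n' 0 i : ℕ) : ℝ)) • z 0 i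
    have e5 : x - x' = (x - y) + ((y - x' - S) + S) := by abel
    have e6 : 2 * (Fintype.card ι + 1 : ℝ) * C * N * (s * (N : ℝ)⁻¹)
        = 2 * (Fintype.card ι + 1) * C * s := by field_simp
    rw [e6] at e3
    calc ‖x - x'‖ ≤ ‖x - y‖ + (‖y - x' - S‖ + ‖S‖) := by
          rw [e5]; exact (norm_add_le _ _).trans (by gcongr; exact norm_add_le _ _)
      _ ≤ 2 * (Fintype.card ι + 1) * C * s + (C * s + Fintype.card ι * (N * (C * s))) := by gcongr
      _ ≤ _ := by
        have h1 : 0 ≤ (Fintype.card ι : ℝ) * (C * s) := by positivity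
        have h2 : 0 < C * s := by positivity
        nlinarith [mul_le_mul_of_nonneg_right hN2 h1, mul_le_mul_of_nonneg_right hN2 h2.le]

open Classical in
/-- Small-ball estimate for multiscale digit expansions: every level at which the digit vectors
span in a quantitative sense contributes a factor comparable to `N ^ (-d)` to the probability of
falling into a ball of smaller radius. -/
theorem exists_card_digitWalk_le (d : ℕ) (c C : ℝ) (hc : 0 < c) (hC : 0 < C)
    (ι : Type) [Fintype ι] :
    ∃ K : ℕ, 0 < K ∧ ∀ (N : ℕ), 2 ≤ N → ∀ (L : ℕ) (s : ℝ) (_ : 0 < s)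
      (F : (Fin L → ι → Fin N) → Euc d) (z : Fin L → ι → Euc d) (cov : Fin L → Prop),
      (∀ t i, ‖z t i‖ ≤ C * (s * (N : ℝ)⁻¹ ^ (t : ℕ))) →
      (∀ n t a, ‖F (Function.update n t a) - F n -
        ∑ i, (((a i : ℕ) : ℝ) - ((n t i : ℕ) : ℝ)) • z t i‖ ≤ C * (s * (N : ℝ)⁻¹ ^ (t : ℕ))) →
      (∀ t, cov t → ∀ w : Euc d, ‖w‖ = 1 →
        ∃ i, c * (s * (N : ℝ)⁻¹ ^ (t : ℕ)) ≤ |inner ℝ (z t i) w|) →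
      ∀ (w : Euc d) (r : ℝ), ((Finset.univ.filter fun n => ‖F n - w‖ ≤ r).card : ℝ) ≤
        ∏ t : Fin L, (N : ℝ) ^ Fintype.card ι *
          (if cov t ∧ r ≤ s * (N : ℝ)⁻¹ ^ (t : ℕ) then ((K : ℝ) / N) ^ d else 1) := by
  obtain ⟨K, hK, hdig⟩ := exists_card_digits_le d c C
    (2 + 2 * (Fintype.card ι + 1) * C + C) hc hC
  refine ⟨K, hK, fun N hN L => ?_⟩
  have hN0 : (0 : ℝ) < N := by positivity
  induction L with
  | zero =>
    intro s hs F z cov _ _ _ w r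
    simpa using Finset.card_le_one.2 (fun a _ b _ => Subsingleton.elim a b)
  | succ L ih =>
    intro s hs F z cov hz hF hcov w r
    set Y : Finset (ι → Fin N) := Finset.univ.filter fun a => ∃ p, ‖F (Fin.cons a p) - w‖ ≤ r
      with hY
    have hrest : ∀ a, ((Finset.univ.filter fun p => ‖F (Fin.cons a p) - w‖ ≤ r).card : ℝ) ≤
        ∏ t : Fin L, (N : ℝ) ^ Fintype.card ι * (if cov t.succ ∧
          r ≤ s * (N : ℝ)⁻¹ ^ ((t.succ : Fin (L + 1)) : ℕ) then ((K : ℝ) / N) ^ d else 1) := by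
      intro a
      have := ih (s * (N : ℝ)⁻¹) (by positivity) (fun p => F (Fin.cons a p)) (fun t => z t.succ)
        (fun t => cov t.succ) (fun t i => by
          have := hz t.succ i
          rwa [Fin.val_succ, pow_succ', ← mul_assoc s] at this)
        (fun p t b => by
          have := hF (Fin.cons a p) t.succ b
          rw [Fin.cons_update]
          rwa [Fin.val_succ, pow_succ', ← mul_assoc s] at this)
        (fun t ht v hv => by
          have := hcov t.succ ht v hv
          rwa [Fin.val_succ, pow_succ', ← mul_assoc s] at this) w r
      simp only [Fin.val_succ, pow_succ', ← mul_assoc s]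
      exact this
    have hsplit : (Finset.univ.filter fun n => ‖F n - w‖ ≤ r).card ≤
        ∑ a ∈ Y, (Finset.univ.filter fun p => ‖F (Fin.cons a p) - w‖ ≤ r).card := by
      have hsub : (Finset.univ.filter fun n => ‖F n - w‖ ≤ r) ⊆ Y.biUnion fun a =>
          (Finset.univ.filter fun p => ‖F (Fin.cons a p) - w‖ ≤ r).image (Fin.cons a) := by
        intro n hn
        have hn' : ‖F (Fin.cons (n 0) (Fin.tail n)) - w‖ ≤ r := by
          rw [Fin.cons_self_tail]; exact (Finset.mem_filter.1 hn).2
        refine Finset.mem_biUnion.2 ⟨n 0, ?_, Finset.mem_image.2 ⟨Fin.tail n, ?_, ?_⟩⟩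
        · exact Finset.mem_filter.2 ⟨Finset.mem_univ _, Fin.tail n, hn'⟩
        · exact Finset.mem_filter.2 ⟨Finset.mem_univ _, hn'⟩
        · exact Fin.cons_self_tail n
      exact (Finset.card_le_card hsub).trans (Finset.card_biUnion_le.trans
        (Finset.sum_le_sum fun a _ => Finset.card_image_le))
    have hYcard : (Y.card : ℝ) ≤ (N : ℝ) ^ Fintype.card ι * (if cov 0 ∧
        r ≤ s * (N : ℝ)⁻¹ ^ ((0 : Fin (L + 1)) : ℕ) then ((K : ℝ) / N) ^ d else 1) := by
      split_ifs with hc0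
      · obtain ⟨hc0, hr⟩ := hc0
        simp only [Fin.val_zero, pow_zero, mul_one] at hr
        have key := hdig ι (fun i => s⁻¹ • z 0 i) (fun i => by
            have := hz 0 i
            rw [Fin.val_zero, pow_zero, mul_one] at this
            rw [norm_smul, norm_inv, Real.norm_of_nonneg hs.le, inv_mul_le_iff₀ hs, mul_comm]
            exact this)
          (fun v hv => by
            obtain ⟨i, hi⟩ := hcov 0 hc0 v hv
            rw [Fin.val_zero, pow_zero, mul_one] at hi
            refine ⟨i, ?_⟩
            rw [real_inner_smul_left, abs_mul, abs_inv, abs_of_pos hs, le_inv_mul_iff₀ hs, mul_comm]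
            exact hi) N Y (fun a ha b hb => ?_)
        · have hk' : (Y.card : ℝ) * (N : ℝ) ^ d ≤ (K : ℝ) ^ d * (N : ℝ) ^ Fintype.card ι := by
            exact_mod_cast key
          rw [div_pow, mul_div_assoc', le_div_iff₀ (by positivity)]
          linarith
        · obtain ⟨p, hp⟩ := (Finset.mem_filter.1 ha).2
          obtain ⟨q, hq⟩ := (Finset.mem_filter.1 hb).2
          have e1 := norm_digitWalk_sub_le hN C hC L (s * (N : ℝ)⁻¹) (by positivity)
            (fun p => F (Fin.cons b p)) (fun t => z t.succ) (fun t i => by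
              have := hz t.succ i
              rwa [Fin.val_succ, pow_succ', ← mul_assoc s] at this)
            (fun p t a => by
              have := hF (Fin.cons b p) t.succ a
              rw [Fin.cons_update]
              rwa [Fin.val_succ, pow_succ', ← mul_assoc s] at this) p q
          have e2 := hF (Fin.cons b p) 0 a
          simp only [Fin.update_cons_zero, Fin.val_zero, pow_zero, mul_one, Fin.cons_zero] at e1 e2
          have e3 : 2 * (Fintype.card ι + 1 : ℝ) * C * N * (s * (N : ℝ)⁻¹)
              = 2 * (Fintype.card ι + 1) * C * s := by field_simp
          rw [e3] at e1
          have e4 : ∑ i, (((a i : ℕ) : ℝ) - ((b i : ℕ) : ℝ)) • s⁻¹ • z 0 i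
              = s⁻¹ • ∑ i, (((a i : ℕ) : ℝ) - ((b i : ℕ) : ℝ)) • z 0 i := by
            rw [Finset.smul_sum]
            exact Finset.sum_congr rfl fun i _ => smul_comm _ _ _
          rw [e4, norm_smul, norm_inv, Real.norm_of_nonneg hs.le, inv_mul_le_iff₀ hs]
          set S := ∑ i, (((a i : ℕ) : ℝ) - ((b i : ℕ) : ℝ)) • z 0 i
          set x := F (Fin.cons a p)
          set y := F (Fin.cons b p)
          set x' := F (Fin.cons b q)
          have e5 : S = (x - w) - (x' - w) - (y - x') - (x - y - S) := by abel
          calc ‖S‖ ≤ ‖x - w‖ + ‖x' - w‖ + ‖y - x'‖ + ‖x - y - S‖ := by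
                conv_lhs => rw [e5]
                exact (norm_sub_le _ _).trans (by
                  gcongr
                  exact (norm_sub_le _ _).trans (by gcongr; exact norm_sub_le _ _))
            _ ≤ r + r + 2 * (Fintype.card ι + 1) * C * s + C * s := by gcongr
            _ ≤ _ := by nlinarith
      · rw [mul_one]
        have := Finset.card_le_univ Y
        simp only [Fintype.card_fun, Fintype.card_fin] at this
        exact_mod_cast this
    rw [Fin.prod_univ_succ]
    calc ((Finset.univ.filter fun n => ‖F n - w‖ ≤ r).card : ℝ)
        ≤ ∑ a ∈ Y, ((Finset.univ.filter fun p => ‖F (Fin.cons a p) - w‖ ≤ r).card : ℝ) := by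
          exact_mod_cast hsplit
      _ ≤ ∑ a ∈ Y, _ := Finset.sum_le_sum fun a _ => hrest a
      _ = Y.card * _ := by rw [Finset.sum_const, nsmul_eq_mul]
      _ ≤ _ := by
        gcongr

end Walk

/-! ### Binary trees in a non-concentrated set -/

section PatternSum

variable {V : Type*}

/-- The sum of `F l` over the patterns `l` obtained by choosing, for `i` consecutive scales from `j`
on, either no vector (with weight `m`) or a vector of the finite set `E j` (with weight `M`). -/
noncomputable def patternSum (m M : ℝ) (E : ℕ → Finset V) : ℕ → ℕ → (List V → ℝ) → ℝ
  | _, 0, F => F []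
  | j, i + 1, F => m * patternSum m M E (j + 1) i F +
      M * ∑ e ∈ E j, patternSum m M E (j + 1) i fun l => F (e :: l)

theorem patternSum_mono {m M : ℝ} (hm : 0 ≤ m) (hM : 0 ≤ M) (E : ℕ → Finset V) (i : ℕ) :
    ∀ (j : ℕ) (F G : List V → ℝ), (∀ l, F l ≤ G l) →
      patternSum m M E j i F ≤ patternSum m M E j i G := by
  induction i with
  | zero => exact fun j F G h => h []
  | succ i ih =>
    intro j F G h
    simp only [patternSum]
    gcongr with e he
    · exact ih _ _ _ h
    · exact ih _ _ _ fun l => h _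

theorem patternSum_add (m M : ℝ) (E : ℕ → Finset V) (i : ℕ) : ∀ (j : ℕ) (F G : List V → ℝ),
    patternSum m M E j i (fun l => F l + G l) =
      patternSum m M E j i F + patternSum m M E j i G := by
  induction i with
  | zero => exact fun j F G => rfl
  | succ i ih =>
    intro j F G
    simp only [patternSum, ih, Finset.sum_add_distrib]
    ring

theorem patternSum_const_mul (m M : ℝ) (E : ℕ → Finset V) (a : ℝ) (i : ℕ) :
    ∀ (j : ℕ) (F : List V → ℝ),
      patternSum m M E j i (fun l => a * F l) = a * patternSum m M E j i F := by
  induction i with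
  | zero => exact fun j F => rfl
  | succ i ih =>
    intro j F
    simp only [patternSum, ih, ← Finset.mul_sum]
    ring

theorem patternSum_zero (m M : ℝ) (E : ℕ → Finset V) (i j : ℕ) :
    patternSum m M E j i (fun _ => 0) = 0 := by
  simpa using patternSum_const_mul m M E 0 i j fun _ => 0

theorem patternSum_sum {ι : Type*} (m M : ℝ) (E : ℕ → Finset V) (i j : ℕ) (s : Finset ι)
    (F : ι → List V → ℝ) : patternSum m M E j i (fun l => ∑ p ∈ s, F p l) =
      ∑ p ∈ s, patternSum m M E j i (F p) := by
  classical
  induction s using Finset.induction_on with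
  | empty => simpa using patternSum_zero m M E i j
  | insert p s hp ih =>
    simp only [Finset.sum_insert hp, patternSum_add, ih]

theorem patternSum_pow_length_le {m M y Q : ℝ} (hm : 0 ≤ m) (hM : 0 ≤ M) (hy : 0 ≤ y) (hQ : 0 ≤ Q)
    (E : ℕ → Finset V) (hE : ∀ j, ((E j).card : ℝ) ≤ Q) (i : ℕ) : ∀ j : ℕ,
    patternSum m M E j i (fun l => y ^ l.length) ≤ (m + M * Q * y) ^ i := by
  induction i with
  | zero => intro j; simp [patternSum]
  | succ i ih =>
    intro j
    have h1 : ∀ e : V, patternSum m M E (j + 1) i (fun l => y ^ (e :: l).length)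
        = y * patternSum m M E (j + 1) i (fun l => y ^ l.length) := by
      intro e
      rw [← patternSum_const_mul]
      simp [pow_succ']
    simp only [patternSum, h1, Finset.sum_const, nsmul_eq_mul]
    have h0 : 0 ≤ patternSum m M E (j + 1) i (fun l => y ^ l.length) := by
      refine (patternSum_zero m M E i (j + 1)).ge.trans ?_
      exact patternSum_mono hm hM E i _ _ _ fun l => by positivity
    calc m * patternSum m M E (j + 1) i (fun l => y ^ l.length) + M * ((E j).card *
          (y * patternSum m M E (j + 1) i (fun l => y ^ l.length)))
        ≤ m * patternSum m M E (j + 1) i (fun l => y ^ l.length) + M * (Q *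
          (y * patternSum m M E (j + 1) i (fun l => y ^ l.length))) := by
          gcongr; exact hE j
      _ = (m + M * Q * y) * patternSum m M E (j + 1) i (fun l => y ^ l.length) := by ring
      _ ≤ (m + M * Q * y) * (m + M * Q * y) ^ i := by gcongr; exact ih _
      _ = _ := by ring

end PatternSum

section Tree

variable {V : Type*} [NormedAddCommGroup V]

/-- `SplitsAlong ε η l B` says that `B` contains a binary tree with `l.length` generations, such
that all the nodes of one generation split into two parts whose difference is the same vector, the
corresponding entry `e` of `l`, up to an error `ε * ‖e‖`. All entries have norm at least `η`. -/
def SplitsAlong (ε η : ℝ) : List V → Set V → Prop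
  | [], B => B.Nonempty
  | e :: l, B => ∃ B₀ B₁ : Set V, B₀ ⊆ B ∧ B₁ ⊆ B ∧ SplitsAlong ε η l B₀ ∧ SplitsAlong ε η l B₁ ∧
      (∀ x ∈ B₀, ∀ y ∈ B₀, ‖x - y‖ ≤ ε * ‖e‖) ∧ (∀ x ∈ B₁, ∀ y ∈ B₁, ‖x - y‖ ≤ ε * ‖e‖) ∧
      (∀ x ∈ B₁, ∀ y ∈ B₀, ‖x - y - e‖ ≤ ε * ‖e‖) ∧ η ≤ ‖e‖

theorem SplitsAlong.mono {ε η : ℝ} {l : List V} {B B' : Set V} (h : SplitsAlong ε η l B)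
    (hB : B ⊆ B') : SplitsAlong ε η l B' := by
  cases l with
  | nil => exact Set.Nonempty.mono hB h
  | cons e l =>
    obtain ⟨B₀, B₁, h0, h1, h2⟩ := h
    exact ⟨B₀, B₁, h0.trans hB, h1.trans hB, h2⟩

theorem SplitsAlong.nonempty {ε η : ℝ} {l : List V} : ∀ {B : Set V}, SplitsAlong ε η l B →
    B.Nonempty := by
  induction l with
  | nil => exact fun h => h
  | cons e l ih =>
    rintro B ⟨B₀, B₁, h0, h1, h2, -⟩
    exact (ih h2).mono h0

/-- The leaves of a binary tree, labelled by sequences of bits: two leaves whose labels agree before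
place `j` differ by the difference of their `j`-th bits times the `j`-th splitting vector. -/
theorem SplitsAlong.exists_leaves [NormedSpace ℝ V] {ε η : ℝ} {l : List V} :
    ∀ {B : Set V}, SplitsAlong ε η l B →
    ∃ x : (ℕ → Bool) → V, (∀ ω, x ω ∈ B) ∧ ∀ j < l.length, η ≤ ‖l.getD j 0‖ ∧
      ∀ ω ω' : ℕ → Bool, (∀ i < j, ω i = ω' i) →
        ‖x ω - x ω' - (((ω j).toNat : ℝ) - ((ω' j).toNat : ℝ)) • l.getD j 0‖
          ≤ ε * ‖l.getD j 0‖ := by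
  induction l with
  | nil =>
    intro B h
    obtain ⟨b, hb⟩ := h
    exact ⟨fun _ => b, fun _ => hb, fun j hj => absurd hj (Nat.not_lt_zero j)⟩
  | cons e l ih =>
    rintro B ⟨B₀, B₁, h0, h1, s0, s1, d0, d1, d01, he⟩
    obtain ⟨x₀, hx₀, hl₀⟩ := ih s0
    obtain ⟨x₁, hx₁, hl₁⟩ := ih s1
    refine ⟨fun ω => if ω 0 then x₁ fun i => ω (i + 1) else x₀ fun i => ω (i + 1), fun ω => ?_, ?_⟩
    · dsimp only
      split_ifs
      · exact h1 (hx₁ _)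
      · exact h0 (hx₀ _)
    · intro j hj
      cases j with
      | zero =>
        refine ⟨by simpa using he, fun ω ω' _ => ?_⟩
        cases hω : ω 0 <;> cases hω' : ω' 0 <;> simp [hω, hω']
        · exact d0 _ (hx₀ _) _ (hx₀ _)
        · rw [← norm_neg]
          have := d01 _ (hx₁ fun i => ω' (i + 1)) _ (hx₀ fun i => ω (i + 1))
          rwa [neg_add', neg_sub]
        · exact d01 _ (hx₁ _) _ (hx₀ _)
        · exact d1 _ (hx₁ _) _ (hx₁ _)
      | succ j =>
        have hj' : j < l.length := by simpa using hj
        refine ⟨by simpa using (hl₀ j hj').1, fun ω ω' h => ?_⟩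
        have hz : ω 0 = ω' 0 := h 0 (Nat.succ_pos j)
        have hs : ∀ i < j, ω (i + 1) = ω' (i + 1) := fun i hi => h (i + 1) (by omega)
        simp only [List.getD_cons_succ]
        cases hω' : ω' 0
        · simpa [hz, hω'] using (hl₀ j hj').2 _ _ hs
        · simpa [hz, hω'] using (hl₁ j hj').2 _ _ hs

open Classical in
/-- The mass of a set is controlled by the number of binary trees it contains: `β` bounds the mass
of a set at the finest scale `r ^ (j + i)`, the weight `m` bounds the number of neighbouring pieces
of one generation, and `M` the number of all pieces. -/
theorem measureReal_le_patternSum [NormedSpace ℝ V] [MeasurableSpace V]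
    (μ : Measure V) [IsFiniteMeasure μ]
    {ε r β : ℝ} {m M : ℕ} (hε : 0 < ε) (hε1 : ε ≤ 1) (hr : 0 < r) (hr1 : r ≤ 1)
    (E : ℕ → Finset V)
    (hm : ∀ (s : ℝ) (c : V) (P : Finset V), 0 < s → (∀ p ∈ P, ‖p - c‖ ≤ (1 + 3 / ε) * s) →
      (∀ p ∈ P, ∀ q ∈ P, p ≠ q → s < ‖p - q‖) → P.card ≤ m)
    (hM : ∀ (s : ℝ) (c : V), 0 < s → ∃ P : Finset V, P.card ≤ M ∧
      (∀ p ∈ P, ∀ q ∈ P, p ≠ q → s < ‖p - q‖) ∧ ∀ x, ‖x - c‖ ≤ 2 / r * s → ∃ p ∈ P, ‖x - p‖ ≤ s)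
    (hE : ∀ j x, ‖x‖ ≤ 4 * r ^ j → ∃ e ∈ E j, ‖x - e‖ ≤ r ^ (j + 1)) (L : ℕ)
    (hβ : ∀ Y : Set V, (∀ x ∈ Y, ∀ y ∈ Y, ‖x - y‖ ≤ 2 * r ^ L) → μ.real Y ≤ β) (hβ0 : 0 ≤ β)
    (i : ℕ) : ∀ (j : ℕ) (B : Set V), j + i = L → (∀ x ∈ B, ∀ y ∈ B, ‖x - y‖ ≤ 2 * r ^ j) →
      μ.real B ≤ β * patternSum m M E j i fun l => if SplitsAlong ε (r ^ L) l B then 1 else 0 := by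
  induction i with
  | zero =>
    intro j B hj hB
    by_cases h : SplitsAlong ε (r ^ L) [] B
    · simp only [patternSum, if_pos h, mul_one]
      refine hβ B ?_
      rw [← hj]
      exact hB
    · have hBe : B = ∅ := Set.not_nonempty_iff_eq_empty.1 h
      simp only [patternSum, if_neg h, mul_zero]
      rw [hBe, measureReal_empty]
  | succ i ih =>
    intro j B hj hB
    rcases B.eq_empty_or_nonempty with rfl | ⟨b, hb⟩
    · rw [measureReal_empty]
      refine mul_nonneg hβ0 ?_
      refine (patternSum_zero (m : ℝ) M E (i + 1) j).ge.trans ?_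
      exact patternSum_mono (by positivity) (by positivity) E _ _ _ _ fun l => by
        split_ifs <;> norm_num
    set s := r ^ (j + 1) with hs
    have hs0 : 0 < s := by positivity
    have hsr : s = r * r ^ j := by rw [hs, pow_succ']
    have hsle : s ≤ r ^ j := by
      rw [hsr]; exact mul_le_of_le_one_left (by positivity) hr1
    obtain ⟨P, hPc, hPs, hPn⟩ := hM s b hs0
    set Bp : V → Set V := fun p => B ∩ {x | ‖x - p‖ ≤ s} with hBp
    have hcover : B ⊆ ⋃ p ∈ P, Bp p := by
      intro x hx
      obtain ⟨p, hp, hxp⟩ := hPn x (by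
        have := hB x hx b hb
        rw [hsr]
        field_simp
        linarith)
      exact Set.mem_iUnion₂.2 ⟨p, hp, hx, hxp⟩
    have hmass : μ.real B ≤ ∑ p ∈ P, μ.real (Bp p) :=
      (measureReal_mono hcover (measure_ne_top _ _)).trans (measureReal_biUnion_finset_le P Bp)
    have hpiece : ∀ p ∈ P, μ.real (Bp p) ≤ β * patternSum m M E (j + 1) i fun l =>
        if SplitsAlong ε (r ^ L) l (Bp p) then 1 else 0 := by
      intro p _
      refine ih (j + 1) (Bp p) (by omega) fun x hx y hy => ?_
      have e : x - y = (x - p) - (y - p) := by abel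
      rw [e]
      linarith [norm_sub_le (x - p) (y - p), hx.2.out, hy.2.out]
    have hpoint : ∀ l : List V, ∑ p ∈ P, (if SplitsAlong ε (r ^ L) l (Bp p) then (1 : ℝ) else 0) ≤
        m * (if SplitsAlong ε (r ^ L) l B then 1 else 0) +
          M * ∑ e ∈ E j, (if SplitsAlong ε (r ^ L) (e :: l) B then 1 else 0) := by
      intro l
      rw [Finset.sum_boole]
      set C := P.filter fun p => SplitsAlong ε (r ^ L) l (Bp p) with hC
      have hnn : (0 : ℝ) ≤ M * ∑ e ∈ E j, (if SplitsAlong ε (r ^ L) (e :: l) B then 1 else 0) :=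
        mul_nonneg (Nat.cast_nonneg _) (Finset.sum_nonneg fun e _ => by split_ifs <;> norm_num)
      rcases C.eq_empty_or_nonempty with hCe | ⟨p₀, hp₀⟩
      · rw [hCe, Finset.card_empty, Nat.cast_zero]
        refine add_nonneg (mul_nonneg (Nat.cast_nonneg _) ?_) hnn
        split_ifs <;> norm_num
      have hBl : SplitsAlong ε (r ^ L) l B :=
        (Finset.mem_filter.1 hp₀).2.mono Set.inter_subset_left
      rw [if_pos hBl, mul_one]
      by_cases hfar : ∀ p ∈ C, ‖p - p₀‖ ≤ (1 + 3 / ε) * s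
      · have : (C.card : ℝ) ≤ m := by
          exact_mod_cast hm s p₀ C hs0 hfar fun p hp q hq =>
            hPs p (Finset.mem_filter.1 hp).1 q (Finset.mem_filter.1 hq).1
        linarith
      · push Not at hfar
        obtain ⟨p, hp, hpp⟩ := hfar
        have hSp := (Finset.mem_filter.1 hp).2
        have hSq := (Finset.mem_filter.1 hp₀).2
        obtain ⟨x, hx⟩ := hSp.nonempty
        obtain ⟨y, hy⟩ := hSq.nonempty
        have hclose : ‖p - p₀‖ ≤ 4 * r ^ j := by
          have e : p - p₀ = (x - y) - (x - p) + (y - p₀) := by abel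
          rw [e]
          have h1 := norm_add_le ((x - y) - (x - p)) (y - p₀)
          have h2 := norm_sub_le (x - y) (x - p)
          linarith [hB x hx.1 y hy.1, hx.2.out, hy.2.out]
        obtain ⟨e, heE, hpe⟩ := hE j _ hclose
        have hnorm : 3 / ε * s ≤ ‖e‖ := by
          have := norm_sub_norm_le (p - p₀) e
          rw [← hs] at hpe
          linarith
        have h3s : 3 * s ≤ ε * ‖e‖ := by
          calc 3 * s = ε * (3 / ε * s) := by field_simp
            _ ≤ _ := by gcongr
        have hdiam : ∀ q, ∀ x ∈ Bp q, ∀ y ∈ Bp q, ‖x - y‖ ≤ ε * ‖e‖ := by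
          intro q x hx y hy
          have e : x - y = (x - q) - (y - q) := by abel
          rw [e]
          linarith [norm_sub_le (x - q) (y - q), hx.2.out, hy.2.out]
        have hsplit : SplitsAlong ε (r ^ L) (e :: l) B := by
          refine ⟨Bp p₀, Bp p, Set.inter_subset_left, Set.inter_subset_left, hSq, hSp, hdiam p₀,
            hdiam p, fun x hx y hy => ?_, ?_⟩
          · have e' : x - y - e = (x - p) - (y - p₀) + (p - p₀ - e) := by abel
            rw [e']
            have h1 := norm_add_le ((x - p) - (y - p₀)) (p - p₀ - e)
            have h2 := norm_sub_le (x - p) (y - p₀)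
            linarith [hx.2.out, hy.2.out]
          · have h1 : r ^ L ≤ s := by
              rw [hs]
              exact pow_le_pow_of_le_one hr.le hr1 (by omega)
            nlinarith [norm_nonneg e]
        have h1 : (1 : ℝ) ≤ ∑ e ∈ E j, (if SplitsAlong ε (r ^ L) (e :: l) B then 1 else 0) := by
          rw [Finset.sum_boole]
          have : 0 < ((E j).filter fun e => SplitsAlong ε (r ^ L) (e :: l) B).card :=
            Finset.card_pos.2 ⟨e, Finset.mem_filter.2 ⟨heE, hsplit⟩⟩
          exact_mod_cast this
        have h2 : (C.card : ℝ) ≤ M := by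
          exact_mod_cast (Finset.card_filter_le _ _).trans hPc
        have h3 : (0 : ℝ) ≤ m := Nat.cast_nonneg m
        nlinarith [Nat.cast_nonneg (α := ℝ) M]
    calc μ.real B ≤ ∑ p ∈ P, β * patternSum m M E (j + 1) i fun l =>
          if SplitsAlong ε (r ^ L) l (Bp p) then 1 else 0 := hmass.trans (Finset.sum_le_sum hpiece)
      _ = β * patternSum m M E (j + 1) i fun l =>
          ∑ p ∈ P, if SplitsAlong ε (r ^ L) l (Bp p) then 1 else 0 := by
          rw [patternSum_sum, Finset.mul_sum]
      _ ≤ β * patternSum m M E (j + 1) i fun l =>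
          (m * (if SplitsAlong ε (r ^ L) l B then 1 else 0) +
          M * ∑ e ∈ E j, (if SplitsAlong ε (r ^ L) (e :: l) B then 1 else 0)) := by
          gcongr
          exact patternSum_mono (by positivity) (by positivity) E _ _ _ _ hpoint
      _ = _ := by
          rw [patternSum_add, patternSum_const_mul, patternSum_const_mul, patternSum_sum]
          rfl

open Classical in
/-- A non-concentrated probability measure on the unit ball charges long binary trees: the number of
generations is a positive proportion of the number `L` of scales. -/
theorem exists_splitsAlong [NormedSpace ℝ V] [FiniteDimensional ℝ V] [MeasurableSpace V]
    {ε κ c : ℝ} (hε : 0 < ε)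
    (hε1 : ε ≤ 1) (hκ : 0 < κ) (hc : 0 < c) :
    ∃ r : ℝ, 0 < r ∧ r < 1 / 4 ∧ ∃ α : ℝ, 0 < α ∧ ∀ (L : ℕ), 1 ≤ L → ∀ (μ : Measure V)
      [IsFiniteMeasure μ] (B : Set V), μ.real B = 1 → (∀ b ∈ B, ‖b‖ ≤ 1) →
      (∀ Y : Set V, (∀ x ∈ Y, ∀ y ∈ Y, ‖x - y‖ ≤ 2 * r ^ L) → μ.real Y ≤ c * (3 * r ^ L) ^ κ) →
      ∃ l : List V, α * L ≤ l.length ∧ SplitsAlong ε (r ^ L) l B := by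
  obtain ⟨m, hm⟩ := exists_card_le_of_separated (V := V) (1 + 3 / ε)
  set D : ℝ := max 1 (c * 3 ^ κ) with hD
  have hD1 : 1 ≤ D := le_max_left _ _
  obtain ⟨r, hr0, hr4, hrκ⟩ : ∃ r : ℝ, 0 < r ∧ r < 1 / 4 ∧ D * r ^ κ * (m + 1) ≤ 1 / 4 := by
    have ht : Filter.Tendsto (fun r : ℝ => D * r ^ κ * (m + 1)) (nhdsWithin 0 (Set.Ioi 0))
        (nhds 0) := by
      have h1 : Filter.Tendsto (fun r : ℝ => r ^ κ) (nhdsWithin 0 (Set.Ioi 0)) (nhds 0) := by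
        have := (Real.continuous_rpow_const hκ.le).tendsto 0
        rw [Real.zero_rpow hκ.ne'] at this
        exact this.mono_left nhdsWithin_le_nhds
      simpa using (h1.const_mul D).mul_const ((m : ℝ) + 1)
    have h2 := ht.eventually (gt_mem_nhds (show (0 : ℝ) < 1 / 4 by norm_num))
    have h3 : ∀ᶠ r : ℝ in nhdsWithin 0 (Set.Ioi 0), r < 1 / 4 :=
      nhdsWithin_le_nhds (gt_mem_nhds (by norm_num))
    obtain ⟨r, h4, h5, h6⟩ := (h2.and (h3.and self_mem_nhdsWithin)).exists
    exact ⟨r, h6, h5, h4.le⟩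
  obtain ⟨M, hM⟩ := exists_separated_net (V := V) (2 / r)
  obtain ⟨Q, hQ⟩ := exists_separated_net (V := V) (4 / r)
  have hE : ∀ j : ℕ, ∃ E : Finset V, E.card ≤ Q ∧
      ∀ x, ‖x‖ ≤ 4 * r ^ j → ∃ e ∈ E, ‖x - e‖ ≤ r ^ (j + 1) := by
    intro j
    obtain ⟨E, h1, -, h2⟩ := hQ (r ^ (j + 1)) 0 (by positivity)
    refine ⟨E, h1, fun x hx => h2 x ?_⟩
    rw [sub_zero, pow_succ]
    field_simp
    exact hx
  choose E hEc hEn using hE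
  set X : ℝ := M * Q + 2 with hX
  have hX2 : 2 ≤ X := by rw [hX]; linarith [show (0 : ℝ) ≤ M * Q by positivity]
  have hlX : 0 < Real.log X := Real.log_pos (by linarith)
  have hl2 : 0 < Real.log 2 := Real.log_pos (by norm_num)
  refine ⟨r, hr0, hr4, Real.log 2 / Real.log X, by positivity, fun L hL μ _ B hB hB1 hμ => ?_⟩
  by_contra! hno
  have h1 := measureReal_le_patternSum μ hε hε1 hr0 (by linarith) E hm hM hEn L hμ (by positivity)
    L 0 B (by omega) (fun x hx y hy => by
      rw [pow_zero, mul_one]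
      linarith [norm_sub_le x y, hB1 x hx, hB1 y hy])
  have h2 : ∀ l : List V, (if SplitsAlong ε (r ^ L) l B then (1 : ℝ) else 0) ≤
      2 ^ L * X⁻¹ ^ l.length := by
    intro l
    split_ifs with h
    · have hlen : (l.length : ℝ) < Real.log 2 / Real.log X * L := by
        by_contra! hle
        exact hno l hle h
      have : X ^ l.length ≤ 2 ^ L := by
        rw [← Real.log_le_log_iff (by positivity) (by positivity), Real.log_pow, Real.log_pow]
        rw [div_mul_eq_mul_div, lt_div_iff₀ hlX] at hlen
        linarith
      rw [inv_pow, ← div_eq_mul_inv, le_div_iff₀ (by positivity), one_mul]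
      exact this
    · positivity
  have h3 := patternSum_mono (Nat.cast_nonneg m) (Nat.cast_nonneg M) E L 0 _ _ h2
  rw [patternSum_const_mul] at h3
  have h4 := patternSum_pow_length_le (Nat.cast_nonneg m) (Nat.cast_nonneg M)
    (show (0 : ℝ) ≤ X⁻¹ by positivity) (Nat.cast_nonneg Q) E (fun j => by exact_mod_cast hEc j) L 0
  have h5 : (m + M * Q * X⁻¹ : ℝ) ^ L ≤ (m + 1) ^ L := by
    gcongr
    rw [← div_eq_mul_inv, div_le_one (by linarith)]
    linarith
  have h6 : c * (3 * r ^ L) ^ κ ≤ (D * r ^ κ) ^ L := by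
    rw [Real.mul_rpow (by norm_num) (by positivity), ← mul_assoc, mul_pow, ← Real.rpow_natCast r L,
      ← Real.rpow_mul hr0.le, mul_comm (L : ℝ) κ, Real.rpow_mul hr0.le, Real.rpow_natCast]
    gcongr
    exact (le_max_right _ _).trans (le_self_pow₀ hD1 (by omega))
  have h7 : (1 : ℝ) ≤ (D * r ^ κ) ^ L * (2 ^ L * (m + 1) ^ L) := by
    refine hB.ge.trans (h1.trans ?_)
    have : patternSum (m : ℝ) M E 0 L (fun l => if SplitsAlong ε (r ^ L) l B then 1 else 0) ≤
        2 ^ L * (m + 1) ^ L := h3.trans (by gcongr; exact h4.trans h5)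
    calc _ ≤ c * (3 * r ^ L) ^ κ * (2 ^ L * (m + 1) ^ L) := by gcongr
      _ ≤ _ := by gcongr
  have h8 : (D * r ^ κ) ^ L * (2 ^ L * (m + 1) ^ L) ≤ (1 / 2 : ℝ) ^ L := by
    rw [← mul_pow, ← mul_pow]
    gcongr
    linarith
  have h9 : (1 / 2 : ℝ) ^ L < 1 := pow_lt_one₀ (by norm_num) (by norm_num) (by omega)
  linarith

end Tree

/-! ### Sums of many elements of a set of positive density -/

section Schnirelmann

open Classical in
/-- Schnirelmann's inequality on an initial segment: if `B` has at least `β * n` elements in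
`[1, n]` for all `n ≤ L`, then a fraction `β` of the complement of `A` lies in `A + B`. -/
theorem card_add_ge_of_density {A B C : Set ℕ} {β : ℝ} {L : ℕ} (hA : 0 ∈ A) (hB0 : 0 ∈ B)
    (hC : ∀ a ∈ A, ∀ b ∈ B, a + b ∈ C)
    (hB : ∀ n ≤ L, β * n ≤ ((Finset.Icc 1 n).filter (· ∈ B)).card) :
    ∀ n ≤ L, (((Finset.Icc 1 n).filter (· ∈ A)).card : ℝ) +
      β * (n - ((Finset.Icc 1 n).filter (· ∈ A)).card) ≤ ((Finset.Icc 1 n).filter (· ∈ C)).card := by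
  intro n
  induction n using Nat.strong_induction_on with
  | _ n ih =>
    intro hn
    rcases Nat.eq_zero_or_pos n with rfl | hn0
    · simp
    by_cases hnA : n ∈ A
    · obtain ⟨m, rfl⟩ : ∃ m, n = m + 1 := ⟨n - 1, by omega⟩
      have hstep : ∀ D : Set ℕ, m + 1 ∈ D → ((Finset.Icc 1 (m + 1)).filter (· ∈ D)).card =
          ((Finset.Icc 1 m).filter (· ∈ D)).card + 1 := by
        intro D hD
        rw [← Finset.insert_Icc_right_eq_Icc_add_one (by omega), Finset.filter_insert, if_pos hD,
          Finset.card_insert_of_notMem]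
        simp
      have h1 := ih m (by omega) (by omega)
      rw [hstep A hnA, hstep C (by simpa using hC _ hnA _ hB0)]
      push_cast
      linarith
    · -- the largest element of `A` below `n`
      obtain ⟨a, haA, han, hmax⟩ : ∃ a ∈ A, a < n ∧ ∀ x ∈ A, x ≤ n → x ≤ a := by
        have hne : ((Finset.range (n + 1)).filter (· ∈ A)).Nonempty :=
          ⟨0, by simp [hA]⟩
        obtain ⟨a, ha, hmax⟩ := Finset.exists_max_image _ id hne
        simp only [Finset.mem_filter, Finset.mem_range, id] at ha hmax
        refine ⟨a, ha.2, lt_of_le_of_ne (by omega) ?_, fun x hx hxn => hmax x ⟨by omega, hx⟩⟩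
        rintro rfl
        exact hnA ha.2
      have h1 := ih a han (by omega)
      have h2 := hB (n - a) (by omega)
      have hAcard : ((Finset.Icc 1 n).filter (· ∈ A)) = ((Finset.Icc 1 a).filter (· ∈ A)) := by
        ext x
        simp only [Finset.mem_filter, Finset.mem_Icc]
        constructor
        · rintro ⟨⟨h3, h4⟩, h5⟩
          exact ⟨⟨h3, hmax x h5 h4⟩, h5⟩
        · rintro ⟨⟨h3, h4⟩, h5⟩
          exact ⟨⟨h3, by omega⟩, h5⟩
      have hCcard : ((Finset.Icc 1 a).filter (· ∈ C)).card +
          ((Finset.Icc 1 (n - a)).filter (· ∈ B)).card ≤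
            ((Finset.Icc 1 n).filter (· ∈ C)).card := by
        have h3 : ((Finset.Icc 1 (n - a)).filter (· ∈ B)).card =
            (((Finset.Icc 1 (n - a)).filter (· ∈ B)).image (a + ·)).card :=
          (Finset.card_image_of_injective _ (add_right_injective a)).symm
        rw [h3, ← Finset.card_union_of_disjoint]
        · refine Finset.card_le_card fun x hx => ?_
          rcases Finset.mem_union.1 hx with hx | hx
          · simp only [Finset.mem_filter, Finset.mem_Icc] at hx ⊢
            exact ⟨⟨hx.1.1, by omega⟩, hx.2⟩
          · obtain ⟨y, hy, rfl⟩ := Finset.mem_image.1 hx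
            simp only [Finset.mem_filter, Finset.mem_Icc] at hy ⊢
            exact ⟨⟨by omega, by omega⟩, hC _ haA _ hy.2⟩
        · rw [Finset.disjoint_left]
          intro x hx hx'
          obtain ⟨y, hy, rfl⟩ := Finset.mem_image.1 hx'
          simp only [Finset.mem_filter, Finset.mem_Icc] at hx hy
          omega
      rw [hAcard]
      have hCcard' : (((Finset.Icc 1 a).filter (· ∈ C)).card : ℝ) +
          ((Finset.Icc 1 (n - a)).filter (· ∈ B)).card ≤
            ((Finset.Icc 1 n).filter (· ∈ C)).card := by
        exact_mod_cast hCcard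
      rw [Nat.cast_sub han.le] at h2
      linarith

open Classical in
/-- If a set containing `0` has density at least `α` in all intervals `[1, n]` with `n ≤ L`, then
each `n ≤ L` is a sum of `k` of its elements, where `k` depends only on `α`. -/
theorem exists_sum_of_density {α : ℝ} (hα : 0 < α) (hα1 : α ≤ 1) :
    ∃ k : ℕ, ∀ (L : ℕ) (A : Set ℕ), 0 ∈ A →
      (∀ n ≤ L, α * n ≤ ((Finset.Icc 1 n).filter (· ∈ A)).card) →
      ∀ n ≤ L, ∃ a : Fin k → ℕ, (∀ i, a i ∈ A) ∧ ∑ i, a i = n := by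
  obtain ⟨k, hk⟩ := exists_pow_lt_of_lt_one (show (0 : ℝ) < 1 / 2 by norm_num)
    (show 1 - α < 1 by linarith)
  refine ⟨k + k, fun L A hA0 hA => ?_⟩
  let C : ℕ → Set ℕ := fun j => {n | ∃ a : Fin j → ℕ, (∀ i, a i ∈ A) ∧ ∑ i, a i = n}
  have hC0 : ∀ j, 0 ∈ C j := fun j => ⟨fun _ => 0, fun _ => hA0, by simp⟩
  have hCs : ∀ j, ∀ a ∈ A, ∀ b ∈ C j, a + b ∈ C (j + 1) := by
    rintro j a ha b ⟨f, hf, rfl⟩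
    refine ⟨Fin.cons a f, fun i => ?_, by simp [Fin.sum_univ_succ]⟩
    refine Fin.cases ?_ (fun i => ?_) i
    · simpa using ha
    · simpa using hf i
  have hdens : ∀ j, ∀ n ≤ L, (1 - (1 - α) ^ j) * n ≤ ((Finset.Icc 1 n).filter (· ∈ C j)).card := by
    intro j
    induction j with
    | zero => intro n _; simp
    | succ j ih =>
      intro n hn
      have h1 := card_add_ge_of_density hA0 (hC0 j) (hCs j) ih n hn
      have h2 := hA n hn
      have h3 : 0 ≤ (1 - α) ^ j := pow_nonneg (by linarith) j
      rw [pow_succ]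
      nlinarith
  intro n hn
  -- `n - C k` meets `C k` inside `[0, n]`, as both have more than half of the elements
  set X := (Finset.range (n + 1)).filter (· ∈ C k) with hX
  have hXc : (n : ℝ) / 2 + 1 ≤ X.card := by
    have h1 : X = insert 0 ((Finset.Icc 1 n).filter (· ∈ C k)) := by
      ext x
      simp only [hX, Finset.mem_filter, Finset.mem_range, Finset.mem_insert, Finset.mem_Icc]
      constructor
      · rintro ⟨h1, h2⟩
        rcases Nat.eq_zero_or_pos x with h | h
        · exact Or.inl h
        · exact Or.inr ⟨⟨h, by omega⟩, h2⟩
      · rintro (rfl | ⟨h1, h2⟩)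
        · exact ⟨by omega, hC0 k⟩
        · exact ⟨by omega, h2⟩
    rw [h1, Finset.card_insert_of_notMem (by simp)]
    push_cast
    have h2 := hdens k n hn
    have h3 : (0 : ℝ) ≤ n := Nat.cast_nonneg n
    nlinarith
  have hYX : (X.image (n - ·)).card = X.card := by
    refine Finset.card_image_of_injOn fun x hx y hy hxy => ?_
    simp only [hX, Finset.coe_filter, Finset.mem_range, Set.mem_ofPred_eq] at hx hy hxy
    omega
  have hnd : ¬ Disjoint X (X.image (n - ·)) := by
    intro hd
    have h1 : (X ∪ X.image (n - ·)).card ≤ (Finset.range (n + 1)).card := by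
      refine Finset.card_le_card fun x hx => ?_
      rcases Finset.mem_union.1 hx with h | h
      · exact (Finset.mem_filter.1 h).1
      · obtain ⟨y, -, rfl⟩ := Finset.mem_image.1 h
        exact Finset.mem_range.2 (by omega)
    rw [Finset.card_union_of_disjoint hd, hYX, Finset.card_range] at h1
    have h2 : (X.card : ℝ) + X.card ≤ n + 1 := by exact_mod_cast h1
    linarith
  obtain ⟨x, hx, hx'⟩ := Finset.not_disjoint_iff.1 hnd
  obtain ⟨y, hy, hyx⟩ := Finset.mem_image.1 hx'
  simp only [hX, Finset.mem_filter, Finset.mem_range] at hx hy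
  obtain ⟨a, ha, hax⟩ := hx.2
  obtain ⟨b, hb, hby⟩ := hy.2
  refine ⟨Fin.append a b, fun i => ?_, ?_⟩
  · refine Fin.addCases (fun i => ?_) (fun i => ?_) i
    · simpa using ha i
    · rw [Fin.append_right]; exact hb i
  · rw [Fin.sum_univ_add]
    simp only [Fin.append_left, Fin.append_right, hax, hby]
    omega

end Schnirelmann

/-! ### The ring generated by a set of linear maps -/

section Generated

variable {d : ℕ}

/-- The linear maps obtained from elements of `S` by at most `k` successive rounds of additions,
subtractions and compositions. -/
def generated (S : Set (LinEuc d)) : ℕ → Set (LinEuc d)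
  | 0 => S
  | k + 1 => {h | ∃ f ∈ generated S k, ∃ g ∈ generated S k,
      h = f ∨ h = f + g ∨ h = f - g ∨ h = f * g}

variable {S : Set (LinEuc d)}

theorem generated_mono {j k : ℕ} (hjk : j ≤ k) : generated S j ⊆ generated S k := by
  induction hjk with
  | refl => exact subset_rfl
  | step _ ih => exact ih.trans fun f hf => ⟨f, hf, f, hf, Or.inl rfl⟩

theorem add_mem_generated {k : ℕ} {f g : LinEuc d} (hf : f ∈ generated S k)
    (hg : g ∈ generated S k) : f + g ∈ generated S (k + 1) :=
  ⟨f, hf, g, hg, Or.inr (Or.inl rfl)⟩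

theorem sub_mem_generated {k : ℕ} {f g : LinEuc d} (hf : f ∈ generated S k)
    (hg : g ∈ generated S k) : f - g ∈ generated S (k + 1) :=
  ⟨f, hf, g, hg, Or.inr (Or.inr (Or.inl rfl))⟩

theorem mul_mem_generated {k : ℕ} {f g : LinEuc d} (hf : f ∈ generated S k)
    (hg : g ∈ generated S k) : f * g ∈ generated S (k + 1) :=
  ⟨f, hf, g, hg, Or.inr (Or.inr (Or.inr rfl))⟩

theorem sum_mem_generated {ι : Type*} {k : ℕ} (hS : S.Nonempty) (s : Finset ι) (f : ι → LinEuc d)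
    (hf : ∀ i ∈ s, f i ∈ generated S k) : ∑ i ∈ s, f i ∈ generated S (k + 1 + s.card) := by
  classical
  induction s using Finset.induction_on with
  | empty =>
    obtain ⟨g, hg⟩ := hS
    rw [Finset.sum_empty, ← sub_self g]
    exact generated_mono (by omega) (sub_mem_generated (k := 0) hg hg)
  | insert i s hi ih =>
    rw [Finset.sum_insert hi, Finset.card_insert_of_notMem hi, ← add_assoc]
    refine add_mem_generated (generated_mono (by omega) (hf i (Finset.mem_insert_self _ _)))
      (ih fun j hj => hf j (Finset.mem_insert_of_mem hj))

theorem two_pow_smul_mem_generated {k : ℕ} {f : LinEuc d} (hf : f ∈ generated S k) (c : ℕ) :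
    (2 ^ c : ℝ) • f ∈ generated S (k + c) := by
  induction c with
  | zero => simpa using hf
  | succ c ih =>
    have : (2 ^ (c + 1) : ℝ) • f = (2 ^ c : ℝ) • f + (2 ^ c : ℝ) • f := by
      rw [← two_smul ℝ ((2 ^ c : ℝ) • f), smul_smul, pow_succ']
    rw [this]
    exact add_mem_generated ih ih

theorem norm_le_of_mem_generated (hS : ∀ f ∈ S, ‖f‖ ≤ 1) (k : ℕ) :
    ∀ f ∈ generated S k, ‖f‖ ≤ 2 ^ 2 ^ k := by
  induction k with
  | zero => intro f hf; exact (hS f hf).trans (by norm_num)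
  | succ k ih =>
    have h2 : (2 : ℝ) ≤ 2 ^ 2 ^ k := le_self_pow₀ (by norm_num) (by positivity)
    have h3 : (2 : ℝ) ^ 2 ^ (k + 1) = 2 ^ 2 ^ k * 2 ^ 2 ^ k := by
      rw [← pow_add, pow_succ]; ring_nf
    rintro h ⟨f, hf, g, hg, rfl | rfl | rfl | rfl⟩ <;> rw [h3] <;>
      have hf' := ih _ hf <;> have hg' := ih _ hg
    · nlinarith [norm_nonneg h]
    · nlinarith [norm_add_le f g]
    · nlinarith [norm_sub_le f g]
    · exact (norm_mul_le f g).trans (mul_le_mul hf' hg' (norm_nonneg _) (by positivity))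

end Generated

/-! ### Transversal sets of linear maps -/

section Transversal

variable {d : ℕ}

/-- A set of linear maps of norm at most `1` that moves every direction to every other direction,
with an inner product of size at least `ρ`. -/
structure TransversalSet (ρ : ℝ) (U : Set (LinEuc d)) : Prop where
  norm_le : ∀ u ∈ U, ‖u‖ ≤ 1
  exists_le : ∀ v w : Euc d, ‖v‖ = 1 → ‖w‖ = 1 → ∃ u ∈ U, ρ ≤ |inner ℝ (u v) w|

theorem exists_unit_half_norm_le (hd : 0 < d) (f : LinEuc d) :
    ∃ v : Euc d, ‖v‖ = 1 ∧ ‖f‖ / 2 ≤ ‖f v‖ := by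
  have : NeZero d := ⟨hd.ne'⟩
  rcases eq_or_ne f 0 with rfl | hf
  · exact ⟨EuclideanSpace.single 0 1, by simp, by simp⟩
  · have hf' : 0 < ‖f‖ := norm_pos_iff.2 hf
    obtain ⟨x, hx, hfx⟩ := f.exists_lt_apply_of_lt_opNorm (half_lt_self hf')
    have hx0 : x ≠ 0 := by
      rintro rfl
      rw [map_zero, norm_zero] at hfx
      linarith
    refine ⟨‖x‖⁻¹ • x, norm_smul_inv_norm hx0, ?_⟩
    have hxp : 0 < ‖x‖ := norm_pos_iff.2 hx0
    rw [map_smul, norm_smul, norm_inv, norm_norm, le_inv_mul_iff₀ hxp]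
    nlinarith

namespace TransversalSet

variable {ρ : ℝ} {U : Set (LinEuc d)}

theorem nonempty (hd : 0 < d) (h : TransversalSet ρ U) : U.Nonempty := by
  have : NeZero d := ⟨hd.ne'⟩
  obtain ⟨u, hu, -⟩ := h.exists_le (EuclideanSpace.single 0 1) (EuclideanSpace.single 0 1)
    (by simp) (by simp)
  exact ⟨u, hu⟩

theorem le_one (hd : 0 < d) (h : TransversalSet ρ U) : ρ ≤ 1 := by
  have : NeZero d := ⟨hd.ne'⟩
  obtain ⟨u, hu, hρ⟩ := h.exists_le (EuclideanSpace.single 0 1) (EuclideanSpace.single 0 1)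
    (by simp) (by simp)
  refine hρ.trans ((abs_real_inner_le_norm _ _).trans ?_)
  have := u.le_opNorm (EuclideanSpace.single 0 1)
  have h1 := h.norm_le u hu
  simp at this ⊢
  linarith

theorem exists_inner_ge (hd : 0 < d) (h : TransversalSet ρ U) (v w : Euc d) :
    ∃ u ∈ U, ρ * ‖v‖ * ‖w‖ ≤ |inner ℝ (u v) w| := by
  rcases eq_or_ne v 0 with rfl | hv
  · obtain ⟨u, hu⟩ := h.nonempty hd
    exact ⟨u, hu, by simp⟩
  rcases eq_or_ne w 0 with rfl | hw
  · obtain ⟨u, hu⟩ := h.nonempty hd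
    exact ⟨u, hu, by simp⟩
  obtain ⟨u, hu, hρ⟩ := h.exists_le (‖v‖⁻¹ • v) (‖w‖⁻¹ • w) (norm_smul_inv_norm hv)
    (norm_smul_inv_norm hw)
  refine ⟨u, hu, ?_⟩
  have hv' : 0 < ‖v‖ := norm_pos_iff.2 hv
  have hw' : 0 < ‖w‖ := norm_pos_iff.2 hw
  rw [map_smul, real_inner_smul_left, real_inner_smul_right, abs_mul, abs_mul, abs_inv, abs_inv,
    abs_norm, abs_norm, le_inv_mul_iff₀ hv', le_inv_mul_iff₀ hw'] at hρ
  linarith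

theorem exists_norm_ge (hd : 0 < d) (h : TransversalSet ρ U) (hρ : 0 ≤ ρ) (f : LinEuc d)
    (v : Euc d) : ∃ u ∈ U, ρ / 2 * ‖f‖ * ‖v‖ ≤ ‖f (u v)‖ := by
  obtain ⟨w, hw, hfw⟩ := exists_unit_half_norm_le hd (ContinuousLinearMap.adjoint f)
  rw [LinearIsometryEquiv.norm_map] at hfw
  obtain ⟨u, hu, h1⟩ := h.exists_inner_ge hd v (ContinuousLinearMap.adjoint f w)
  refine ⟨u, hu, ?_⟩
  rw [ContinuousLinearMap.adjoint_inner_right] at h1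
  have h2 := abs_real_inner_le_norm (f (u v)) w
  rw [hw, mul_one] at h2
  calc ρ / 2 * ‖f‖ * ‖v‖ = ρ * ‖v‖ * (‖f‖ / 2) := by ring
    _ ≤ ρ * ‖v‖ * ‖ContinuousLinearMap.adjoint f w‖ := by gcongr
    _ ≤ _ := h1.trans h2

/-- Compositions of linear maps do not lose norm if a suitable transversal map is inserted. -/
theorem exists_norm_mul_ge (hd : 0 < d) (h : TransversalSet ρ U) (hρ : 0 ≤ ρ) (g f : LinEuc d) :
    ∃ u ∈ U, ρ / 4 * ‖g‖ * ‖f‖ ≤ ‖g * u * f‖ := by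
  obtain ⟨v, hv, hfv⟩ := exists_unit_half_norm_le hd f
  obtain ⟨u, hu, h1⟩ := h.exists_norm_ge hd hρ g (f v)
  refine ⟨u, hu, ?_⟩
  have h2 := (g * u * f).le_opNorm v
  rw [hv, mul_one] at h2
  calc ρ / 4 * ‖g‖ * ‖f‖ = ρ / 2 * ‖g‖ * (‖f‖ / 2) := by ring
    _ ≤ ρ / 2 * ‖g‖ * ‖f v‖ := by gcongr
    _ ≤ _ := h1.trans h2

theorem exists_inner_mul_ge (hd : 0 < d) (h : TransversalSet ρ U) (hρ : 0 ≤ ρ) (g f : LinEuc d)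
    (v w : Euc d) : ∃ u₁ ∈ U, ∃ u₂ ∈ U, ∃ u₃ ∈ U,
      ρ ^ 3 / 4 * (‖g‖ * ‖f‖) * ‖v‖ * ‖w‖ ≤ |inner ℝ ((u₁ * g * u₂ * f * u₃) v) w| := by
  obtain ⟨u₃, hu₃, h3⟩ := h.exists_norm_ge hd hρ f v
  obtain ⟨u₂, hu₂, h2⟩ := h.exists_norm_ge hd hρ g (f (u₃ v))
  obtain ⟨u₁, hu₁, h1⟩ := h.exists_inner_ge hd (g (u₂ (f (u₃ v)))) w
  refine ⟨u₁, hu₁, u₂, hu₂, u₃, hu₃, le_trans ?_ h1⟩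
  calc ρ ^ 3 / 4 * (‖g‖ * ‖f‖) * ‖v‖ * ‖w‖ = ρ * (ρ / 2 * ‖g‖ * (ρ / 2 * ‖f‖ * ‖v‖)) * ‖w‖ := by
        ring
    _ ≤ ρ * (ρ / 2 * ‖g‖ * ‖f (u₃ v)‖) * ‖w‖ := by gcongr
    _ ≤ _ := by gcongr

/-- A transversal set contains a transversal subfamily, of size bounded in terms of `d` and `ρ`
only, at the price of halving `ρ`. -/
theorem exists_finite_subfamily (hd : 0 < d) (hρ : 0 < ρ) :
    ∃ R : ℕ, ∀ U : Set (LinEuc d), TransversalSet ρ U →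
      ∃ u : Fin R → LinEuc d, (∀ i, u i ∈ U) ∧ TransversalSet (ρ / 2) (Set.range u) := by
  obtain ⟨M, hM⟩ := exists_separated_net (V := LinEuc d) (4 / ρ)
  obtain ⟨P, hPM, -, hP⟩ := hM (ρ / 4) 0 (by positivity)
  refine ⟨P.card, fun U hU => ?_⟩
  classical
  obtain ⟨u₀, hu₀⟩ := hU.nonempty hd
  let e := P.equivFin.symm
  let u : Fin P.card → LinEuc d := fun i =>
    if h : ∃ u ∈ U, ‖u - e i‖ ≤ ρ / 4 then h.choose else u₀
  have huU : ∀ i, u i ∈ U := by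
    intro i
    simp only [u]
    split_ifs with h
    · exact h.choose_spec.1
    · exact hu₀
  refine ⟨u, huU, ⟨?_, fun v w hv hw => ?_⟩⟩
  · rintro _ ⟨i, rfl⟩
    exact hU.norm_le _ (huU i)
  · obtain ⟨f, hf, hρf⟩ := hU.exists_le v w hv hw
    obtain ⟨p, hp, hfp⟩ := hP f (by
      rw [sub_zero]
      refine (hU.norm_le f hf).trans (le_of_eq ?_)
      field_simp)
    set i := P.equivFin ⟨p, hp⟩ with hi
    have hei : (e i : LinEuc d) = p := by simp [e, hi]
    have hex : ∃ u ∈ U, ‖u - e i‖ ≤ ρ / 4 := ⟨f, hf, by rwa [hei]⟩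
    refine ⟨u i, ⟨i, rfl⟩, ?_⟩
    have hui : ‖u i - p‖ ≤ ρ / 4 := by
      have h0 : u i = hex.choose := dif_pos hex
      have h1 : ‖u i - e i‖ ≤ ρ / 4 := by rw [h0]; exact hex.choose_spec.2
      rwa [hei] at h1
    have h1 : ‖f - u i‖ ≤ ρ / 2 := by
      have : f - u i = (f - p) - (u i - p) := by abel
      rw [this]
      linarith [norm_sub_le (f - p) (u i - p)]
    have h2 : |inner ℝ ((f - u i) v) w| ≤ ρ / 2 := by
      refine (abs_real_inner_le_norm _ _).trans ?_
      rw [hw, mul_one]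
      refine ((f - u i).le_opNorm v).trans ?_
      rwa [hv, mul_one]
    have h3 : inner ℝ (f v) w = inner ℝ ((f - u i) v) w + inner ℝ (u i v) w := by
      rw [← inner_add_left]; simp
    have h4 := abs_add_le (inner ℝ ((f - u i) v) w) (inner ℝ (u i v) w)
    rw [← h3] at h4
    linarith

end TransversalSet

end Transversal

/-! ### Linear maps of prescribed norm -/

section Scales

open Classical in
/-- If the differences of a set avoid the scale between `2 * r ^ (l + 1)` and `2 * r ^ l`, then the
set need not be subdivided when passing to the next scale; so its mass is controlled by the number
of scales that do occur. -/
theorem measureReal_le_pow_card_scales {V : Type*} [NormedAddCommGroup V] [MeasurableSpace V]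
    (μ : Measure V) [IsFiniteMeasure μ] {r β : ℝ} {M : ℕ} (hr : 0 < r) (hM1 : 1 ≤ M)
    (hM : ∀ (s : ℝ) (c : V), 0 < s → ∃ P : Finset V, P.card ≤ M ∧
      ∀ x, ‖x - c‖ ≤ 2 / r * s → ∃ p ∈ P, ‖x - p‖ ≤ s) (B : Set V) (L : ℕ)
    (hβ : ∀ Y : Set V, (∀ x ∈ Y, ∀ y ∈ Y, ‖x - y‖ ≤ 2 * r ^ L) → μ.real Y ≤ β) (hβ0 : 0 ≤ β)
    (i : ℕ) : ∀ (j : ℕ) (Y : Set V), j + i = L → Y ⊆ B → (∀ x ∈ Y, ∀ y ∈ Y, ‖x - y‖ ≤ 2 * r ^ j) →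
      μ.real Y ≤ β * M ^ ((Finset.Ico j L).filter fun l =>
        ∃ b ∈ B, ∃ b' ∈ B, 2 * r ^ (l + 1) < ‖b - b'‖ ∧ ‖b - b'‖ ≤ 2 * r ^ l).card := by
  have hM1' : (1 : ℝ) ≤ M := by exact_mod_cast hM1
  induction i with
  | zero =>
    intro j Y hj _ hY
    refine (hβ Y (by rw [← hj]; exact hY)).trans ?_
    exact le_mul_of_one_le_right hβ0 (one_le_pow₀ hM1')
  | succ i ih =>
    intro j Y hj hYB hY
    rw [← Finset.insert_Ico_add_one_left_eq_Ico (show j < L by omega), Finset.filter_insert]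
    split_ifs with hocc
    · rw [Finset.card_insert_of_notMem (by simp), pow_succ]
      rcases Y.eq_empty_or_nonempty with rfl | ⟨b, hb⟩
      · rw [measureReal_empty]; positivity
      obtain ⟨P, hPc, hPn⟩ := hM (r ^ (j + 1)) b (by positivity)
      have hcover : Y ⊆ ⋃ p ∈ P, Y ∩ {x | ‖x - p‖ ≤ r ^ (j + 1)} := by
        intro x hx
        obtain ⟨p, hp, hxp⟩ := hPn x (by
          refine (hY x hx b hb).trans (le_of_eq ?_)
          rw [pow_succ]
          field_simp)
        exact Set.mem_iUnion₂.2 ⟨p, hp, hx, hxp⟩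
      set m := ((Finset.Ico (j + 1) L).filter fun l =>
        ∃ b ∈ B, ∃ b' ∈ B, 2 * r ^ (l + 1) < ‖b - b'‖ ∧ ‖b - b'‖ ≤ 2 * r ^ l).card
      calc μ.real Y ≤ ∑ p ∈ P, μ.real (Y ∩ {x | ‖x - p‖ ≤ r ^ (j + 1)}) :=
            (measureReal_mono hcover (measure_ne_top _ _)).trans (measureReal_biUnion_finset_le P _)
        _ ≤ ∑ p ∈ P, β * M ^ m := by
            refine Finset.sum_le_sum fun p _ => ih (j + 1) _ (by omega)
              (Set.inter_subset_left.trans hYB) fun x hx y hy => ?_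
            have e : x - y = (x - p) - (y - p) := by abel
            rw [e]
            linarith [norm_sub_le (x - p) (y - p), hx.2.out, hy.2.out]
        _ = P.card * (β * M ^ m) := by rw [Finset.sum_const, nsmul_eq_mul]
        _ ≤ M * (β * M ^ m) := by gcongr
        _ = _ := by ring
    · refine ih (j + 1) Y (by omega) hYB fun x hx y hy => ?_
      by_contra! hlt
      exact hocc ⟨x, hYB hx, y, hYB hy, hlt, hY x hx y hy⟩

variable {d : ℕ}

open Classical in
/-- Sums and products of boundedly many elements of a non-concentrated set of linear maps, together
with a transversal set, realize all norms, up to constants: the norms of differences realize a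
positive proportion of all scales, products add up scales, and Schnirelmann's theorem applies. -/
theorem exists_generated_norm_eq (hd : 0 < d) {ρ κ c : ℝ} (hρ : 0 < ρ) (hκ : 0 < κ) (hc : 0 < c) :
    ∃ r : ℝ, 0 < r ∧ r < 1 / 4 ∧ ∃ (k : ℕ) (c₁ C₁ : ℝ), 0 < c₁ ∧ 0 < C₁ ∧
      ∀ (L : ℕ) (μ : Measure (LinEuc d)) [IsFiniteMeasure μ] (B U S : Set (LinEuc d)),
        μ.real B = 1 → (∀ b ∈ B, ‖b‖ ≤ 1) → TransversalSet ρ U → B ⊆ S → U ⊆ S → 1 ∈ S →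
        (∀ l, 1 ≤ l → l ≤ L → ∀ Y : Set (LinEuc d),
          (∀ x ∈ Y, ∀ y ∈ Y, ‖x - y‖ ≤ 2 * r ^ l) → μ.real Y ≤ c * (3 * r ^ l) ^ κ) →
        ∀ l ≤ L, ∃ g ∈ generated S k, c₁ * r ^ l ≤ ‖g‖ ∧ ‖g‖ ≤ C₁ * r ^ l := by
  set D : ℝ := max 1 (c * 3 ^ κ) with hD
  have hD1 : 1 ≤ D := le_max_left _ _
  obtain ⟨r, hr0, hr4, hrκ⟩ : ∃ r : ℝ, 0 < r ∧ r < 1 / 4 ∧ D * r ^ κ ≤ 1 / 2 := by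
    have ht : Filter.Tendsto (fun r : ℝ => D * r ^ κ) (nhdsWithin 0 (Set.Ioi 0)) (nhds 0) := by
      have h1 : Filter.Tendsto (fun r : ℝ => r ^ κ) (nhdsWithin 0 (Set.Ioi 0)) (nhds 0) := by
        have := (Real.continuous_rpow_const hκ.le).tendsto 0
        rw [Real.zero_rpow hκ.ne'] at this
        exact this.mono_left nhdsWithin_le_nhds
      simpa using h1.const_mul D
    have h2 := ht.eventually (gt_mem_nhds (show (0 : ℝ) < 1 / 2 by norm_num))
    have h3 : ∀ᶠ r : ℝ in nhdsWithin 0 (Set.Ioi 0), r < 1 / 4 :=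
      nhdsWithin_le_nhds (gt_mem_nhds (by norm_num))
    obtain ⟨r, h4, h5, h6⟩ := (h2.and (h3.and self_mem_nhdsWithin)).exists
    exact ⟨r, h6, h5, h4.le⟩
  obtain ⟨M₀, hM₀⟩ := exists_separated_net (V := LinEuc d) (2 / r)
  set M : ℕ := M₀ + 2 with hM
  have hM2 : (2 : ℝ) ≤ M := by rw [hM]; push_cast; linarith [Nat.cast_nonneg (α := ℝ) M₀]
  have hlM : 0 < Real.log M := Real.log_pos (by linarith)
  have hl2 : 0 < Real.log 2 := Real.log_pos (by norm_num)
  obtain ⟨k, hk⟩ := exists_sum_of_density (α := Real.log 2 / Real.log M) (by positivity)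
    ((div_le_one hlM).2 (Real.log_le_log (by norm_num) hM2))
  refine ⟨r, hr0, hr4, k + 2, (ρ / 4) ^ k, (2 / r) ^ k, by positivity, by positivity,
    fun L μ _ B U S hB hB1 hU hBS hUS h1S hμ => ?_⟩
  set A : Set ℕ := {a | a = 0 ∨ ∃ l, a = l + 1 ∧
    ∃ b ∈ B, ∃ b' ∈ B, 2 * r ^ (l + 1) < ‖b - b'‖ ∧ ‖b - b'‖ ≤ 2 * r ^ l} with hA
  have hdens : ∀ n ≤ L, Real.log 2 / Real.log M * n ≤ ((Finset.Icc 1 n).filter (· ∈ A)).card := by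
    intro n hn
    rcases Nat.eq_zero_or_pos n with rfl | hn0
    · simp
    set m := ((Finset.Ico 0 n).filter fun l =>
        ∃ b ∈ B, ∃ b' ∈ B, 2 * r ^ (l + 1) < ‖b - b'‖ ∧ ‖b - b'‖ ≤ 2 * r ^ l).card with hm
    have hmA : m ≤ ((Finset.Icc 1 n).filter (· ∈ A)).card := by
      refine Finset.card_le_card_of_injOn (· + 1) (fun l hl => ?_)
        (fun x _ y _ h => by simpa using h)
      simp only [Finset.coe_filter, Finset.mem_Ico, Set.mem_ofPred_eq] at hl
      simp only [Finset.coe_filter, Finset.mem_Icc, Set.mem_ofPred_eq]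
      exact ⟨⟨by omega, by omega⟩, Or.inr ⟨l, rfl, hl.2⟩⟩
    have h1 := measureReal_le_pow_card_scales μ hr0 (M := M) (by omega)
      (fun s c hs => by
        obtain ⟨P, h1, -, h2⟩ := hM₀ s c hs
        exact ⟨P, by omega, h2⟩) B n (hμ n hn0 hn) (by positivity) n 0 B (by omega) subset_rfl
      (fun x hx y hy => by
        rw [pow_zero, mul_one]
        linarith [norm_sub_le x y, hB1 x hx, hB1 y hy])
    rw [hB, ← hm] at h1
    have h2 : c * (3 * r ^ n) ^ κ ≤ (1 / 2) ^ n := by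
      calc c * (3 * r ^ n) ^ κ ≤ (D * r ^ κ) ^ n := by
            rw [Real.mul_rpow (by norm_num) (by positivity), ← mul_assoc, mul_pow,
              ← Real.rpow_natCast r n, ← Real.rpow_mul hr0.le, mul_comm (n : ℝ) κ,
              Real.rpow_mul hr0.le, Real.rpow_natCast]
            gcongr
            exact (le_max_right _ _).trans (le_self_pow₀ hD1 (by omega))
        _ ≤ _ := by gcongr
    have h3 : (2 : ℝ) ^ n ≤ M ^ m := by
      have h4 : (1 : ℝ) ≤ (1 / 2) ^ n * M ^ m := h1.trans (by gcongr)
      calc (2 : ℝ) ^ n = 2 ^ n * 1 := (mul_one _).symm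
        _ ≤ 2 ^ n * ((1 / 2) ^ n * M ^ m) := by gcongr
        _ = M ^ m := by rw [← mul_assoc, ← mul_pow]; norm_num
    rw [← Real.log_le_log_iff (by positivity) (by positivity), Real.log_pow, Real.log_pow] at h3
    rw [div_mul_eq_mul_div, div_le_iff₀ hlM]
    have h5 : (m : ℝ) * Real.log M ≤ ((Finset.Icc 1 n).filter (· ∈ A)).card * Real.log M := by
      gcongr
    linarith
  have hprod : ∀ (j : ℕ) (a : Fin j → ℕ), (∀ i, a i ∈ A) → ∃ g ∈ generated S (j + 2),
      (ρ / 4) ^ j * r ^ (∑ i, a i) ≤ ‖g‖ ∧ ‖g‖ ≤ (2 / r) ^ j * r ^ (∑ i, a i) := by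
    intro j
    have : NeZero d := ⟨hd.ne'⟩
    have hρ1 := hU.le_one hd
    have h2r : 1 ≤ 2 / r := by rw [le_div_iff₀ hr0]; linarith
    induction j with
    | zero =>
      intro a _
      refine ⟨1, generated_mono (k := 2) (Nat.zero_le _) h1S, ?_⟩
      simp
    | succ j ih =>
      intro a ha
      obtain ⟨g, hg, hg1, hg2⟩ := ih (fun i => a i.succ) fun i => ha i.succ
      rw [Fin.sum_univ_succ]
      set n := ∑ i : Fin j, a i.succ
      rcases ha 0 with h0 | ⟨l, hl, b, hb, b', hb', hlt, hle⟩
      · refine ⟨g, generated_mono (by omega) hg, ?_, ?_⟩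
        · rw [h0, zero_add, pow_succ]
          refine le_trans ?_ hg1
          gcongr
          exact mul_le_of_le_one_right (by positivity) (by linarith)
        · rw [h0, zero_add, pow_succ]
          refine hg2.trans ?_
          gcongr
          exact le_mul_of_one_le_right (by positivity) h2r
      · obtain ⟨u, hu, hug⟩ := hU.exists_norm_mul_ge hd hρ.le (b - b') g
        refine ⟨(b - b') * u * g, ?_, ?_, ?_⟩
        · have h1 : b - b' ∈ generated S 1 := sub_mem_generated (k := 0) (hBS hb) (hBS hb')
          have h2 : (b - b') * u ∈ generated S 2 :=
            mul_mem_generated h1 (generated_mono (Nat.zero_le _)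
              (show u ∈ generated S 0 from hUS hu))
          have := mul_mem_generated (generated_mono (show 2 ≤ j + 2 by omega) h2) hg
          exact this
        · refine le_trans ?_ hug
          rw [hl, pow_succ, pow_add]
          calc (ρ / 4) ^ j * (ρ / 4) * (r ^ (l + 1) * r ^ n)
              = ρ / 4 * r ^ (l + 1) * ((ρ / 4) ^ j * r ^ n) := by ring
            _ ≤ ρ / 4 * ‖b - b'‖ * ‖g‖ := by
              gcongr
              linarith [show 0 < r ^ (l + 1) by positivity]
        · rw [hl, pow_succ, pow_add]
          calc ‖(b - b') * u * g‖ ≤ ‖b - b'‖ * ‖u‖ * ‖g‖ :=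
                (norm_mul_le _ _).trans (by gcongr; exact norm_mul_le _ _)
            _ ≤ (2 * r ^ l) * 1 * ((2 / r) ^ j * r ^ n) := by
                gcongr
                exact hU.norm_le u hu
            _ = _ := by field_simp; ring
  intro l hl
  obtain ⟨a, ha, hal⟩ := hk L A (Or.inl rfl) (fun n hn => by convert hdens n hn) l hl
  obtain ⟨g, hg, h1, h2⟩ := hprod k a ha
  rw [hal] at h1 h2
  exact ⟨g, hg, h1, h2⟩

end Scales

/-! ### Random linear maps built from trees -/

section Expansion

open Classical in
/-- If each of the sets `Λ m`, `m ∈ W`, contains a proportion `p` of `I`, then `k` suitable elements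
of `I` hit all but a proportion `(1 - p) ^ k` of these sets. -/
theorem exists_hitting_family {p : ℝ} (hp1 : p ≤ 1) {α β : Type*} (I : Finset β)
    (hI : I.Nonempty) (W : Finset α) (Λ : α → Finset β) (hΛI : ∀ m ∈ W, Λ m ⊆ I)
    (hΛ : ∀ m ∈ W, p * I.card ≤ (Λ m).card) (k : ℕ) :
    ∃ f : Fin k → β, (∀ i, f i ∈ I) ∧
      ((W.filter fun m => ∀ i, f i ∉ Λ m).card : ℝ) ≤ (1 - p) ^ k * W.card := by
  induction k with
  | zero => exact ⟨Fin.elim0, fun i => i.elim0, by simp⟩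
  | succ k ih =>
    obtain ⟨f, hf, hfW⟩ := ih
    set X := W.filter fun m => ∀ i, f i ∉ Λ m with hX
    have hXW : ∀ m ∈ X, m ∈ W := fun m hm => (Finset.mem_filter.1 hm).1
    obtain ⟨b, hb, hbX⟩ : ∃ b ∈ I, p * X.card ≤ (X.filter fun m => b ∈ Λ m).card := by
      by_contra! h
      have h1 : ∑ b ∈ I, ((X.filter fun m => b ∈ Λ m).card : ℝ) = ∑ m ∈ X, ((Λ m).card : ℝ) := by
        have := Finset.sum_card_bipartiteAbove_eq_sum_card_bipartiteBelow (s := I) (t := X)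
          (fun b m => b ∈ Λ m)
        simp only [Finset.bipartiteAbove, Finset.bipartiteBelow] at this
        have h2 : ∀ m ∈ X, (I.filter fun b => b ∈ Λ m) = Λ m := by
          intro m hm
          rw [Finset.filter_mem_eq_inter, Finset.inter_eq_right.2 (hΛI m (hXW m hm))]
        rw [Finset.sum_congr rfl fun m hm => congrArg Finset.card (h2 m hm)] at this
        exact_mod_cast this
      have h3 : ∑ b ∈ I, ((X.filter fun m => b ∈ Λ m).card : ℝ) < I.card * (p * X.card) := by
        rw [← nsmul_eq_mul, ← Finset.sum_const]
        exact Finset.sum_lt_sum_of_nonempty hI h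
      have h4 : X.card * (p * I.card) ≤ ∑ m ∈ X, ((Λ m).card : ℝ) := by
        rw [← nsmul_eq_mul, ← Finset.sum_const]
        exact Finset.sum_le_sum fun m hm => hΛ m (hXW m hm)
      nlinarith
    refine ⟨Fin.cons b f, fun i => ?_, ?_⟩
    · refine Fin.cases ?_ (fun i => ?_) i
      · simpa using hb
      · simpa using hf i
    · have h1 : (W.filter fun m => ∀ i : Fin (k + 1), (Fin.cons b f : Fin (k + 1) → β) i ∉ Λ m)
          = X.filter fun m => b ∉ Λ m := by
        ext m
        simp only [hX, Finset.mem_filter, Fin.forall_fin_succ, Fin.cons_zero, Fin.cons_succ]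
        tauto
      have h2 := Finset.card_filter_add_card_filter_not (s := X) (fun m => b ∈ Λ m)
      have h3 : ((X.filter fun m => b ∈ Λ m).card : ℝ) + (X.filter fun m => b ∉ Λ m).card
          = X.card := by exact_mod_cast h2
      rw [h1, pow_succ]
      nlinarith [mul_le_mul_of_nonneg_left hfW (sub_nonneg.2 hp1)]

theorem sum_two_pow_mul_testBit (q : ℕ) : ∀ a : ℕ, a < 2 ^ q →
    ∑ c ∈ Finset.range q, 2 ^ c * (a.testBit c).toNat = a := by
  induction q with
  | zero => intro a ha; simp at ha; simp [ha]
  | succ q ih =>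
    intro a ha
    have h1 := ih (a / 2) (by rw [pow_succ] at ha; omega)
    rw [Finset.sum_range_succ']
    simp only [Nat.testBit_succ, pow_succ, pow_zero, one_mul, Nat.testBit_zero]
    have h2 : ∑ c ∈ Finset.range q, 2 ^ c * 2 * ((a / 2).testBit c).toNat
        = 2 * ∑ c ∈ Finset.range q, 2 ^ c * ((a / 2).testBit c).toNat := by
      rw [Finset.mul_sum]
      exact Finset.sum_congr rfl fun c _ => by ring
    rw [h2, h1]
    rcases Nat.mod_two_eq_zero_or_one a with h | h <;> simp [h] <;> omega

variable {d : ℕ}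

/-- The data of a multiscale digit expansion in linear maps: a transversal family `u`, linear maps
`g i` that adjust scales, a binary tree of linear maps with leaves `x` and splitting vectors `e`,
and an assignment of a scale adjustment `shift t` and a generation `gen t` of the tree to each
covered level `t`. -/
structure DigitExpansion (d : ℕ) where
  /-- the number of transversal maps -/
  R : ℕ
  /-- the number of scale adjustments -/
  k₀ : ℕ
  /-- the number of binary digits at each level -/
  q : ℕ
  /-- the number of levels -/
  L : ℕ
  /-- the transversal maps -/
  u : Fin R → LinEuc d
  /-- the scale adjustments -/
  g : Fin k₀ → LinEuc d
  /-- the leaves of the tree -/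
  x : (ℕ → Bool) → LinEuc d
  /-- the splitting vectors of the tree -/
  e : ℕ → LinEuc d
  /-- the covered levels -/
  cov : Fin L → Prop
  /-- the scale adjustment used at a level -/
  shift : Fin L → Fin k₀
  /-- the generation of the tree used at a level -/
  gen : Fin L → ℕ

namespace DigitExpansion

variable (D : DigitExpansion d)

/-- The places of the digits of one level: one digit for each triple of transversal maps. -/
abbrev Place : Type := Fin D.R × Fin D.R × Fin D.R

/-- The digits, between `0` and `2 ^ q - 1`, of all levels. -/
abbrev Digits : Type := Fin D.L → D.Place → Fin (2 ^ D.q)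

open Classical in
/-- The branch of the tree prescribed by the `c`-th binary digits of `n` at the place `τ` and at the
levels with scale adjustment `i`. -/
noncomputable def branch (n : D.Digits) (i : Fin D.k₀) (τ : D.Place) (c : ℕ) : ℕ → Bool := fun j =>
  decide (∃ t, D.cov t ∧ D.shift t = i ∧ D.gen t = j ∧ (n t τ : ℕ).testBit c = true)

/-- The product `u₁ g u₂ f u₃` with transversal maps inserted around `g` and `f`. -/
noncomputable def sandwich (i : Fin D.k₀) (τ : D.Place) (f : LinEuc d) : LinEuc d :=
  D.u τ.1 * D.g i * D.u τ.2.1 * f * D.u τ.2.2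

/-- The linear map with given digits. -/
noncomputable def value (n : D.Digits) : LinEuc d :=
  ∑ p : Fin D.k₀ × D.Place × Fin D.q,
    (2 ^ (p.2.2 : ℕ) : ℝ) • D.sandwich p.1 p.2.1 (D.x (D.branch n p.1 p.2.1 p.2.2))

theorem sandwich_sub (i : Fin D.k₀) (τ : D.Place) (f f' : LinEuc d) :
    D.sandwich i τ (f - f') = D.sandwich i τ f - D.sandwich i τ f' := by
  simp only [sandwich, mul_sub, sub_mul]

theorem sandwich_smul (i : Fin D.k₀) (τ : D.Place) (a : ℝ) (f : LinEuc d) :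
    D.sandwich i τ (a • f) = a • D.sandwich i τ f := by
  ext1 w
  simp only [sandwich, mul_apply_eq_comp, smul_apply, map_smul]

theorem norm_sandwich_le (hu : ∀ s, ‖D.u s‖ ≤ 1) (i : Fin D.k₀) (τ : D.Place) (f : LinEuc d) :
    ‖D.sandwich i τ f‖ ≤ ‖D.g i‖ * ‖f‖ := by
  calc ‖D.sandwich i τ f‖ ≤ ‖D.u τ.1‖ * ‖D.g i‖ * ‖D.u τ.2.1‖ * ‖f‖ * ‖D.u τ.2.2‖ := by
        refine (norm_mul_le _ _).trans ?_
        gcongr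
        refine (norm_mul_le _ _).trans ?_
        gcongr
        refine (norm_mul_le _ _).trans ?_
        gcongr
        exact norm_mul_le _ _
    _ ≤ 1 * ‖D.g i‖ * 1 * ‖f‖ * 1 := by
        gcongr <;> exact hu _
    _ = _ := by ring

theorem value_mem_generated {S : Set (LinEuc d)} {k : ℕ} (hS : S.Nonempty) (hu : ∀ s, D.u s ∈ S)
    (hg : ∀ i, D.g i ∈ generated S k) (hx : ∀ ω, D.x ω ∈ S) (n : D.Digits) :
    D.value n ∈ generated S (k + 4 + D.q + 1 + D.k₀ * D.R ^ 3 * D.q) := by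
  have hu' : ∀ (s : Fin D.R) (j : ℕ), D.u s ∈ generated S j := fun s j =>
    generated_mono (Nat.zero_le j) (show D.u s ∈ generated S 0 from hu s)
  have hx' : ∀ (ω : ℕ → Bool) (j : ℕ), D.x ω ∈ generated S j := fun s j =>
    generated_mono (Nat.zero_le j) (show D.x s ∈ generated S 0 from hx s)
  have h := sum_mem_generated (k := k + 4 + D.q) hS (Finset.univ : Finset _)
    (fun p : Fin D.k₀ × D.Place × Fin D.q =>
    (2 ^ (p.2.2 : ℕ) : ℝ) • D.sandwich p.1 p.2.1 (D.x (D.branch n p.1 p.2.1 p.2.2)))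
    (fun p _ => generated_mono (j := k + 4 + (p.2.2 : ℕ)) (by have := p.2.2.2; omega)
      (two_pow_smul_mem_generated (mul_mem_generated (mul_mem_generated (mul_mem_generated
        (mul_mem_generated (hu' _ _) (hg _)) (hu' _ _)) (hx' _ _)) (hu' _ _)) _))
  have hcard : (Finset.univ : Finset (Fin D.k₀ × D.Place × Fin D.q)).card
      = D.k₀ * D.R ^ 3 * D.q := by
    simp only [Finset.card_univ, Fintype.card_prod, Fintype.card_fin]
    ring
  rw [hcard] at h
  exact h

/-- Changing the digits of one level changes the value by the corresponding combination of the
splitting vectors of that level, up to a small error. -/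
theorem norm_value_update_sub_le {ε : ℝ} (hε : (2 : ℝ) ^ D.q * ε ≤ 1) (hε0 : 0 ≤ ε)
    (hu : ∀ s, ‖D.u s‖ ≤ 1)
    (hx : ∀ t, D.cov t → ∀ ω ω' : ℕ → Bool, (∀ i < D.gen t, ω i = ω' i) →
      ‖D.x ω - D.x ω' - (((ω (D.gen t)).toNat : ℝ) - ((ω' (D.gen t)).toNat : ℝ)) • D.e (D.gen t)‖
        ≤ ε * ‖D.e (D.gen t)‖)
    (hinj : ∀ t t', D.cov t → D.cov t' → D.shift t = D.shift t' → D.gen t = D.gen t' → t = t')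
    (n : D.Digits) (t : Fin D.L) (ht : D.cov t) (a : D.Place → Fin (2 ^ D.q)) :
    ‖D.value (Function.update n t a) - D.value n - ∑ τ, (((a τ : ℕ) : ℝ) - ((n t τ : ℕ) : ℝ)) •
      D.sandwich (D.shift t) τ (D.e (D.gen t))‖ ≤
      Fintype.card D.Place * (‖D.g (D.shift t)‖ * ‖D.e (D.gen t)‖) := by
  classical
  set n' := Function.update n t a with hn'
  -- only the branches with the scale adjustment of level `t` change
  have hother : ∀ i τ c, i ≠ D.shift t → D.branch n' i τ c = D.branch n i τ c := by
    intro i τ c hi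
    funext j
    simp only [branch, decide_eq_decide]
    refine exists_congr fun t' => and_congr_right fun _ => and_congr_right fun hs =>
      and_congr_right fun _ => ?_
    have : t' ≠ t := by rintro rfl; exact hi hs.symm
    rw [hn', Function.update_of_ne this]
  have hsame : ∀ τ c j, j ≠ D.gen t → D.branch n' (D.shift t) τ c j =
      D.branch n (D.shift t) τ c j := by
    intro τ c j hj
    simp only [branch, decide_eq_decide]
    refine exists_congr fun t' => and_congr_right fun _ => and_congr_right fun _ =>
      and_congr_right fun hg => ?_
    have : t' ≠ t := by rintro rfl; exact hj hg.symm
    rw [hn', Function.update_of_ne this]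
  have hbit : ∀ (m : D.Digits) τ c,
      D.branch m (D.shift t) τ c (D.gen t) = (m t τ : ℕ).testBit c := by
    intro m τ c
    rw [Bool.eq_iff_iff]
    simp only [branch, decide_eq_true_eq]
    constructor
    · rintro ⟨t', h1, h2, h3, h4⟩
      rwa [hinj t' t h1 ht h2 h3] at h4
    · exact fun h => ⟨t, ht, rfl, rfl, h⟩
  have hsum : ∀ m : ℕ, m < 2 ^ D.q →
      ∑ c : Fin D.q, (2 ^ (c : ℕ) : ℝ) * ((m.testBit c).toNat : ℝ) = m := by
    intro m hm
    rw [Fin.sum_univ_eq_sum_range (fun c => (2 ^ c : ℝ) * ((m.testBit c).toNat : ℝ)) D.q]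
    exact_mod_cast sum_two_pow_mul_testBit D.q m hm
  have hval : ∀ m : D.Digits, D.value m = ∑ i, ∑ τ, ∑ c : Fin D.q,
      (2 ^ (c : ℕ) : ℝ) • D.sandwich i τ (D.x (D.branch m i τ c)) := by
    intro m
    simp only [value, Fintype.sum_prod_type]
  set s := D.shift t with hs
  set v := D.e (D.gen t) with hv
  let err : D.Place → Fin D.q → LinEuc d := fun τ c =>
    D.x (D.branch n' s τ c) - D.x (D.branch n s τ c) -
      ((((a τ : ℕ).testBit c).toNat : ℝ) - (((n t τ : ℕ).testBit c).toNat : ℝ)) • v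
  have herr : ∀ τ c, ‖err τ c‖ ≤ ε * ‖v‖ := by
    intro τ c
    have := hx t ht (D.branch n' s τ c) (D.branch n s τ c)
      (fun j hj => hsame τ c j hj.ne)
    rw [hbit, hbit, hn', Function.update_self] at this
    exact this
  have hdiff : D.value n' - D.value n - ∑ τ, (((a τ : ℕ) : ℝ) - ((n t τ : ℕ) : ℝ)) •
      D.sandwich s τ v = ∑ τ, ∑ c : Fin D.q, (2 ^ (c : ℕ) : ℝ) • D.sandwich s τ (err τ c) := by
    rw [hval, hval, ← Finset.sum_sub_distrib, Finset.sum_eq_single s]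
    · rw [← Finset.sum_sub_distrib, ← Finset.sum_sub_distrib]
      refine Finset.sum_congr rfl fun τ _ => ?_
      rw [← hsum (a τ) (a τ).2, ← hsum (n t τ) (n t τ).2, ← Finset.sum_sub_distrib,
        ← Finset.sum_sub_distrib]
      refine (congrArg (_ - ·) (Finset.sum_smul (M := LinEuc d))).trans ?_
      rw [← Finset.sum_sub_distrib]
      refine Finset.sum_congr rfl fun c _ => ?_
      simp only [err, sandwich_sub, sandwich_smul]
      module
    · intro i _ hi
      simp only [hother i _ _ hi, sub_self]
    · intro h; exact absurd (Finset.mem_univ _) h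
  rw [hdiff]
  have hgeom : ∑ c : Fin D.q, (2 ^ (c : ℕ) : ℝ) ≤ 2 ^ D.q := by
    rw [Fin.sum_univ_eq_sum_range (fun c => (2 ^ c : ℝ)) D.q, geom_sum_eq (by norm_num)]
    norm_num
  refine (norm_sum_le _ _).trans ?_
  rw [← nsmul_eq_mul, ← Finset.card_univ]
  refine Finset.sum_le_card_nsmul _ _ _ fun τ _ => ?_
  calc ‖∑ c : Fin D.q, (2 ^ (c : ℕ) : ℝ) • D.sandwich s τ (err τ c)‖
      ≤ ∑ c : Fin D.q, (2 ^ (c : ℕ) : ℝ) * (‖D.g s‖ * (ε * ‖v‖)) := by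
        refine (norm_sum_le _ _).trans (Finset.sum_le_sum fun c _ => ?_)
        rw [norm_smul, Real.norm_of_nonneg (by positivity)]
        gcongr
        refine (D.norm_sandwich_le hu _ _ _).trans ?_
        gcongr
        exact herr τ c
    _ = (∑ c : Fin D.q, (2 ^ (c : ℕ) : ℝ)) * (‖D.g s‖ * (ε * ‖v‖)) := by rw [Finset.sum_mul]
    _ ≤ 2 ^ D.q * (‖D.g s‖ * (ε * ‖v‖)) := by gcongr
    _ = (2 ^ D.q * ε) * (‖D.g s‖ * ‖v‖) := by ring
    _ ≤ 1 * (‖D.g s‖ * ‖v‖) := by gcongr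
    _ = _ := one_mul _

/-- Digits of levels that are not covered do not matter. -/
theorem value_update_of_not_cov (n : D.Digits) (t : Fin D.L) (ht : ¬ D.cov t)
    (a : D.Place → Fin (2 ^ D.q)) : D.value (Function.update n t a) = D.value n := by
  have : ∀ i τ c, D.branch (Function.update n t a) i τ c = D.branch n i τ c := by
    intro i τ c
    funext j
    simp only [branch, decide_eq_decide]
    refine exists_congr fun t' => and_congr_right fun hc => ?_
    have : t' ≠ t := by rintro rfl; exact ht hc
    rw [Function.update_of_ne this]
  simp only [value, this]

end DigitExpansion

/-- The product of the gains over all scales larger than `r`. -/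
theorem mul_prod_scales_le {lam r : ℝ} (hl0 : 0 < lam) (hl1 : lam ≤ 1) (L : ℕ) : ∀ s : ℝ, 0 < s →
    s * ∏ t : Fin L, (if r ≤ s * lam ^ (t : ℕ) then lam else 1) ≤ max r (s * lam ^ L) := by
  induction L with
  | zero => intro s _; simp
  | succ L ih =>
    intro s hs
    rw [Fin.prod_univ_succ]
    simp only [Fin.val_zero, pow_zero, mul_one, Fin.val_succ]
    by_cases hrs : r ≤ s
    · rw [if_pos hrs, ← mul_assoc]
      have := ih (s * lam) (by positivity)
      simp only [pow_succ', ← mul_assoc] at this ⊢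
      exact this
    · rw [if_neg hrs, one_mul]
      refine le_trans ?_ (le_max_left _ _)
      push Not at hrs
      refine le_trans ?_ hrs.le
      refine mul_le_of_le_one_right hs.le (Finset.prod_le_one ?_ ?_)
      · intro t _; split_ifs <;> positivity
      · intro t _; split_ifs <;> linarith

end Expansion

/-! ### A well-spread family of generated linear maps -/

section Spread

variable {d : ℕ}

open Classical in
/-- If the numbers `E j`, `j < ℓ`, occupy different scales, then `k` shifts by powers of `r` suffice
to bring one of them to most of the levels `s * lam ^ t`. The level determines the shift and the
number `j` used at this level, and conversely. -/
theorem exists_shifts {r lam δ p s : ℝ} (hr0 : 0 < r) (hr1 : r < 1) (hlam0 : 0 < lam)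
    (hlam : lam ≤ r)
    (hs : 0 < s) {ℓ L L₀ k : ℕ} (hk : 0 < k) (E : ℕ → ℝ) (hE0 : ∀ j < ℓ, s ≤ E j)
    (hE4 : ∀ j < ℓ, E j ≤ 4) (hEE : ∀ j j', j < j' → j' < ℓ → E j' ≤ r * E j)
    (hsδ : ∀ t < L, 4 * δ ≤ r * (s * lam ^ t)) (hδ1 : δ ≤ 1) (hL₀ : ∀ l, δ ≤ r ^ l → l ≤ L₀)
    (hp1 : p ≤ 1) (hp : p * (L₀ + 1) ≤ ℓ) :
    ∃ f : Fin k → ℕ, (∀ i, f i ≤ L₀) ∧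
      ∃ (cov : Fin L → Prop) (shift : Fin L → Fin k) (gen : Fin L → ℕ),
        (∀ t, cov t → gen t < ℓ ∧ r * (s * lam ^ (t : ℕ)) < E (gen t) * r ^ f (shift t) ∧
          E (gen t) * r ^ f (shift t) ≤ s * lam ^ (t : ℕ)) ∧
        (∀ t t', cov t → cov t' → shift t = shift t' → gen t = gen t' → t = t') ∧
        (((Finset.univ : Finset (Fin L)).filter fun t => ¬ cov t).card : ℝ) ≤ (1 - p) ^ k * L := by
  let Q : Fin L → ℕ → ℕ → Prop := fun t j l =>
    r * (s * lam ^ (t : ℕ)) < E j * r ^ l ∧ E j * r ^ l ≤ s * lam ^ (t : ℕ)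
  have hlam1 : lam ≤ 1 := hlam.trans hr1.le
  have hEpos : ∀ j < ℓ, 0 < E j := fun j hj => hs.trans_le (hE0 j hj)
  have hex : ∀ t : Fin L, ∀ j, j < ℓ → ∃ l, l ≤ L₀ ∧ Q t j l := by
    intro t j hj
    have hpos : 0 < s * lam ^ (t : ℕ) := by positivity
    have hex1 : ∃ l : ℕ, E j * r ^ l ≤ s * lam ^ (t : ℕ) := by
      obtain ⟨l, hl⟩ := exists_pow_lt_of_lt_one (div_pos hpos (hEpos j hj)) hr1
      refine ⟨l, ?_⟩
      rw [lt_div_iff₀ (hEpos j hj)] at hl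
      linarith
    have hspec := Nat.find_spec hex1
    have hmin := fun m hm => Nat.find_min hex1 (m := m) hm
    set l := Nat.find hex1 with hl
    rcases Nat.eq_zero_or_pos l with h0 | h0
    · refine ⟨l, ?_, ?_, hspec⟩
      · exact hL₀ _ (by rw [h0, pow_zero]; exact hδ1)
      · rw [h0, pow_zero, mul_one]
        have h1 : s * lam ^ (t : ℕ) ≤ s := mul_le_of_le_one_right hs.le (pow_le_one₀ hlam0.le hlam1)
        have h2 := hE0 j hj
        nlinarith
    · obtain ⟨m, hm⟩ := Nat.exists_eq_succ_of_ne_zero h0.ne'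
      have h1 := hmin m (by omega)
      push Not at h1
      have h2 : r * (s * lam ^ (t : ℕ)) < E j * r ^ l := by
        rw [hm, pow_succ]
        nlinarith
      refine ⟨l, hL₀ _ ?_, h2, hspec⟩
      have h3 := hsδ t t.2
      have h4 : E j * r ^ l ≤ 4 * r ^ l := by
        have := hE4 j hj
        gcongr
      linarith
  choose! lf hlf hQ using hex
  let Λ : Fin L → Finset ℕ := fun t => (Finset.range ℓ).image (lf t)
  have hΛ : ∀ t, (Λ t).card = ℓ := by
    intro t
    rw [Finset.card_image_of_injOn, Finset.card_range]
    have key : ∀ j j', j < j' → j' < ℓ → lf t j ≠ lf t j' := by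
      intro j j' hjj hj' heq
      have h1 := (hQ t j (hjj.trans hj')).2
      have h2 := (hQ t j' hj').1
      rw [← heq] at h2
      have h3 : E j' * r ^ lf t j ≤ r * E j * r ^ lf t j := by
        have := hEE j j' hjj hj'
        gcongr
      nlinarith
    intro j hj j' hj' heq
    simp only [Finset.coe_range, Set.mem_Iio] at hj hj'
    rcases lt_trichotomy j j' with h | h | h
    · exact absurd heq (key _ _ h hj')
    · exact h
    · exact absurd heq.symm (key _ _ h hj)
  obtain ⟨f, hf, hfW⟩ := exists_hitting_family hp1 (Finset.range (L₀ + 1)) (by simp)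
    (Finset.univ : Finset (Fin L)) Λ (fun t _ l hl => by
      obtain ⟨j, hj, rfl⟩ := Finset.mem_image.1 hl
      exact Finset.mem_range_succ_iff.2 (hlf t j (Finset.mem_range.1 hj)))
    (fun t _ => by rw [hΛ, Finset.card_range]; exact_mod_cast hp) k
  let cov : Fin L → Prop := fun t => ∃ i, f i ∈ Λ t
  have hcov : ∀ t, cov t → ∃ i : Fin k, ∃ j < ℓ, lf t j = f i := by
    rintro t ⟨i, hi⟩
    obtain ⟨j, hj, hj'⟩ := Finset.mem_image.1 hi
    exact ⟨i, j, Finset.mem_range.1 hj, hj'⟩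
  have : Nonempty (Fin k) := ⟨⟨0, hk⟩⟩
  choose! shift gen hgen hsg using hcov
  have hspec : ∀ t, cov t → gen t < ℓ ∧ r * (s * lam ^ (t : ℕ)) < E (gen t) * r ^ f (shift t) ∧
      E (gen t) * r ^ f (shift t) ≤ s * lam ^ (t : ℕ) := by
    intro t ht
    rw [← hsg t ht]
    exact ⟨hgen t ht, hQ t _ (hgen t ht)⟩
  refine ⟨f, fun i => Finset.mem_range_succ_iff.1 (hf i), cov, shift, gen, hspec, ?_, ?_⟩
  · have key : ∀ t t', cov t → cov t' → shift t = shift t' → gen t = gen t' → ¬ t < t' := by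
      intro t t' ht ht' h1 h2 hlt
      have h3 := (hspec t ht).2.1
      have h4 := (hspec t' ht').2.2
      rw [h1, h2] at h3
      -- the windows of different levels are disjoint, as `lam ≤ r`
      have h5 : lam ^ (t' : ℕ) ≤ lam ^ ((t : ℕ) + 1) :=
        pow_le_pow_of_le_one hlam0.le hlam1 hlt
      have h6 : s * lam ^ (t' : ℕ) ≤ s * lam ^ (t : ℕ) * lam := by
        rw [mul_assoc, ← pow_succ]
        gcongr
      have h7 : s * lam ^ (t : ℕ) * lam ≤ s * lam ^ (t : ℕ) * r := by gcongr
      linarith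
    intro t t' ht ht' h1 h2
    rcases lt_trichotomy t t' with h | h | h
    · exact absurd h (key t t' ht ht' h1 h2)
    · exact h
    · exact absurd h (key t' t ht' ht h1.symm h2.symm)
  · rw [Finset.card_univ, Fintype.card_fin] at hfW
    refine le_trans (le_of_eq ?_) hfW
    congr 2
    ext t
    simp [cov]

open Classical in
/-- The product of the gains over all covered scales larger than `r`. -/
theorem prod_gain_le (d : ℕ) {K N s : ℝ} (hK1 : 1 ≤ K) (hN1 : 1 ≤ N) (hs : 0 < s) (r : ℝ) {L : ℕ}
    (cov : Fin L → Prop) :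
    ∏ t : Fin L, (if cov t ∧ r ≤ s * N⁻¹ ^ (t : ℕ) then (K / N) ^ d else 1) ≤
      (K ^ L * N ^ ((Finset.univ : Finset (Fin L)).filter fun t => ¬ cov t).card *
        (max r (s * N⁻¹ ^ L) / s)) ^ d := by
  have hN0 : 0 < N := by linarith
  have hK0 : 0 < K := by linarith
  have hfac : ∀ t : Fin L, (if cov t ∧ r ≤ s * N⁻¹ ^ (t : ℕ) then (K / N) ^ d else 1)
      ≤ (K * (if ¬ cov t then N else 1) *
        (if r ≤ s * N⁻¹ ^ (t : ℕ) then N⁻¹ else 1)) ^ d := by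
    intro t
    by_cases h1 : cov t <;> by_cases h2 : r ≤ s * N⁻¹ ^ (t : ℕ)
    · rw [if_pos ⟨h1, h2⟩, if_neg (not_not_intro h1), if_pos h2, mul_one, div_eq_mul_inv]
    · rw [if_neg (fun h => h2 h.2), if_neg (not_not_intro h1), if_neg h2, mul_one, mul_one]
      exact one_le_pow₀ hK1
    · rw [if_neg (fun h => h1 h.1), if_pos h1, if_pos h2, mul_assoc, mul_inv_cancel₀ hN0.ne',
        mul_one]
      exact one_le_pow₀ hK1
    · rw [if_neg (fun h => h1 h.1), if_pos h1, if_neg h2, mul_one]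
      exact one_le_pow₀ (one_le_mul_of_one_le_of_one_le hK1 hN1)
  refine (Finset.prod_le_prod (fun t _ => ?_) fun t _ => hfac t).trans ?_
  · split_ifs <;> positivity
  rw [Finset.prod_pow, Finset.prod_mul_distrib, Finset.prod_mul_distrib, Finset.prod_const,
    Finset.card_univ, Fintype.card_fin, ← Finset.prod_filter, Finset.prod_const]
  have hsc := mul_prod_scales_le (r := r) (inv_pos.2 hN0) (inv_le_one_of_one_le₀ hN1) L s hs
  have hsc' : ∏ t : Fin L, (if r ≤ s * N⁻¹ ^ (t : ℕ) then N⁻¹ else 1) ≤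
      max r (s * N⁻¹ ^ L) / s := by
    rw [le_div_iff₀ hs, mul_comm]
    exact hsc
  have h0 : 0 ≤ ∏ t : Fin L, (if r ≤ s * N⁻¹ ^ (t : ℕ) then N⁻¹ else 1) :=
    Finset.prod_nonneg fun t _ => by split_ifs <;> positivity
  gcongr

open Classical in
/-- The values of a digit expansion are well spread in every direction. -/
theorem DigitExpansion.exists_card_value_apply_le (hd : 0 < d) (R : ℕ) {ρ c C : ℝ} (hρ : 0 < ρ)
    (hc : 0 < c) (hC : 0 < C) :
    ∃ K : ℕ, 0 < K ∧ ∀ (D : DigitExpansion d) (ε s : ℝ), D.R = R → 0 < D.q → 0 < s →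
      TransversalSet ρ (Set.range D.u) → 0 ≤ ε → (2 : ℝ) ^ D.q * ε ≤ 1 →
      (∀ t, D.cov t → ∀ ω ω' : ℕ → Bool, (∀ i < D.gen t, ω i = ω' i) →
        ‖D.x ω - D.x ω' - (((ω (D.gen t)).toNat : ℝ) - ((ω' (D.gen t)).toNat : ℝ)) • D.e (D.gen t)‖
          ≤ ε * ‖D.e (D.gen t)‖) →
      (∀ t t', D.cov t → D.cov t' → D.shift t = D.shift t' → D.gen t = D.gen t' → t = t') →
      (∀ t, D.cov t → c * (s * ((2 : ℝ) ^ D.q)⁻¹ ^ (t : ℕ)) ≤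
        ‖D.g (D.shift t)‖ * ‖D.e (D.gen t)‖) →
      (∀ t, D.cov t → ‖D.g (D.shift t)‖ * ‖D.e (D.gen t)‖ ≤
        C * (s * ((2 : ℝ) ^ D.q)⁻¹ ^ (t : ℕ))) →
      ∀ v w : Euc d, ‖v‖ = 1 → ∀ r : ℝ,
        (((Finset.univ : Finset D.Digits).filter fun n => ‖D.value n v - w‖ ≤ r).card : ℝ) ≤
          ((K : ℝ) ^ D.L * ((2 : ℝ) ^ D.q) ^
            ((Finset.univ : Finset (Fin D.L)).filter fun t => ¬ D.cov t).card *
            (max r (s * ((2 : ℝ) ^ D.q)⁻¹ ^ D.L) / s)) ^ d * Fintype.card D.Digits := by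
  obtain ⟨K, hK, hwalk⟩ := exists_card_digitWalk_le d (ρ ^ 3 / 4 * c)
    ((Fintype.card (Fin R × Fin R × Fin R) + 1) * C) (by positivity) (by positivity)
    (Fin R × Fin R × Fin R)
  refine ⟨K, hK, fun D ε s hR hq hs hU hε0 hε hx hinj hlow hupp v w hv r => ?_⟩
  subst hR
  have hu : ∀ i, ‖D.u i‖ ≤ 1 := fun i => hU.norm_le _ ⟨i, rfl⟩
  set N : ℕ := 2 ^ D.q with hN
  have hNr : (N : ℝ) = 2 ^ D.q := by rw [hN]; push_cast; rfl
  have hN2 : 2 ≤ N := by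
    calc 2 = 2 ^ 1 := rfl
      _ ≤ 2 ^ D.q := Nat.pow_le_pow_right (by norm_num) hq
  have hN0 : (0 : ℝ) < N := by positivity
  rw [← hNr] at hlow hupp hε ⊢
  set P : ℝ := ((Fintype.card (Fin D.R × Fin D.R × Fin D.R) : ℕ) : ℝ) with hP
  have hP0 : 0 ≤ P := by positivity
  let z : Fin D.L → D.Place → Euc d := fun t τ =>
    if D.cov t then D.sandwich (D.shift t) τ (D.e (D.gen t)) v else 0
  have hCs : ∀ t : Fin D.L, 0 < C * (s * (N : ℝ)⁻¹ ^ (t : ℕ)) := fun t => by positivity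
  have key := hwalk N hN2 D.L s hs (fun n => D.value n v) z D.cov ?_ ?_ ?_ w r
  · refine (le_of_eq ?_).trans (key.trans ?_)
    · congr!
    rw [Finset.prod_mul_distrib, mul_comm]
    have hcard : (∏ _t : Fin D.L, (N : ℝ) ^ Fintype.card (Fin D.R × Fin D.R × Fin D.R)) =
        Fintype.card D.Digits := by
      rw [Finset.prod_const]
      simp [DigitExpansion.Digits, hN]
    rw [hcard]
    refine mul_le_mul_of_nonneg_right ?_ (Nat.cast_nonneg _)
    exact prod_gain_le d (by exact_mod_cast hK) (by exact_mod_cast (by omega : 1 ≤ N)) hs r D.cov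
  · intro t τ
    by_cases ht : D.cov t
    · simp only [z, if_pos ht]
      have h1 := (D.sandwich (D.shift t) τ (D.e (D.gen t))).le_opNorm v
      rw [hv, mul_one] at h1
      have h2 := D.norm_sandwich_le hu (D.shift t) τ (D.e (D.gen t))
      have h3 := hupp t ht
      have h4 := hCs t
      nlinarith [mul_nonneg hP0 h4.le]
    · simp only [z, if_neg ht, norm_zero]
      positivity
  · intro n t a
    by_cases ht : D.cov t
    · have h1 := D.norm_value_update_sub_le (ε := ε) (by rw [← hNr]; exact hε) hε0 hu hx
        hinj n t ht a
      set X := D.value (Function.update n t a) - D.value n - ∑ τ, (((a τ : ℕ) : ℝ) -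
        ((n t τ : ℕ) : ℝ)) • D.sandwich (D.shift t) τ (D.e (D.gen t)) with hX
      have h2 : D.value (Function.update n t a) v - D.value n v -
          ∑ i, (((a i : ℕ) : ℝ) - ((n t i : ℕ) : ℝ)) • z t i = X v := by
        simp only [z, if_pos ht, hX, sub_apply, sum_apply, smul_apply]
      rw [h2]
      have h3 := X.le_opNorm v
      rw [hv, mul_one] at h3
      have h5 := mul_le_mul_of_nonneg_left (hupp t ht) hP0
      have h4 := hCs t
      calc ‖X v‖ ≤ P * (‖D.g (D.shift t)‖ * ‖D.e (D.gen t)‖) := h3.trans h1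
        _ ≤ _ := by nlinarith
    · have : ∑ i, (((a i : ℕ) : ℝ) - ((n t i : ℕ) : ℝ)) • z t i = 0 := by simp [z, ht]
      rw [D.value_update_of_not_cov n t ht a, this, sub_self, sub_zero, norm_zero]
      positivity
  · intro t ht w hw
    obtain ⟨_, ⟨i₁, rfl⟩, _, ⟨i₂, rfl⟩, _, ⟨i₃, rfl⟩, h⟩ :=
      hU.exists_inner_mul_ge hd hρ.le (D.g (D.shift t)) (D.e (D.gen t)) v w
    refine ⟨(i₁, i₂, i₃), ?_⟩
    simp only [z, if_pos ht, DigitExpansion.sandwich]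
    refine le_trans ?_ h
    rw [hv, hw, mul_one, mul_one, mul_assoc]
    exact mul_le_mul_of_nonneg_left (hlow t ht) (by positivity)

end Spread

section SpreadFamily

variable {d : ℕ}

theorem exists_nat_scale {r b : ℝ} (hr0 : 0 < r) (hr1 : r < 1) (hb0 : 0 < b) (hb1 : b ≤ 1) :
    ∃ L : ℕ, (∀ l : ℕ, b ≤ r ^ l ↔ l ≤ L) ∧
      Real.log b / Real.log r - 1 < L ∧ (L : ℝ) ≤ Real.log b / Real.log r := by
  have hlog : Real.log r < 0 := Real.log_neg hr0 hr1
  have h0 : 0 ≤ Real.log b / Real.log r :=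
    div_nonneg_of_nonpos (Real.log_nonpos hb0.le hb1) hlog.le
  refine ⟨⌊Real.log b / Real.log r⌋₊, fun l => ?_, Nat.sub_one_lt_floor _, Nat.floor_le h0⟩
  rw [Nat.le_floor_iff h0, le_div_iff_of_neg hlog, ← Real.log_pow,
    Real.log_le_log_iff hb0 (by positivity)]

/-- The splitting vectors of a binary tree decrease quickly. -/
theorem norm_splitting_le {V : Type*} [NormedAddCommGroup V] [NormedSpace ℝ V] {ε : ℝ}
    (x : (ℕ → Bool) → V) (e : ℕ → V) {ℓ : ℕ}
    (hx : ∀ j < ℓ, ∀ ω ω' : ℕ → Bool, (∀ i < j, ω i = ω' i) →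
      ‖x ω - x ω' - (((ω j).toNat : ℝ) - ((ω' j).toNat : ℝ)) • e j‖ ≤ ε * ‖e j‖) (hε : ε ≤ 1 / 2) :
    (∀ j < ℓ, ∃ ω ω', ‖e j‖ ≤ 2 * ‖x ω - x ω'‖) ∧
      ∀ j j', j < j' → j' < ℓ → ‖e j'‖ ≤ 2 * ε * ‖e j‖ := by
  have h1 : ∀ j < ℓ, (1 - ε) * ‖e j‖ ≤
      ‖x (fun i => decide (i = j)) - x (fun _ => false)‖ := by
    intro j hj
    have h := hx j hj (fun i => decide (i = j)) (fun _ => false)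
      (fun i hi => by simpa using hi.ne)
    simp only [decide_true, Bool.toNat_true, Bool.toNat_false, Nat.cast_one, Nat.cast_zero,
      sub_zero, one_smul] at h
    have h2 := norm_sub_norm_le (e j) (x (fun i => decide (i = j)) - x (fun _ => false))
    rw [norm_sub_rev (e j)] at h2
    linarith
  constructor
  · intro j hj
    refine ⟨fun i => decide (i = j), fun _ => false, ?_⟩
    have := h1 j hj
    nlinarith [norm_nonneg (e j)]
  · intro j j' hjj hj'
    have h := hx j (hjj.trans hj') (fun i => decide (i = j')) (fun _ => false)
      (fun i hi => by simpa using (hi.trans hjj).ne)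
    have h3 : decide (j = j') = false := by simpa using hjj.ne
    simp only [h3, sub_self, zero_smul, sub_zero] at h
    have := h1 j' hj'
    nlinarith [norm_nonneg (e j')]

open Classical in
/-- Boundedly many ring operations, applied to a non-concentrated set of linear maps together with
a transversal set, produce a finite family which is well spread: the images of each unit vector are
distributed almost like a `d`-dimensional uniform distribution, down to scale `δ`. -/
theorem exists_spread_family (hd : 0 < d) {ρ κ c η : ℝ} (hρ : 0 < ρ) (hκ : 0 < κ) (hc : 0 < c)
    (hη : 0 < η) :
    ∃ (k : ℕ) (C δ₀ : ℝ), 0 < C ∧ 0 < δ₀ ∧ ∀ δ : ℝ, 0 < δ → δ < δ₀ →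
      ∀ (μ : Measure (LinEuc d)) [IsFiniteMeasure μ] (B U S : Set (LinEuc d)), μ.real B = 1 →
        (∀ b ∈ B, ‖b‖ ≤ 1) → TransversalSet ρ U → B ⊆ S → U ⊆ S → 1 ∈ S →
        (∀ δ₁ : ℝ, δ < δ₁ → δ₁ < 1 → ∀ Y : Set (LinEuc d), (∀ x ∈ Y, ∀ y ∈ Y, ‖x - y‖ < δ₁) →
          μ.real Y ≤ c * δ₁ ^ κ) →
        ∃ (Ω : Type) (_ : Fintype Ω) (_ : Nonempty Ω) (f : Ω → LinEuc d),
          (∀ ω, f ω ∈ generated S k) ∧ ∀ v w : Euc d, ‖v‖ = 1 → ∀ r : ℝ, δ ≤ r →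
            (((Finset.univ : Finset Ω).filter fun ω => ‖f ω v - w‖ ≤ r).card : ℝ) ≤
              C * r ^ d * δ ^ (-η) * Fintype.card Ω := by
  have hd' : (0 : ℝ) < d := by exact_mod_cast hd
  set η₁ : ℝ := min 1 (η / (3 * d)) with hη₁
  have hη₁0 : 0 < η₁ := lt_min one_pos (by positivity)
  have hη₁1 : η₁ ≤ 1 := min_le_left _ _
  have hη₁d : 3 * d * η₁ ≤ η := by
    calc 3 * d * η₁ ≤ 3 * d * (η / (3 * d)) := by gcongr; exact min_le_right _ _
      _ = η := by field_simp
  obtain ⟨R, hR⟩ := TransversalSet.exists_finite_subfamily (d := d) hd hρ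
  obtain ⟨r₀, hr₀, hr₀4, k, c₁, C₁, hc₁, hC₁, hscale⟩ := exists_generated_norm_eq hd hρ hκ hc
  obtain ⟨K, hK, hspread⟩ := DigitExpansion.exists_card_value_apply_le hd R (half_pos hρ)
    (mul_pos hc₁ hr₀) hC₁
  -- the number `2 ^ q` of digits per place is so large that the losses `K` are negligible
  obtain ⟨q, hq⟩ := pow_unbounded_of_one_lt (max (2 / r₀) ((K : ℝ) ^ (1 / η₁)))
    (one_lt_two (α := ℝ))
  set N : ℝ := 2 ^ q with hN
  have hNr : 2 / r₀ < N := (le_max_left _ _).trans_lt hq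
  have hN8 : 8 < N := by
    refine lt_of_le_of_lt ?_ hNr
    rw [le_div_iff₀ hr₀]
    linarith
  have hN0 : 0 < N := by linarith
  have hNK : (K : ℝ) ≤ N ^ η₁ := by
    have h1 : (K : ℝ) ^ (1 / η₁) ≤ N := ((le_max_right _ _).trans_lt hq).le
    have h2 := Real.rpow_le_rpow (by positivity) h1 hη₁0.le
    rwa [← Real.rpow_mul (Nat.cast_nonneg _), one_div, inv_mul_cancel₀ hη₁0.ne', Real.rpow_one]
      at h2
  have hq0 : 0 < q := by
    rcases Nat.eq_zero_or_pos q with h | h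
    · rw [hN, h] at hN8; norm_num at hN8
    · exact h
  have hε0 : 0 < N⁻¹ := inv_pos.2 hN0
  have hεr : 2 * N⁻¹ ≤ r₀ := by
    rw [div_lt_iff₀ hr₀] at hNr
    rw [← div_eq_mul_inv, div_le_iff₀ hN0]
    linarith
  obtain ⟨r, hr, hr4, α, hα, htree⟩ := exists_splitsAlong (V := LinEuc d) (ε := N⁻¹) (κ := κ)
    (c := c) hε0 (by linarith) hκ hc
  have hlr : 0 < -Real.log r := neg_pos.2 (Real.log_neg hr (by linarith))
  have hlr₀ : 0 < -Real.log r₀ := neg_pos.2 (Real.log_neg hr₀ (by linarith))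
  set a₁ : ℝ := η₁ / (2 * -Real.log r) with ha₁
  set a₀ : ℝ := 2 / -Real.log r₀ with ha₀
  have ha₁0 : 0 < a₁ := by positivity
  have ha₀0 : 0 < a₀ := by positivity
  set p : ℝ := min 1 (α * a₁ / a₀) with hp
  have hp0 : 0 < p := lt_min one_pos (by positivity)
  have hp1 : p ≤ 1 := min_le_left _ _
  obtain ⟨k₀, hk₀⟩ := exists_pow_lt_of_lt_one hη₁0 (by linarith : 1 - p < 1)
  have hk₀0 : 0 < k₀ := by
    rcases Nat.eq_zero_or_pos k₀ with h | h
    · rw [h, pow_zero] at hk₀; linarith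
    · exact h
  set x₀ : ℝ := max (2 * -Real.log r / η₁) (-Real.log r₀) with hx₀
  refine ⟨k + 4 + q + 1 + k₀ * R ^ 3 * q, (4 / r₀ * N ^ 2) ^ d, Real.exp (-x₀), by positivity,
    Real.exp_pos _, fun δ hδ0 hδ μ _ B U S hμB hB hU hBS hUS hS1 hnc => ?_⟩
  set X : ℝ := -Real.log δ with hX
  have hXx₀ : x₀ < X := by
    have := (Real.log_lt_iff_lt_exp hδ0).2 hδ
    linarith
  have hX1 : 2 * -Real.log r / η₁ < X := (le_max_left _ _).trans_lt hXx₀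
  have hX0 : -Real.log r₀ < X := (le_max_right _ _).trans_lt hXx₀
  have hδ1 : δ < 1 := (Real.log_neg_iff hδ0).1 (by linarith)
  obtain ⟨u, huU, hu⟩ := hR U hU
  -- the number `L₀` of scales down to `δ`, and the number `L` of scales down to `δ ^ η₁`
  obtain ⟨L₀, hL₀, -, hL₀X⟩ := exists_nat_scale hr₀ (by linarith) hδ0 hδ1.le
  obtain ⟨L, hL, hLX, -⟩ := exists_nat_scale hr (by linarith)
    (Real.rpow_pos_of_pos hδ0 η₁) (Real.rpow_le_one hδ0.le hδ1.le hη₁0.le)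
  have hL₀' : (L₀ : ℝ) + 1 ≤ a₀ * X := by
    have h1 : Real.log δ / Real.log r₀ = X / -Real.log r₀ := by rw [hX, neg_div_neg_eq]
    rw [h1] at hL₀X
    have h2 : 1 ≤ X / -Real.log r₀ := by rw [le_div_iff₀ hlr₀]; linarith
    have h3 : a₀ * X = 2 * (X / -Real.log r₀) := by rw [ha₀]; ring
    linarith
  have hL' : a₁ * X ≤ L := by
    rw [Real.log_rpow hδ0] at hLX
    have h1 : η₁ * Real.log δ / Real.log r = η₁ * X / -Real.log r := by
      rw [hX, mul_neg, neg_div_neg_eq]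
    rw [h1] at hLX
    have h2 : 2 ≤ η₁ * X / -Real.log r := by
      rw [le_div_iff₀ hlr]
      rw [div_lt_iff₀ hη₁0] at hX1
      linarith
    have h3 : a₁ * X = η₁ * X / -Real.log r / 2 := by rw [ha₁]; field_simp
    linarith
  have hL1 : 1 ≤ L := by
    have h1 : 0 < a₁ * X := mul_pos ha₁0 (by linarith)
    have h2 : (0 : ℝ) < L := by linarith
    exact_mod_cast h2
  have hs : δ ^ η₁ ≤ r ^ L := (hL L).2 le_rfl
  have hδs : δ ≤ r ^ L := by
    refine le_trans ?_ hs
    calc δ = δ ^ (1 : ℝ) := (Real.rpow_one δ).symm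
      _ ≤ δ ^ η₁ := Real.rpow_le_rpow_of_exponent_ge hδ0 hδ1.le hη₁1
  have hnc' : ∀ t : ℝ, δ ≤ t → t < 1 / 4 → ∀ Y : Set (LinEuc d),
      (∀ x ∈ Y, ∀ y ∈ Y, ‖x - y‖ ≤ 2 * t) → μ.real Y ≤ c * (3 * t) ^ κ := by
    intro t ht ht1 Y hY
    exact hnc (3 * t) (by linarith) (by linarith) Y fun x hx y hy =>
      (hY x hx y hy).trans_lt (by linarith)
  have hpow4 : ∀ {a : ℝ} {l : ℕ}, 0 < a → a < 1 / 4 → 1 ≤ l → a ^ l < 1 / 4 := by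
    intro a l ha ha4 hl
    refine lt_of_le_of_lt ?_ ha4
    exact pow_le_of_le_one ha.le (by linarith) (by omega)
  have hgen := hscale L₀ μ B U S hμB hB hU hBS hUS hS1 fun l hl1 hlL =>
    hnc' _ ((hL₀ l).2 hlL) (hpow4 hr₀ hr₀4 hl1)
  choose! g hgS hg1 hg2 using hgen
  obtain ⟨l, hl, hsplit⟩ := htree L hL1 μ B hμB hB (hnc' _ hδs (hpow4 hr hr4 hL1))
  obtain ⟨x, hxB, hx⟩ := hsplit.exists_leaves
  set e : ℕ → LinEuc d := fun j => l.getD j 0 with he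
  obtain ⟨he4, hee⟩ := norm_splitting_le x e (fun j hj => (hx j hj).2)
    (by linarith : N⁻¹ ≤ 1 / 2)
  set s : ℝ := r ^ L with hs_def
  have hs0 : 0 < s := by positivity
  have hex : ∃ M : ℕ, r₀ * (s * N⁻¹ ^ M) < 4 * δ := by
    obtain ⟨M, hM⟩ := exists_pow_lt_of_lt_one (y := N⁻¹) (x := 4 * δ / (r₀ * s)) (by positivity)
      (by linarith)
    refine ⟨M, ?_⟩
    rw [lt_div_iff₀ (by positivity)] at hM
    linarith
  have hMspec := Nat.find_spec hex
  have hMmin := fun t ht => Nat.find_min hex (m := t) ht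
  set M := Nat.find hex with hM
  obtain ⟨sh, hshL, cov, shift, gen, hcov, hinj, hunc⟩ := exists_shifts (lam := N⁻¹) (δ := δ)
    (p := p)
    (s := s) (L := M) (L₀ := L₀) hr₀ (by linarith) hε0 (by linarith) hs0 hk₀0 (fun j => ‖e j‖)
    (fun j hj => (hx j hj).1)
    (fun j hj => by
      obtain ⟨ω, ω', h⟩ := he4 j hj
      have h1 := norm_sub_le (x ω) (x ω')
      have h2 := hB _ (hxB ω)
      have h3 := hB _ (hxB ω')
      linarith)
    (fun j j' hjj hj' => (hee j j' hjj hj').trans (by gcongr))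
    (fun t ht => not_lt.1 (hMmin t ht)) hδ1.le (fun l hl => (hL₀ l).1 hl) hp1
    (by
      calc p * (L₀ + 1) ≤ α * a₁ / a₀ * (a₀ * X) := by
            gcongr
            exact min_le_right _ _
        _ = α * (a₁ * X) := by field_simp
        _ ≤ α * L := by gcongr
        _ ≤ l.length := hl)
  let D : DigitExpansion d :=
    { R := R, k₀ := k₀, q := q, L := M, u := u, g := fun i => g (sh i), x := x, e := e, cov := cov,
      shift := shift, gen := gen }
  have hu1 : ∀ i, ‖u i‖ ≤ 1 := fun i => hu.norm_le _ ⟨i, rfl⟩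
  refine ⟨D.Digits, inferInstance, ⟨fun _ _ => ⟨0, by positivity⟩⟩, D.value,
    D.value_mem_generated ⟨1, hS1⟩ (fun i => hUS (huU i)) (fun i => hgS _ (hshL i))
      (fun ω => hBS (hxB ω)), fun v w hv t ht => ?_⟩
  refine (hspread D N⁻¹ s rfl hq0 hs0 hu hε0.le (mul_inv_cancel₀ hN0.ne').le
    (fun t ht => (hx _ (hcov t ht).1).2) hinj ?_ ?_ v w hv t).trans ?_
  · intro t ht
    have h1 := (hcov t ht).2.1
    have h2 := hg1 _ (hshL (shift t))
    calc c₁ * r₀ * (s * N⁻¹ ^ (t : ℕ)) = c₁ * (r₀ * (s * N⁻¹ ^ (t : ℕ))) := by ring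
      _ ≤ c₁ * (‖e (gen t)‖ * r₀ ^ sh (shift t)) := by gcongr
      _ = c₁ * r₀ ^ sh (shift t) * ‖e (gen t)‖ := by ring
      _ ≤ _ := by gcongr
  · intro t ht
    have h1 := (hcov t ht).2.2
    have h2 := hg2 _ (hshL (shift t))
    calc ‖g (sh (shift t))‖ * ‖e (gen t)‖ ≤ C₁ * r₀ ^ sh (shift t) * ‖e (gen t)‖ := by gcongr
      _ = C₁ * (‖e (gen t)‖ * r₀ ^ sh (shift t)) := by ring
      _ ≤ _ := by gcongr
  · refine mul_le_mul_of_nonneg_right ?_ (Nat.cast_nonneg _)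
    have hδη : 0 < δ ^ (-η₁) := Real.rpow_pos_of_pos hδ0 _
    have ht0 : 0 < t := hδ0.trans_le ht
    have hNM : N ^ M ≤ N / δ := by
      rcases Nat.eq_zero_or_pos M with h | h
      · rw [h, pow_zero, le_div_iff₀ hδ0]
        linarith
      · obtain ⟨m, hm⟩ := Nat.exists_eq_succ_of_ne_zero h.ne'
        have h1 := hMmin m (by omega)
        push Not at h1
        have h2 : s ≤ 1 := pow_le_one₀ hr.le (by linarith)
        have h3 : r₀ * (s * N⁻¹ ^ m) ≤ 1 * (1 * N⁻¹ ^ m) := by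
          gcongr
          linarith
        have h4 : δ ≤ N⁻¹ ^ m := by linarith
        rw [inv_pow, le_inv_comm₀ hδ0 (by positivity)] at h4
        rw [hm, pow_succ, div_eq_inv_mul]
        gcongr
    have hNη : (N ^ M) ^ η₁ ≤ N * δ ^ (-η₁) := by
      calc (N ^ M) ^ η₁ ≤ (N / δ) ^ η₁ := Real.rpow_le_rpow (by positivity) hNM hη₁0.le
        _ = N ^ η₁ * δ ^ (-η₁) := by
          rw [Real.div_rpow hN0.le hδ0.le, Real.rpow_neg hδ0.le, div_eq_mul_inv]
        _ ≤ N ^ (1 : ℝ) * δ ^ (-η₁) := by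
          gcongr
          linarith
        _ = _ := by rw [Real.rpow_one]
    have hK1 : (K : ℝ) ^ M ≤ N * δ ^ (-η₁) := by
      refine le_trans ?_ hNη
      rw [← Real.rpow_natCast N M, ← Real.rpow_mul hN0.le, mul_comm (M : ℝ), Real.rpow_mul hN0.le,
        Real.rpow_natCast]
      gcongr
    have hK2 : N ^ ((Finset.univ : Finset (Fin M)).filter fun t => ¬ cov t).card ≤
        N * δ ^ (-η₁) := by
      refine le_trans ?_ hNη
      rw [← Real.rpow_natCast N M, ← Real.rpow_mul hN0.le, ← Real.rpow_natCast]
      refine Real.rpow_le_rpow_of_exponent_le (by linarith) (hunc.trans ?_)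
      rw [mul_comm]
      gcongr
    have hK3 : max t (s * N⁻¹ ^ M) / s ≤ 4 / r₀ * t * δ ^ (-η₁) := by
      have h1 : max t (s * N⁻¹ ^ M) ≤ 4 / r₀ * t := by
        have h4 : 1 ≤ 4 / r₀ := by rw [le_div_iff₀ hr₀]; linarith
        refine max_le (le_mul_of_one_le_left ht0.le h4) ?_
        rw [div_mul_eq_mul_div, le_div_iff₀ hr₀]
        linarith
      have h2 : s⁻¹ ≤ δ ^ (-η₁) := by
        rw [Real.rpow_neg hδ0.le]
        exact inv_anti₀ (Real.rpow_pos_of_pos hδ0 _) hs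
      rw [div_eq_mul_inv]
      gcongr
    have hfin : (δ ^ (-η₁)) ^ (3 * d) ≤ δ ^ (-η) := by
      rw [← Real.rpow_natCast, ← Real.rpow_mul hδ0.le]
      refine Real.rpow_le_rpow_of_exponent_ge hδ0 hδ1.le ?_
      push_cast
      linarith
    calc ((K : ℝ) ^ M * N ^ ((Finset.univ : Finset (Fin M)).filter fun t => ¬ cov t).card *
          (max t (s * N⁻¹ ^ M) / s)) ^ d
        ≤ (N * δ ^ (-η₁) * (N * δ ^ (-η₁)) * (4 / r₀ * t * δ ^ (-η₁))) ^ d := by gcongr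
      _ = (4 / r₀ * N ^ 2) ^ d * t ^ d * (δ ^ (-η₁)) ^ (3 * d) := by
        rw [pow_mul, ← mul_pow, ← mul_pow]
        congr 1
        ring
      _ ≤ _ := by gcongr

end SpreadFamily

/-! ### Counting lattice cells -/

section Cells

variable {d : ℕ} {δ : ℝ}

/-- The cell of the lattice `δ ℤ^d` that contains `x`. -/
noncomputable def cell (δ : ℝ) (x : Euc d) : Fin d → ℤ := fun i => ⌊x i / δ⌋

open Classical in
/-- The cells of the lattice `δ ℤ^d` that meet the bounded set `Y` (and a junk value if infinitely
many cells meet `Y`). -/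
noncomputable def cells (δ : ℝ) (Y : Set (Euc d)) : Finset (Fin d → ℤ) :=
  if h : (cell δ '' Y).Finite then h.toFinset else ∅

theorem abs_floor_sub_floor_le {a b : ℝ} {n : ℕ} (h : |a - b| ≤ n) : |⌊a⌋ - ⌊b⌋| ≤ n := by
  rw [abs_le] at h ⊢
  have h1 := Int.floor_le a
  have h2 := Int.lt_floor_add_one a
  have h3 := Int.floor_le b
  have h4 := Int.lt_floor_add_one b
  constructor
  · have : (-(n : ℤ) - 1 : ℝ) < (⌊a⌋ - ⌊b⌋ : ℤ) := by push_cast; linarith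
    have : -(n : ℤ) - 1 < ⌊a⌋ - ⌊b⌋ := by exact_mod_cast this
    omega
  · have : ((⌊a⌋ - ⌊b⌋ : ℤ) : ℝ) < (n : ℤ) + 1 := by push_cast; linarith
    have : ⌊a⌋ - ⌊b⌋ < (n : ℤ) + 1 := by exact_mod_cast this
    omega

theorem abs_coord_le_norm (x : Euc d) (i : Fin d) : |x i| ≤ ‖x‖ := by
  simpa using PiLp.norm_apply_le x i

theorem norm_le_of_abs_coord_le {x : Euc d} {b : ℝ} (h : ∀ i, |x i| ≤ b) :
    ‖x‖ ≤ d * b := by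
  have h1 : ‖x‖ ≤ ∑ i, |x i| := by
    rw [EuclideanSpace.norm_eq]
    refine Real.sqrt_le_iff.2 ⟨Finset.sum_nonneg fun i _ => abs_nonneg _, ?_⟩
    simpa using Finset.sum_sq_le_sq_sum_of_nonneg (s := Finset.univ) (f := fun i => |x i|)
      (fun i _ => abs_nonneg _)
  refine h1.trans ((Finset.sum_le_sum fun i _ => h i).trans ?_)
  simp

theorem abs_cell_sub_cell_le (hδ : 0 < δ) {x y : Euc d} {n : ℕ} (h : ‖x - y‖ ≤ n * δ) (i : Fin d) :
    |cell δ x i - cell δ y i| ≤ n := by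
  refine abs_floor_sub_floor_le ?_
  rw [← sub_div, abs_div, abs_of_pos hδ, div_le_iff₀ hδ]
  exact (abs_coord_le_norm (x - y) i).trans h

theorem norm_sub_le_of_cell_eq (hδ : 0 < δ) {x y : Euc d} (h : cell δ x = cell δ y) :
    ‖x - y‖ ≤ d * δ := by
  refine norm_le_of_abs_coord_le fun i => ?_
  have h1 : ⌊x i / δ⌋ = ⌊y i / δ⌋ := congrFun h i
  have h2 := Int.abs_sub_lt_one_of_floor_eq_floor h1
  rw [← sub_div, abs_div, abs_of_pos hδ, div_lt_one hδ] at h2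
  exact h2.le

theorem finite_cell_image (hδ : 0 < δ) {Y : Set (Euc d)} (hY : Bornology.IsBounded Y) :
    (cell δ '' Y).Finite := by
  obtain ⟨C, hC⟩ := hY.exists_norm_le
  obtain ⟨n, hn⟩ := exists_nat_ge (C / δ)
  rw [div_le_iff₀ hδ] at hn
  refine (Set.finite_Icc (fun i => cell δ (0 : Euc d) i - n)
    (fun i => cell δ (0 : Euc d) i + n)).subset ?_
  rintro _ ⟨y, hy, rfl⟩
  have h : ‖y - 0‖ ≤ n * δ := by rw [sub_zero]; exact (hC y hy).trans hn
  have h' := fun i => abs_le.1 (abs_cell_sub_cell_le hδ h i)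
  exact ⟨fun i => by have := h' i; dsimp only; omega, fun i => by have := h' i; dsimp only; omega⟩

theorem mem_cells (hδ : 0 < δ) {Y : Set (Euc d)} (hY : Bornology.IsBounded Y) {p : Fin d → ℤ} :
    p ∈ cells δ Y ↔ ∃ y ∈ Y, cell δ y = p := by
  rw [cells, dif_pos (finite_cell_image hδ hY), Set.Finite.mem_toFinset]
  rfl

/-- A set of lattice points within distance `n` of a set `T` has at most `(2 n + 1) ^ d` times as
many elements as `T`. -/
theorem card_le_of_near {S T : Finset (Fin d → ℤ)} (n : ℕ)
    (h : ∀ p ∈ S, ∃ q ∈ T, ∀ i, |p i - q i| ≤ n) : S.card ≤ (2 * n + 1) ^ d * T.card := by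
  classical
  have hsub : S ⊆ T.biUnion fun q => Finset.Icc (fun i => q i - n) (fun i => q i + n) := by
    intro p hp
    obtain ⟨q, hq, hpq⟩ := h p hp
    refine Finset.mem_biUnion.2 ⟨q, hq, Finset.mem_Icc.2 ⟨fun i => ?_, fun i => ?_⟩⟩
    · have := abs_le.1 (hpq i); dsimp only; omega
    · have := abs_le.1 (hpq i); dsimp only; omega
  refine (Finset.card_le_card hsub).trans (Finset.card_biUnion_le.trans ?_)
  rw [mul_comm, ← smul_eq_mul T.card]
  refine Finset.sum_le_card_nsmul _ _ _ fun q _ => ?_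
  rw [Pi.card_Icc]
  refine (Finset.prod_le_pow_card _ _ (2 * n + 1) fun i _ => ?_).trans_eq (by simp)
  rw [Int.card_Icc]
  omega

theorem card_cells_le (hδ : 0 < δ) {Y : Set (Euc d)} (hY : Bornology.IsBounded Y) :
    (cells δ Y).card ≤ 3 ^ d * entropyNumber Y δ := by
  have hne := externalCoveringNumber_ne_top_of_isBounded hY hδ
  obtain ⟨T, hT, hTc⟩ : ∃ T : Set (Euc d), Metric.IsCover δ.toNNReal Y T ∧
      T.encard = Metric.externalCoveringNumber δ.toNNReal Y := by
    have : Nonempty {T : Set (Euc d) // Metric.IsCover δ.toNNReal Y T} := ⟨Y, by simp⟩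
    obtain ⟨T, hT⟩ := ENat.exists_eq_iInf
      (fun T : {T : Set (Euc d) // Metric.IsCover δ.toNNReal Y T} => (T : Set (Euc d)).encard)
    refine ⟨T, T.2, ?_⟩
    rw [hT, iInf_subtype]
    rfl
  have hTf : T.Finite := Set.encard_ne_top_iff.1 (hTc ▸ hne)
  classical
  have h1 := card_le_of_near (S := cells δ Y) (T := hTf.toFinset.image (cell δ)) 1 (fun p hp => by
    obtain ⟨y, hy, rfl⟩ := (mem_cells hδ hY).1 hp
    obtain ⟨t, ht, hyt⟩ := hT hy
    refine ⟨cell δ t, Finset.mem_image_of_mem _ (hTf.mem_toFinset.2 ht), fun i => ?_⟩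
    refine abs_cell_sub_cell_le hδ ?_ i
    have : edist y t ≤ ENNReal.ofReal δ := hyt
    rw [edist_le_ofReal hδ.le, dist_eq_norm] at this
    simpa using this)
  refine h1.trans ?_
  gcongr
  refine Finset.card_image_le.trans (le_of_eq ?_)
  rw [entropyNumber, ← hTc, hTf.encard_eq_coe_toFinset_card]
  rfl

theorem exists_entropyNumber_le (d : ℕ) : ∃ M : ℕ, 0 < M ∧ ∀ δ : ℝ, 0 < δ → ∀ Y : Set (Euc d),
    Bornology.IsBounded Y → entropyNumber Y δ ≤ M * (cells δ Y).card := by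
  classical
  obtain ⟨M, hM⟩ := exists_separated_net (V := Euc d) d
  refine ⟨M + 1, Nat.succ_pos _, fun δ hδ Y hY => ?_⟩
  have hrep : ∀ p ∈ cells δ Y, ∃ y ∈ Y, cell δ y = p := fun p hp => (mem_cells hδ hY).1 hp
  choose! y hy hyp using hrep
  choose P hPM _ hP using fun c => hM δ c hδ
  set T : Finset (Euc d) := (cells δ Y).biUnion fun p => P (y p) with hT
  have hcov : Metric.IsCover δ.toNNReal Y (T : Set (Euc d)) := by
    intro x hx
    have hc : cell δ x ∈ cells δ Y := (mem_cells hδ hY).2 ⟨x, hx, rfl⟩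
    obtain ⟨t, ht, hxt⟩ := hP (y (cell δ x)) x (norm_sub_le_of_cell_eq hδ (hyp _ hc).symm)
    refine ⟨t, Finset.mem_coe.2 (Finset.mem_biUnion.2 ⟨_, hc, ht⟩), ?_⟩
    show edist x t ≤ ENNReal.ofReal δ
    rwa [edist_le_ofReal hδ.le, dist_eq_norm]
  have h1 : entropyNumber Y δ ≤ T.card := by
    have := hcov.externalCoveringNumber_le_encard
    rw [Set.encard_coe_eq_coe_finsetCard] at this
    exact ENat.toNat_le_of_le_natCast this
  refine h1.trans (Finset.card_biUnion_le.trans ?_)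
  rw [mul_comm, ← smul_eq_mul (cells δ Y).card]
  exact Finset.sum_le_card_nsmul _ _ _ fun p _ => (hPM _).trans (Nat.le_succ M)

theorem card_cells_add_cells_le (hδ : 0 < δ) {Y Z : Set (Euc d)} (hY : Bornology.IsBounded Y)
    (hZ : Bornology.IsBounded Z) (hYZ : Bornology.IsBounded (Y + Z)) :
    (cells δ Y + cells δ Z).card ≤ 3 ^ d * (cells δ (Y + Z)).card := by
  refine card_le_of_near 1 fun p hp => ?_
  obtain ⟨q, hq, q', hq', rfl⟩ := Finset.mem_add.1 hp
  obtain ⟨y, hy, rfl⟩ := (mem_cells hδ hY).1 hq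
  obtain ⟨z, hz, rfl⟩ := (mem_cells hδ hZ).1 hq'
  refine ⟨_, (mem_cells hδ hYZ).2 ⟨y + z, Set.add_mem_add hy hz, rfl⟩, fun i => ?_⟩
  have h1 := Int.le_floor_add (y i / δ) (z i / δ)
  have h2 := Int.le_floor_add_floor (y i / δ) (z i / δ)
  have h3 : cell δ (y + z) i = ⌊y i / δ + z i / δ⌋ := by simp [cell, add_div]
  rw [h3, Pi.add_apply, abs_le]
  simp only [cell]
  constructor <;> push_cast <;> omega

end Cells

/-! ### Ring operations and small sumsets -/

section Ruzsa

variable {d : ℕ}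

/-- The sums of `n` differences of elements of `A`. -/
def diffSums (A : Set (Euc d)) : ℕ → Set (Euc d)
  | 0 => {0}
  | n + 1 => diffSums A n + (A - A)

/-- `Z` is covered, up to an error `n * δ`, by at most `M ^ n` translates of the set of sums of `n`
differences of elements of `A`. -/
def CoveredBy (A : Set (Euc d)) (δ M : ℝ) (n : ℕ) (Z : Set (Euc d)) : Prop :=
  ∃ X : Finset (Euc d), (X.card : ℝ) ≤ M ^ n ∧
    ∀ z ∈ Z, ∃ x ∈ X, ∃ y ∈ diffSums A n, ‖z - (x + y)‖ ≤ n * δ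

variable {A : Set (Euc d)} {δ M : ℝ}

theorem add_mem_diffSums {m n : ℕ} {y y' : Euc d} (hy : y ∈ diffSums A m) :
    y' ∈ diffSums A n → y + y' ∈ diffSums A (m + n) := by
  induction n generalizing y' with
  | zero =>
    intro h
    rw [show y' = 0 from h, add_zero y]
    exact hy
  | succ n ih =>
    rintro ⟨a, ha, b, hb, rfl⟩
    exact ⟨y + a, ih ha, b, hb, add_assoc _ _ _⟩

theorem neg_mem_diffSums {n : ℕ} {y : Euc d} : y ∈ diffSums A n → -y ∈ diffSums A n := by
  induction n generalizing y with
  | zero =>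
    intro h
    rw [show y = 0 from h, neg_zero]
    rfl
  | succ n ih =>
    rintro ⟨a, ha, _, ⟨b, hb, c, hc, rfl⟩, rfl⟩
    exact ⟨-a, ih ha, c - b, ⟨c, hc, b, hb, rfl⟩, by simp only; abel⟩

theorem diffSums_mono (hA : A.Nonempty) {m n : ℕ} (h : m ≤ n) : diffSums A m ⊆ diffSums A n := by
  induction h with
  | refl => exact subset_rfl
  | step _ ih =>
    obtain ⟨a, ha⟩ := hA
    exact ih.trans fun y hy => ⟨y, hy, 0, ⟨a, ha, a, ha, sub_self a⟩, add_zero y⟩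

namespace CoveredBy

variable {Y Z : Set (Euc d)} {m n : ℕ}

theorem mono (hA : A.Nonempty) (hM : 1 ≤ M) (hδ : 0 ≤ δ) (hmn : m ≤ n) (h : CoveredBy A δ M m Z)
    (hYZ : Y ⊆ Z) : CoveredBy A δ M n Y := by
  obtain ⟨X, hX, hZ⟩ := h
  refine ⟨X, hX.trans (pow_le_pow_right₀ hM hmn), fun z hz => ?_⟩
  obtain ⟨x, hx, y, hy, hxy⟩ := hZ z (hYZ hz)
  exact ⟨x, hx, y, diffSums_mono hA hmn hy, hxy.trans (by gcongr)⟩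

theorem add (hM : 1 ≤ M) (hY : CoveredBy A δ M m Y) (hZ : CoveredBy A δ M n Z) :
    CoveredBy A δ M (m + n) (Y + Z) := by
  classical
  obtain ⟨X, hX, hY⟩ := hY
  obtain ⟨X', hX', hZ⟩ := hZ
  refine ⟨X + X', ?_, ?_⟩
  · rw [pow_add]
    calc ((X + X').card : ℝ) ≤ X.card * X'.card := by exact_mod_cast Finset.card_add_le
      _ ≤ _ := by gcongr
  · rintro _ ⟨y, hy, z, hz, rfl⟩
    obtain ⟨x, hx, s, hs, h1⟩ := hY y hy
    obtain ⟨x', hx', s', hs', h2⟩ := hZ z hz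
    refine ⟨x + x', Finset.add_mem_add hx hx', s + s', add_mem_diffSums hs hs', ?_⟩
    have h3 : y + z - (x + x' + (s + s')) = (y - (x + s)) + (z - (x' + s')) := by abel
    simp only [h3]
    push_cast
    linarith [norm_add_le (y - (x + s)) (z - (x' + s'))]

theorem neg (hZ : CoveredBy A δ M n Z) : CoveredBy A δ M n (-Z) := by
  classical
  obtain ⟨X, hX, hZ⟩ := hZ
  refine ⟨-X, by rwa [Finset.card_neg], fun z hz => ?_⟩
  obtain ⟨x, hx, s, hs, h⟩ := hZ (-z) hz
  refine ⟨-x, Finset.neg_mem_neg hx, -s, neg_mem_diffSums hs, ?_⟩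
  rwa [show z - (-x + -s) = -(-z - (x + s)) by abel, norm_neg]

theorem sub (hM : 1 ≤ M) (hY : CoveredBy A δ M m Y) (hZ : CoveredBy A δ M n Z) :
    CoveredBy A δ M (m + n) (Y - Z) := by
  rw [sub_eq_add_neg]
  exact hY.add hM hZ.neg

theorem image_diffSums (hM : 1 ≤ M) {f : LinEuc d} (hf : CoveredBy A δ M n (f '' A)) (m : ℕ) :
    CoveredBy A δ M (m * (n + n)) (f '' diffSums A m) := by
  induction m with
  | zero =>
    refine ⟨{0}, by simp, ?_⟩
    rintro _ ⟨_, rfl, rfl⟩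
    exact ⟨0, by simp, 0, by simp [diffSums], by simp⟩
  | succ m ih =>
    rw [Nat.succ_mul]
    have h := ih.add hM (hf.sub hM hf)
    obtain ⟨X, hX, hZ⟩ := h
    refine ⟨X, hX, ?_⟩
    rintro _ ⟨_, ⟨y, hy, _, ⟨a, ha, b, hb, rfl⟩, rfl⟩, rfl⟩
    refine hZ _ ⟨f y, ⟨y, hy, rfl⟩, f a - f b, ⟨_, ⟨a, ha, rfl⟩, _, ⟨b, hb, rfl⟩, rfl⟩, ?_⟩
    simp

theorem mul (hA : A.Nonempty) (hM : 1 ≤ M) (hδ : 0 ≤ δ) {f g : LinEuc d} {b : ℕ} (hb : ‖f‖ ≤ b)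
    (hf : CoveredBy A δ M n (f '' A)) (hg : CoveredBy A δ M m (g '' A)) :
    CoveredBy A δ M (m + m * (n + n) + b * m) ((f * g) '' A) := by
  classical
  obtain ⟨X, hX, hg⟩ := hg
  obtain ⟨X', hX', hf⟩ := hf.image_diffSums hM m
  refine ⟨X.image f + X', ?_, ?_⟩
  · calc ((X.image f + X').card : ℝ) ≤ (X.image f).card * X'.card := by
          exact_mod_cast Finset.card_add_le
      _ ≤ M ^ m * M ^ (m * (n + n)) := by
          gcongr
          exact le_trans (by exact_mod_cast Finset.card_image_le) hX
      _ ≤ M ^ (m + m * (n + n) + b * m) := by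
          rw [← pow_add]
          exact pow_le_pow_right₀ hM (Nat.le_add_right _ _)
  · rintro _ ⟨a, ha, rfl⟩
    obtain ⟨x, hx, y, hy, h1⟩ := hg (g a) ⟨a, ha, rfl⟩
    obtain ⟨x', hx', y', hy', h2⟩ := hf (f y) ⟨y, hy, rfl⟩
    refine ⟨f x + x', Finset.add_mem_add (Finset.mem_image_of_mem _ hx) hx', y',
      diffSums_mono hA (by rw [add_right_comm]; exact Nat.le_add_left _ _) hy', ?_⟩
    have h3 : (f * g) a - (f x + x' + y') = f (g a - (x + y)) + (f y - (x' + y')) := by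
      simp only [mul_apply_eq_comp, map_sub, map_add]
      abel
    have h4 : ‖f (g a - (x + y))‖ ≤ b * (m * δ) :=
      (f.le_opNorm _).trans (mul_le_mul hb h1 (norm_nonneg _) (Nat.cast_nonneg _))
    have h5 : 0 ≤ (m : ℝ) * δ := by positivity
    rw [h3]
    push_cast at h2 ⊢
    linarith [norm_add_le (f (g a - (x + y))) (f y - (x' + y'))]

/-- Being covered passes from a set of linear maps to the linear maps it generates. -/
theorem exists_of_mem_generated (d n₀ k : ℕ) : ∃ n : ℕ, ∀ (A : Set (Euc d)) (δ M : ℝ)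
    (S : Set (LinEuc d)), A.Nonempty → 1 ≤ M → 0 ≤ δ → (∀ f ∈ S, ‖f‖ ≤ 1) →
    (∀ f ∈ S, CoveredBy A δ M n₀ (f '' A)) → ∀ f ∈ generated S k, CoveredBy A δ M n (f '' A) := by
  induction k with
  | zero => exact ⟨n₀, fun A δ M S _ _ _ _ h => h⟩
  | succ k ih =>
    obtain ⟨n, hn⟩ := ih
    refine ⟨n + n * (n + n) + 2 ^ 2 ^ k * n, ?_⟩
    rintro A δ M S hA hM hδ hS hcov h ⟨f, hf, g, hg, hfg⟩
    have hf' := hn A δ M S hA hM hδ hS hcov f hf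
    have hg' := hn A δ M S hA hM hδ hS hcov g hg
    have h1 : n ≤ 2 ^ 2 ^ k * n := Nat.le_mul_of_pos_left _ (by positivity)
    have h2 : n + n ≤ n + n * (n + n) + 2 ^ 2 ^ k * n := by
      have := Nat.zero_le (n * (n + n))
      omega
    rcases hfg with rfl | rfl | rfl | rfl
    · exact hf'.mono hA hM hδ (by omega) subset_rfl
    · refine (hf'.add hM hg').mono hA hM hδ h2 ?_
      rintro _ ⟨a, ha, rfl⟩
      exact ⟨f a, ⟨a, ha, rfl⟩, g a, ⟨a, ha, rfl⟩, rfl⟩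
    · refine (hf'.sub hM hg').mono hA hM hδ h2 ?_
      rintro _ ⟨a, ha, rfl⟩
      exact ⟨f a, ⟨a, ha, rfl⟩, g a, ⟨a, ha, rfl⟩, rfl⟩
    · refine hf'.mul hA hM hδ ?_ hg'
      exact_mod_cast norm_le_of_mem_generated hS k f hf

end CoveredBy

/-- Ruzsa's covering lemma, at scale `δ`. -/
theorem coveredBy_of_card_cells_add_le (hδ : 0 < δ) (hM : 1 ≤ M) (hA : A.Nonempty)
    (hAb : Bornology.IsBounded A) {Z : Set (Euc d)} (hZ : Bornology.IsBounded Z)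
    (h : ((cells δ Z + cells δ A).card : ℝ) ≤ M * (cells δ A).card) :
    CoveredBy A δ M (3 * d + 1) Z := by
  classical
  have hne : (cells δ A).Nonempty := by
    obtain ⟨a, ha⟩ := hA
    exact ⟨_, (mem_cells hδ hAb).2 ⟨a, ha, rfl⟩⟩
  obtain ⟨F, -, hF, hcov⟩ := Finset.ruzsa_covering_add hne h
  let pt : (Fin d → ℤ) → Euc d := fun p => WithLp.toLp 2 fun i => δ * p i
  refine ⟨F.image pt, ?_, fun z hz => ?_⟩
  · calc ((F.image pt).card : ℝ) ≤ F.card := by exact_mod_cast Finset.card_image_le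
      _ ≤ M := hF
      _ = M ^ 1 := (pow_one M).symm
      _ ≤ _ := pow_le_pow_right₀ hM (Nat.le_add_left _ _)
  · obtain ⟨p, hp, q, hq, hpq⟩ := Finset.mem_add.1 (hcov ((mem_cells hδ hZ).2 ⟨z, hz, rfl⟩))
    obtain ⟨q₁, hq₁, q₂, hq₂, rfl⟩ := Finset.mem_sub.1 hq
    obtain ⟨a, ha, rfl⟩ := (mem_cells hδ hAb).1 hq₁
    obtain ⟨b, hb, rfl⟩ := (mem_cells hδ hAb).1 hq₂
    refine ⟨pt p, Finset.mem_image_of_mem _ hp, a - b, ?_, ?_⟩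
    · refine diffSums_mono hA (Nat.le_add_left 1 _) ⟨0, rfl, a - b, ⟨a, ha, b, hb, rfl⟩, zero_add _⟩
    · have hcoord : ∀ i, |(z - (pt p + (a - b))) i| ≤ 3 * δ := by
        intro i
        have h1 : (p i : ℝ) + ((⌊a i / δ⌋ : ℝ) - ⌊b i / δ⌋) = ⌊z i / δ⌋ := by
          exact_mod_cast congrFun hpq i
        have h2 : ∀ t : ℝ, δ * ⌊t / δ⌋ ≤ t ∧ t ≤ δ * ⌊t / δ⌋ + δ := by
          intro t
          have h3 := Int.floor_le (t / δ)
          have h4 := (Int.lt_floor_add_one (t / δ)).le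
          rw [le_div_iff₀ hδ] at h3
          rw [div_le_iff₀ hδ] at h4
          constructor <;> linarith
        have h5 : (z - (pt p + (a - b))) i = z i - (δ * p i + (a i - b i)) := rfl
        have h6 : δ * p i = δ * ⌊z i / δ⌋ - δ * ⌊a i / δ⌋ + δ * ⌊b i / δ⌋ := by
          rw [← h1]; ring
        rw [h5, h6, abs_le]
        have ha2 := h2 (a i)
        have hb2 := h2 (b i)
        have hz2 := h2 (z i)
        constructor <;> linarith
      refine (norm_le_of_abs_coord_le hcoord).trans ?_
      push_cast
      nlinarith

/-- If `A` has small doubling and `Z` is covered by few translates of sums of differences of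
elements of `A`, then the sumset `A + Z` is not much larger than `A`. -/
theorem CoveredBy.card_cells_add_le (hδ : 0 < δ) (hM : 1 ≤ M) (hA : A.Nonempty)
    (hAb : Bornology.IsBounded A) {Z : Set (Euc d)} {n : ℕ}
    (hAZ : Bornology.IsBounded (A + Z)) (h : CoveredBy A δ M n Z)
    (hAA : ((cells δ A + cells δ A).card : ℝ) ≤ M * (cells δ A).card) :
    ((cells δ (A + Z)).card : ℝ) ≤ (6 * n + 7) ^ d * (M ^ (3 * n + 1) * (cells δ A).card) := by
  classical
  set P := cells δ A with hP
  have hne : P.Nonempty := by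
    obtain ⟨a, ha⟩ := hA
    exact ⟨_, (mem_cells hδ hAb).2 ⟨a, ha, rfl⟩⟩
  have hPc : (0 : ℝ) < P.card := by exact_mod_cast hne.card_pos
  have hfl : ∀ t : ℝ, (⌊t⌋ : ℝ) ≤ t ∧ t ≤ ⌊t⌋ + 1 := fun t =>
    ⟨Int.floor_le t, (Int.lt_floor_add_one t).le⟩
  have hD : ∀ n : ℕ, ∀ y ∈ diffSums A n, ∃ u ∈ n • P, ∃ v ∈ n • P,
      ∀ i, |y i / δ - (u i - v i)| ≤ 2 * n := by
    intro n
    induction n with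
    | zero =>
      rintro _ rfl
      exact ⟨0, by simp, 0, by simp, by simp⟩
    | succ n ih =>
      rintro _ ⟨y, hy, _, ⟨a, ha, b, hb, rfl⟩, rfl⟩
      obtain ⟨u, hu, v, hv, huv⟩ := ih y hy
      refine ⟨u + cell δ a, ?_, v + cell δ b, ?_, fun i => ?_⟩
      · rw [succ_nsmul]
        exact Finset.add_mem_add hu ((mem_cells hδ hAb).2 ⟨a, ha, rfl⟩)
      · rw [succ_nsmul]
        exact Finset.add_mem_add hv ((mem_cells hδ hAb).2 ⟨b, hb, rfl⟩)
      · have h1 := abs_le.1 (huv i)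
        have h2 := hfl (a i / δ)
        have h3 := hfl (b i / δ)
        have h4 : (y + (a - b)) i / δ = y i / δ + (a i / δ - b i / δ) := by
          simp [add_div, sub_div]
        simp only [h4, Pi.add_apply, cell]
        push_cast
        rw [abs_le]
        constructor <;> linarith
  obtain ⟨X, hX, hZ⟩ := h
  have hnear := card_le_of_near (S := cells δ (A + Z))
    (T := X.image (cell δ) + ((n + 1) • P - n • P)) (3 * n + 3) (fun p hp => by
      obtain ⟨_, ⟨a, ha, z, hz, rfl⟩, rfl⟩ := (mem_cells hδ hAZ).1 hp
      obtain ⟨x, hx, y, hy, hxy⟩ := hZ z hz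
      obtain ⟨u, hu, v, hv, huv⟩ := hD n y hy
      refine ⟨cell δ x + ((u + cell δ a) - v), Finset.add_mem_add (Finset.mem_image_of_mem _ hx)
        (Finset.sub_mem_sub ?_ hv), fun i => ?_⟩
      · rw [succ_nsmul]
        exact Finset.add_mem_add hu ((mem_cells hδ hAb).2 ⟨a, ha, rfl⟩)
      · have h1 := abs_le.1 (huv i)
        have h2 := hfl (a i / δ)
        have h3 := hfl (x i / δ)
        have h4 : |(z - (x + y)) i / δ| ≤ n := by
          rw [abs_div, abs_of_pos hδ, div_le_iff₀ hδ]
          exact (abs_coord_le_norm _ i).trans hxy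
        have h5 : (z - (x + y)) i / δ = z i / δ - (x i / δ + y i / δ) := by
          simp [add_div, sub_div]
        rw [h5, abs_le] at h4
        have h6 := hfl ((a i + z i) / δ)
        have h7 : (a i + z i) / δ = a i / δ + z i / δ := add_div _ _ _
        have h8 : cell δ (a + z) i = ⌊(a i + z i) / δ⌋ := rfl
        have h9 : |((cell δ (a + z) i - (cell δ x + (u + cell δ a - v)) i : ℤ) : ℝ)| ≤
            ((3 * n + 3 : ℕ) : ℤ) := by
          rw [h8]
          simp only [Pi.add_apply, Pi.sub_apply, cell]
          push_cast
          rw [abs_le]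
          constructor <;> linarith
        exact_mod_cast h9)
  have hplu := Finset.pluennecke_ruzsa_inequality_nsmul_sub_nsmul_add hne P (n + 1) n
  have hplu' : ((((n + 1) • P - n • P).card : ℕ) : ℝ) ≤
      (((P + P).card : ℝ) / P.card) ^ (n + 1 + n) * P.card := by
    have := (NNRat.cast_le (K := ℝ)).2 hplu
    push_cast at this
    exact this
  have hdoub : ((P + P).card : ℝ) / P.card ≤ M := by
    rw [div_le_iff₀ hPc]
    exact hAA
  calc ((cells δ (A + Z)).card : ℝ)
      ≤ (2 * ((3 * n + 3 : ℕ) : ℝ) + 1) ^ d *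
        ((X.image (cell δ) + ((n + 1) • P - n • P)).card : ℝ) := by exact_mod_cast hnear
    _ ≤ (6 * n + 7) ^ d * (M ^ n * (M ^ (n + 1 + n) * P.card)) := by
        have h1 : 2 * ((3 * n + 3 : ℕ) : ℝ) + 1 = 6 * n + 7 := by push_cast; ring
        rw [h1]
        refine mul_le_mul_of_nonneg_left ?_ (by positivity)
        calc ((X.image (cell δ) + ((n + 1) • P - n • P)).card : ℝ)
            ≤ (X.image (cell δ)).card * ((n + 1) • P - n • P).card := by
              exact_mod_cast Finset.card_add_le
          _ ≤ M ^ n * (M ^ (n + 1 + n) * P.card) := by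
              gcongr
              · exact le_trans (by exact_mod_cast Finset.card_image_le) hX
              · refine hplu'.trans ?_
                gcongr
    _ = _ := by
        rw [← mul_assoc (M ^ n), ← pow_add, show n + (n + 1 + n) = 3 * n + 1 by ring]

end Ruzsa

/-! ### Additive energy along a well-spread family -/

section Energy

variable {d : ℕ} {δ : ℝ}

theorem isBounded_add_image {A : Set (Euc d)} (hA : Bornology.IsBounded A) (f : LinEuc d) :
    Bornology.IsBounded (A + f '' A) :=
  hA.add (f.lipschitz.isBounded_image hA)

open Classical in
/-- The collisions of the sums `x + f y`, `x, y ∈ F`, up to an error `d * δ`. -/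
noncomputable def collisions (δ : ℝ) (F : Finset (Euc d)) (f : LinEuc d) :
    Finset ((Euc d × Euc d) × (Euc d × Euc d)) :=
  ((F ×ˢ F) ×ˢ (F ×ˢ F)).filter fun p => ‖(p.1.1 - p.2.1) + f (p.1.2 - p.2.2)‖ ≤ d * δ

theorem card_pow_four_le_mul_card_collisions (hδ : 0 < δ) {A : Set (Euc d)}
    (hA : Bornology.IsBounded A) {F : Finset (Euc d)} (hF : ∀ x ∈ F, x ∈ A) (f : LinEuc d) :
    F.card ^ 4 ≤ (cells δ (A + f '' A)).card * (collisions δ F f).card := by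
  classical
  set T := cells δ (A + f '' A) with hT
  let g : Euc d × Euc d → (Fin d → ℤ) := fun p => cell δ (p.1 + f p.2)
  have hg : ∀ p ∈ F ×ˢ F, g p ∈ T := by
    intro p hp
    rw [Finset.mem_product] at hp
    exact (mem_cells hδ (isBounded_add_image hA f)).2
      ⟨_, ⟨p.1, hF _ hp.1, f p.2, ⟨p.2, hF _ hp.2, rfl⟩, rfl⟩, rfl⟩
  let fib : (Fin d → ℤ) → Finset (Euc d × Euc d) := fun c => (F ×ˢ F).filter fun p => g p = c
  have h1 : F.card ^ 2 = ∑ c ∈ T, (fib c).card := by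
    rw [← Finset.card_eq_sum_card_fiberwise hg, Finset.card_product, sq]
  have h2 : ∑ c ∈ T, (fib c).card ^ 2 ≤ (collisions δ F f).card := by
    have h3 : ∀ c, (fib c).card ^ 2 = (fib c ×ˢ fib c).card := fun c => by
      rw [Finset.card_product, sq]
    simp only [h3]
    rw [← Finset.card_biUnion]
    · refine Finset.card_le_card fun p hp => ?_
      obtain ⟨c, -, hp⟩ := Finset.mem_biUnion.1 hp
      rw [Finset.mem_product, Finset.mem_filter, Finset.mem_filter] at hp
      refine Finset.mem_filter.2 ⟨Finset.mem_product.2 ⟨hp.1.1, hp.2.1⟩, ?_⟩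
      have h4 := norm_sub_le_of_cell_eq hδ (hp.1.2.trans hp.2.2.symm)
      have h5 : p.1.1 - p.2.1 + f (p.1.2 - p.2.2) = p.1.1 + f p.1.2 - (p.2.1 + f p.2.2) := by
        rw [map_sub]; abel
      rwa [h5]
    · intro c _ c' _ hcc
      rw [Function.onFun, Finset.disjoint_left]
      intro p hp hp'
      rw [Finset.mem_product, Finset.mem_filter] at hp hp'
      exact hcc (hp.1.2.symm.trans hp'.1.2)
  calc F.card ^ 4 = (∑ c ∈ T, (fib c).card) ^ 2 := by rw [← h1, ← pow_mul]
    _ ≤ T.card * ∑ c ∈ T, (fib c).card ^ 2 := sq_sum_le_card_mul_sum_sq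
    _ ≤ _ := Nat.mul_le_mul_left _ h2

open Classical in
/-- If `F` is separated at scale `δ`, then few collisions come from pairs `y, y'` close to each
other. -/
theorem card_near_collisions_le (hδ : 0 < δ) {F : Finset (Euc d)}
    (hF : Set.InjOn (cell δ) (F : Set (Euc d)))
    {t₀ : ℝ} {Q : ℕ} (hQ : ∀ y ∈ F, (F.filter fun y' => ‖y - y'‖ < t₀).card ≤ Q) (f : LinEuc d) :
    ((collisions δ F f).filter fun p => ‖p.1.2 - p.2.2‖ < t₀).card ≤
      (2 * d + 1) ^ d * (F.card * (Q * F.card)) := by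
  have hpairs : ((F ×ˢ F).filter fun p : Euc d × Euc d => ‖p.1 - p.2‖ < t₀).card ≤ Q * F.card := by
    refine Finset.card_le_mul_card_image_of_maps_to (f := Prod.fst)
      (fun p hp => (Finset.mem_product.1 (Finset.mem_filter.1 hp).1).1) Q fun y hy => ?_
    refine le_trans (Finset.card_le_card_of_injOn Prod.snd (fun p hp => ?_) ?_) (hQ y hy)
    · simp only [Finset.coe_filter, Finset.mem_filter, Finset.mem_product, Set.mem_ofPred_eq]
        at hp ⊢
      obtain ⟨⟨⟨h1, h2⟩, h3⟩, rfl⟩ := hp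
      exact ⟨h2, h3⟩
    · intro p hp p' hp' h
      simp only [Finset.coe_filter, Finset.mem_filter, Set.mem_ofPred_eq] at hp hp'
      exact Prod.ext (hp.2.trans hp'.2.symm) h
  refine (Finset.card_le_mul_card_image_of_maps_to
    (t := F ×ˢ ((F ×ˢ F).filter fun p : Euc d × Euc d => ‖p.1 - p.2‖ < t₀))
    (f := fun p => (p.1.1, (p.1.2, p.2.2))) (fun p hp => ?_) ((2 * d + 1) ^ d) ?_).trans ?_
  · simp only [collisions, Finset.mem_filter, Finset.mem_product] at hp ⊢
    tauto
  · rintro ⟨x, y, y'⟩ -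
    set W := (((collisions δ F f).filter fun p => ‖p.1.2 - p.2.2‖ < t₀).filter
      fun p => (p.1.1, (p.1.2, p.2.2)) = (x, (y, y'))) with hW
    have hWmem : ∀ p ∈ W, p.1.1 = x ∧ p.1.2 = y ∧ p.2.2 = y' ∧ p.2.1 ∈ F ∧
        ‖p.2.1 - (x + f (y - y'))‖ ≤ d * δ := by
      intro p hp
      simp only [hW, collisions, Finset.mem_filter, Finset.mem_product, Prod.mk.injEq] at hp
      obtain ⟨⟨⟨⟨-, h1, -⟩, h2⟩, -⟩, rfl, rfl, rfl⟩ := hp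
      refine ⟨rfl, rfl, rfl, h1, ?_⟩
      rwa [norm_sub_rev, add_sub_right_comm]
    have hinj : Set.InjOn (fun p : (Euc d × Euc d) × (Euc d × Euc d) => cell δ p.2.1) W := by
      intro p hp p' hp' h
      obtain ⟨h1, h2, h3, h4, -⟩ := hWmem p hp
      obtain ⟨h1', h2', h3', h4', -⟩ := hWmem p' hp'
      exact Prod.ext (Prod.ext (h1.trans h1'.symm) (h2.trans h2'.symm))
        (Prod.ext (hF h4 h4' h) (h3.trans h3'.symm))
    rw [← Finset.card_image_of_injOn hinj]
    refine (card_le_of_near (T := {cell δ (x + f (y - y'))}) d fun c hc => ?_).trans (by simp)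
    obtain ⟨p, hp, rfl⟩ := Finset.mem_image.1 hc
    exact ⟨_, Finset.mem_singleton_self _, abs_cell_sub_cell_le hδ (hWmem p hp).2.2.2.2⟩
  · rw [Finset.card_product]
    gcongr

open Classical in
/-- In a well-spread family of linear maps there is one with few collisions, hence with a large
sumset. -/
theorem exists_card_pow_four_le (hδ : 0 < δ) {A : Set (Euc d)} (hA : Bornology.IsBounded A)
    {F : Finset (Euc d)} (hFA : ∀ x ∈ F, x ∈ A) (hF : Set.InjOn (cell δ) (F : Set (Euc d)))
    {t₀ : ℝ} (ht₀ : 0 < t₀)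
    {Q : ℕ} (hQ : ∀ y ∈ F, (F.filter fun y' => ‖y - y'‖ < t₀).card ≤ Q) {Ω : Type} [Fintype Ω]
    [Nonempty Ω] (f : Ω → LinEuc d) {q : ℝ} (hq : 0 ≤ q) (hf : ∀ v w : Euc d, ‖v‖ = 1 →
      (((Finset.univ : Finset Ω).filter fun ω => ‖f ω v - w‖ ≤ d * δ / t₀).card : ℝ) ≤
        q * Fintype.card Ω) :
    ∃ ω, (F.card : ℝ) ^ 4 ≤ (cells δ (A + f ω '' A)).card *
      (q * F.card ^ 4 + (2 * d + 1) ^ d * (F.card * (Q * F.card))) := by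
  set near : ℝ := (2 * d + 1) ^ d * (F.card * (Q * F.card)) with hnear
  let far : Ω → Finset ((Euc d × Euc d) × (Euc d × Euc d)) := fun ω =>
    (collisions δ F (f ω)).filter fun p => ¬ ‖p.1.2 - p.2.2‖ < t₀
  have hfar : ∑ ω, ((far ω).card : ℝ) ≤ Fintype.card Ω * (q * F.card ^ 4) := by
    set U := ((F ×ˢ F) ×ˢ (F ×ˢ F)).filter
      fun p : (Euc d × Euc d) × (Euc d × Euc d) => ¬ ‖p.1.2 - p.2.2‖ < t₀ with hU
    have h1 : ∀ ω, far ω = U.filter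
        fun p => ‖(p.1.1 - p.2.1) + f ω (p.1.2 - p.2.2)‖ ≤ d * δ := by
      intro ω
      simp only [far, collisions, hU, Finset.filter_filter]
      exact Finset.filter_congr fun p _ => and_comm
    have h2 := Finset.sum_card_bipartiteAbove_eq_sum_card_bipartiteBelow
      (s := (Finset.univ : Finset Ω)) (t := U)
      (fun ω p => ‖(p.1.1 - p.2.1) + f ω (p.1.2 - p.2.2)‖ ≤ d * δ)
    simp only [Finset.bipartiteAbove, Finset.bipartiteBelow] at h2
    have h3 : ∑ ω, ((far ω).card : ℝ) = ∑ p ∈ U, (((Finset.univ : Finset Ω).filter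
        fun ω => ‖(p.1.1 - p.2.1) + f ω (p.1.2 - p.2.2)‖ ≤ d * δ).card : ℝ) := by
      simp only [h1]
      exact_mod_cast h2
    have h4 : ∀ p ∈ U, (((Finset.univ : Finset Ω).filter
        fun ω => ‖(p.1.1 - p.2.1) + f ω (p.1.2 - p.2.2)‖ ≤ d * δ).card : ℝ) ≤
          q * Fintype.card Ω := by
      intro p hp
      have ht := not_lt.1 (Finset.mem_filter.1 hp).2
      set y := p.1.2 - p.2.2 with hy
      set z := p.1.1 - p.2.1 with hz
      have hy0 : 0 < ‖y‖ := ht₀.trans_le ht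
      refine le_trans ?_ (hf (‖y‖⁻¹ • y) (-(‖y‖⁻¹ • z))
        (norm_smul_inv_norm (𝕜 := ℝ) (norm_pos_iff.1 hy0)))
      norm_cast
      refine Finset.card_le_card fun ω hω => ?_
      rw [Finset.mem_filter] at hω ⊢
      refine ⟨Finset.mem_univ _, ?_⟩
      have h5 : f ω (‖y‖⁻¹ • y) - -(‖y‖⁻¹ • z) = ‖y‖⁻¹ • (z + f ω y) := by
        rw [map_smul, sub_neg_eq_add, smul_add, add_comm]
      rw [h5, norm_smul, norm_inv, norm_norm, ← div_eq_inv_mul]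
      exact div_le_div₀ (by positivity) hω.2 ht₀ ht
    rw [h3]
    have hUc : U.card ≤ F.card ^ 4 := by
      refine (Finset.card_filter_le _ _).trans (le_of_eq ?_)
      simp only [Finset.card_product]
      ring
    have hUc' : (U.card : ℝ) ≤ F.card ^ 4 := by exact_mod_cast hUc
    calc ∑ p ∈ U, (((Finset.univ : Finset Ω).filter
          fun ω => ‖(p.1.1 - p.2.1) + f ω (p.1.2 - p.2.2)‖ ≤ d * δ).card : ℝ)
        ≤ U.card * (q * Fintype.card Ω) := by
          exact (Finset.sum_le_card_nsmul _ _ _ h4).trans_eq (nsmul_eq_mul _ _)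
      _ ≤ F.card ^ 4 * (q * Fintype.card Ω) := by gcongr
      _ = _ := by ring
  obtain ⟨ω, -, hω⟩ := Finset.exists_le_of_sum_le (s := (Finset.univ : Finset Ω))
    (f := fun ω => ((far ω).card : ℝ)) (g := fun _ => q * F.card ^ 4) Finset.univ_nonempty
    (by rw [Finset.sum_const, nsmul_eq_mul]; exact hfar)
  refine ⟨ω, ?_⟩
  have h1 := card_pow_four_le_mul_card_collisions hδ hA hFA (f ω)
  have h2 := card_near_collisions_le hδ hF hQ (f ω)
  have h3 := Finset.card_filter_add_card_filter_not (s := collisions δ F (f ω))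
    (fun p => ‖p.1.2 - p.2.2‖ < t₀)
  have h2' : ((((collisions δ F (f ω)).filter fun p => ‖p.1.2 - p.2.2‖ < t₀).card : ℕ) : ℝ) ≤
      near := by
    rw [hnear]
    exact_mod_cast h2
  have h3' : ((collisions δ F (f ω)).card : ℝ) ≤ q * F.card ^ 4 + near := by
    rw [← h3]
    push_cast
    linarith
  calc (F.card : ℝ) ^ 4 ≤ (cells δ (A + f ω '' A)).card * (collisions δ F (f ω)).card := by
        exact_mod_cast h1
    _ ≤ _ := by gcongr

end Energy

/-! ### Large sumsets -/

section LargeSumsets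

theorem exists_mul_rpow_lt_one {K e : ℝ} (hK : 0 < K) (he : 0 < e) :
    ∃ δ₀ : ℝ, 0 < δ₀ ∧ ∀ δ : ℝ, 0 < δ → δ < δ₀ → K * δ ^ e < 1 := by
  refine ⟨K⁻¹ ^ (1 / e), by positivity, fun δ hδ hδ₀ => ?_⟩
  have h := Real.rpow_lt_rpow hδ.le hδ₀ he
  rw [← Real.rpow_mul (by positivity), one_div, inv_mul_cancel₀ he.ne', Real.rpow_one] at h
  rwa [← lt_inv_mul_iff₀ hK, mul_one]

variable {d : ℕ}

theorem isBounded_of_subset_unitCube {A : Set (Euc d)} (hA : A ⊆ unitCube d) :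
    Bornology.IsBounded A := by
  refine isBounded_iff_forall_norm_le.2 ⟨d * 1, fun x hx => norm_le_of_abs_coord_le fun i => ?_⟩
  have h := hA hx i
  simp only [PiLp.zero_apply, zero_add] at h
  exact abs_le.2 ⟨by linarith [h.1], h.2⟩

theorem measureReal_support (μ : Measure (LinEuc d)) [IsProbabilityMeasure μ] :
    μ.real μ.support = 1 := by
  have h : μ.support =ᵐ[μ] Set.univ := Filter.eventuallyEq_univ.2 Measure.support_mem_ae
  rw [measureReal_congr h, probReal_univ]

theorem NonConcentratedMeasure.measureReal_le (hd : 0 < d) {c κ δ : ℝ} (hc : 0 < c) (hδ : 0 < δ)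
    {μ : Measure (LinEuc d)} [IsProbabilityMeasure μ] (h : NonConcentratedMeasure c κ δ μ) {δ₁ : ℝ}
    (h1 : δ < δ₁) (h2 : δ₁ < 1) {Y : Set (LinEuc d)} (hY : ∀ x ∈ Y, ∀ y ∈ Y, ‖x - y‖ < δ₁) :
    μ.real Y ≤ c * δ₁ ^ κ := by
  have hδ₁ : 0 < δ₁ := hδ.trans h1
  rcases Y.eq_empty_or_nonempty with rfl | ⟨y, hy⟩
  · rw [measureReal_empty]
    positivity
  · obtain ⟨v, hv, -⟩ := exists_unit_half_norm_le hd (0 : LinEuc d)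
    refine le_trans (measureReal_mono fun b hb => ?_) (h δ₁ h1 h2 v (y v) hv).le
    have h3 := (b - y).le_opNorm v
    rw [hv, mul_one] at h3
    exact h3.trans_lt (hY b hb y hy)

theorem TransversalMeasure.transversalSet {σ ρ : ℝ} (hσ : 0 < σ) (hd : 0 < d)
    {μ : Measure (LinEuc d)} [IsProbabilityMeasure μ] (hμ : SupportedInUnitBall μ)
    (h : TransversalMeasure σ ρ μ) : TransversalSet ρ μ.support := by
  refine ⟨hμ, fun v w hv hw => ?_⟩
  by_contra! hlt
  have h1 : μ.real μ.support ≤ μ.real {b | |inner ℝ (b v) w| < ρ} := measureReal_mono hlt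
  have h2 := h v w hv hw
  have hd1 : (1 : ℝ) ≤ d := by exact_mod_cast hd
  have h3 : 1 / (100 * (d : ℝ)) * (1 - σ / d) ≤ 1 := by
    have h4 : 1 / (100 * (d : ℝ)) ≤ 1 := by
      rw [div_le_one (by positivity)]
      linarith
    have h5 : 0 < σ / d := by positivity
    have h6 : 0 < 1 / (100 * (d : ℝ)) := by positivity
    nlinarith
  rw [measureReal_support] at h1
  linarith

/-- A bounded set contains one point in each of the cells that it meets. -/
theorem exists_one_point_per_cell {δ : ℝ} (hδ : 0 < δ) {A : Set (Euc d)}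
    (hA : Bornology.IsBounded A) : ∃ F : Finset (Euc d), (∀ x ∈ F, x ∈ A) ∧
      Set.InjOn (cell δ) (F : Set (Euc d)) ∧ F.card = (cells δ A).card := by
  classical
  have hrep : ∀ p ∈ cells δ A, ∃ a ∈ A, cell δ a = p := fun p hp => (mem_cells hδ hA).1 hp
  choose! rep hrepA hrepc using hrep
  refine ⟨(cells δ A).image rep, fun x hx => ?_, fun x hx y hy hxy => ?_,
    Finset.card_image_of_injOn fun p hp q hq hpq => ?_⟩
  · obtain ⟨p, hp, rfl⟩ := Finset.mem_image.1 hx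
    exact hrepA p hp
  · obtain ⟨p, hp, rfl⟩ := Finset.mem_image.1 (Finset.mem_coe.1 hx)
    obtain ⟨q, hq, rfl⟩ := Finset.mem_image.1 (Finset.mem_coe.1 hy)
    rw [hrepc p hp, hrepc q hq] at hxy
    rw [hxy]
  · rw [← hrepc p hp, ← hrepc q hq, hpq]

open Classical in
/-- A ball of radius `t` lies in a box of size `2 * t`. -/
theorem exists_card_filter_norm_sub_lt_le {δ : ℝ} (hδ : 0 < δ) {A : Set (Euc d)}
    (hA : Bornology.IsBounded A) {F : Finset (Euc d)} (hFA : ∀ x ∈ F, x ∈ A)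
    (hF : Set.InjOn (cell δ) (F : Set (Euc d))) (y : Euc d) (t : ℝ) : ∃ a : Euc d,
      (F.filter fun y' => ‖y - y'‖ < t).card ≤ 3 ^ d * entropyNumber (A ∩ sizeBox a (2 * t)) δ := by
  let a : Euc d := WithLp.toLp 2 fun i => y i - t
  have hb : Bornology.IsBounded (A ∩ sizeBox a (2 * t)) := hA.subset Set.inter_subset_left
  refine ⟨a, le_trans ?_ (card_cells_le hδ hb)⟩
  refine Finset.card_le_card_of_injOn (cell δ) (fun y' hy' => ?_) fun y' hy' z hz h => ?_
  · rw [Finset.mem_coe, Finset.mem_filter] at hy'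
    refine Finset.mem_coe.2 ((mem_cells hδ hb).2 ⟨y', ⟨hFA _ hy'.1, fun i => ?_⟩, rfl⟩)
    have h5 := abs_le.1 ((abs_coord_le_norm (y - y') i).trans hy'.2.le)
    have h6 : (y - y') i = y i - y' i := rfl
    have h7 : a i = y i - t := rfl
    rw [h6] at h5
    rw [h7]
    constructor <;> linarith
  · exact hF (Finset.mem_coe.2 (Finset.mem_filter.1 hy').1)
      (Finset.mem_coe.2 (Finset.mem_filter.1 hz).1) h

/-- The numerical comparison of the upper and the lower bound for the size `N` of `A + f A`; here
`P` is the size of `A`. -/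
theorem one_le_of_sumset_bounds {n m : ℕ} {δ σ η η' θ κ τ C C₀ P Q N : ℝ} (hδ : 0 < δ) (hδ1 : δ < 1)
    (hP : 0 < P) (hQ0 : 0 ≤ Q) (hC : 0 < C) (hC₀ : 0 < C₀) (hη1 : η' ≤ d - θ * d - η - σ)
    (hη2 : η' ≤ κ * θ) (hτ : τ * (3 * n + 1 : ℕ) = η' / 2) (hPlow : δ ^ (-σ) ≤ m * P)
    (hPupp : P ≤ 3 ^ d * δ ^ (-σ)) (hQ : Q ≤ 3 ^ d * ((2 * δ ^ θ) ^ κ * δ ^ (-σ)))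
    (hlow : P ^ 4 ≤ N * (C * (d * δ / δ ^ θ) ^ d * δ ^ (-η) * P ^ 4 +
      (2 * d + 1) ^ d * (P * (Q * P))))
    (hup : N ≤ (6 * n + 7) ^ d * ((C₀ * δ ^ (-τ)) ^ (3 * n + 1) * P)) :
    1 ≤ (6 * n + 7) ^ d * C₀ ^ (3 * n + 1) *
      (C * d ^ d * 3 ^ d + (2 * d + 1) ^ d * (3 ^ d * 2 ^ κ * m)) * δ ^ (η' / 2) := by
  have hθ0 : 0 < δ ^ θ := Real.rpow_pos_of_pos hδ _
  have hqP : C * (d * δ / δ ^ θ) ^ d * δ ^ (-η) * P ≤ C * d ^ d * 3 ^ d * δ ^ η' := by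
    have h4 : (δ ^ θ) ^ d = δ ^ (θ * d) := by rw [Real.rpow_mul hδ.le θ, Real.rpow_natCast]
    have h5 : δ ^ d * (δ ^ (θ * d))⁻¹ * δ ^ (-η) * δ ^ (-σ) ≤ δ ^ η' := by
      rw [← Real.rpow_neg hδ.le, ← Real.rpow_natCast, ← Real.rpow_add hδ, ← Real.rpow_add hδ,
        ← Real.rpow_add hδ]
      refine Real.rpow_le_rpow_of_exponent_ge hδ hδ1.le ?_
      linarith
    calc C * (d * δ / δ ^ θ) ^ d * δ ^ (-η) * P
        ≤ C * (d * δ / δ ^ θ) ^ d * δ ^ (-η) * (3 ^ d * δ ^ (-σ)) := by gcongr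
      _ = C * d ^ d * 3 ^ d * (δ ^ d * (δ ^ (θ * d))⁻¹ * δ ^ (-η) * δ ^ (-σ)) := by
        rw [div_pow, mul_pow, h4, div_eq_mul_inv]
        ring
      _ ≤ _ := by gcongr
  have hQP : Q ≤ 3 ^ d * 2 ^ κ * m * δ ^ η' * P := by
    have h4 : (δ ^ θ) ^ κ ≤ δ ^ η' := by
      rw [← Real.rpow_mul hδ.le, mul_comm]
      exact Real.rpow_le_rpow_of_exponent_ge hδ hδ1.le hη2
    calc Q ≤ 3 ^ d * ((2 * δ ^ θ) ^ κ * δ ^ (-σ)) := hQ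
      _ = 3 ^ d * (2 ^ κ * (δ ^ θ) ^ κ * δ ^ (-σ)) := by
        rw [Real.mul_rpow (by norm_num) hθ0.le]
      _ ≤ 3 ^ d * (2 ^ κ * δ ^ η' * (m * P)) := by gcongr
      _ = _ := by ring
  have hMn : (C₀ * δ ^ (-τ)) ^ (3 * n + 1) = C₀ ^ (3 * n + 1) * δ ^ (-(η' / 2)) := by
    rw [mul_pow, ← Real.rpow_natCast (δ ^ (-τ)), ← Real.rpow_mul hδ.le, neg_mul, hτ]
  have hE : C * (d * δ / δ ^ θ) ^ d * δ ^ (-η) * P ^ 4 + (2 * d + 1) ^ d * (P * (Q * P)) ≤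
      (C * d ^ d * 3 ^ d + (2 * d + 1) ^ d * (3 ^ d * 2 ^ κ * m)) * δ ^ η' * P ^ 3 := by
    calc C * (d * δ / δ ^ θ) ^ d * δ ^ (-η) * P ^ 4 + (2 * d + 1) ^ d * (P * (Q * P))
        = C * (d * δ / δ ^ θ) ^ d * δ ^ (-η) * P * P ^ 3 + (2 * d + 1) ^ d * (P * (Q * P)) := by ring
      _ ≤ C * d ^ d * 3 ^ d * δ ^ η' * P ^ 3 +
          (2 * d + 1) ^ d * (P * (3 ^ d * 2 ^ κ * m * δ ^ η' * P * P)) := by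
        gcongr
      _ = _ := by ring
  have hηη : δ ^ (-(η' / 2)) * δ ^ η' = δ ^ (η' / 2) := by
    rw [← Real.rpow_add hδ]
    congr 1
    ring
  have hE0 : 0 ≤ C * (d * δ / δ ^ θ) ^ d * δ ^ (-η) * P ^ 4 + (2 * d + 1) ^ d * (P * (Q * P)) := by
    positivity
  have h5 : 0 < P ^ 4 := by positivity
  refine le_of_mul_le_mul_right ?_ h5
  rw [one_mul]
  calc P ^ 4 ≤ _ := hlow
    _ ≤ ((6 * n + 7) ^ d * ((C₀ * δ ^ (-τ)) ^ (3 * n + 1) * P)) *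
        ((C * d ^ d * 3 ^ d + (2 * d + 1) ^ d * (3 ^ d * 2 ^ κ * m)) * δ ^ η' * P ^ 3) := by
      gcongr
    _ = (6 * n + 7) ^ d * C₀ ^ (3 * n + 1) *
      (C * d ^ d * 3 ^ d + (2 * d + 1) ^ d * (3 ^ d * 2 ^ κ * m)) *
        (δ ^ (-(η' / 2)) * δ ^ η') * P ^ 4 := by
      rw [hMn]
      ring
    _ = _ := by rw [hηη]

/-- The common core of both alternatives: for a transversal set `U` of linear maps, one of the
sumsets `A + A`, `A + b A` with `b` in the support of `μ`, or `A + u A` with `u ∈ U`, is large. -/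
theorem exists_large_sumset (hd : 0 < d) {c σ κ κ' ρ : ℝ} (hc : 0 < c) (hσ : 0 < σ) (hσd : σ < d)
    (hκ : 0 < κ) (hκ' : 0 < κ') (hρ : 0 < ρ) :
    ∃ τ : ℝ, 0 < τ ∧ ∃ δ₀ : ℝ, 0 < δ₀ ∧ ∀ δ : ℝ, 0 < δ → δ < δ₀ →
      ∀ A : Set (Euc d), A ⊆ unitCube d → (entropyNumber A δ : ℝ) = δ ^ (-σ) →
        NonConcentratedSet σ κ δ A →
      ∀ μ : Measure (LinEuc d), IsProbabilityMeasure μ → SupportedInUnitBall μ →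
        NonConcentratedMeasure c κ' δ μ →
      ∀ U : Set (LinEuc d), TransversalSet ρ U →
        (entropyNumber (A + A) δ : ℝ) > δ ^ (-σ - τ) ∨
        (∃ b ∈ μ.support, (entropyNumber (A + b '' A) δ : ℝ) > δ ^ (-σ - τ)) ∨
        (∃ u ∈ U, (entropyNumber (A + u '' A) δ : ℝ) > δ ^ (-σ - τ)) := by
  classical
  have hd1 : (1 : ℝ) ≤ d := by exact_mod_cast hd
  have hd0 : (0 : ℝ) < d := by linarith
  set η : ℝ := (d - σ) / 4 with hη
  have hη0 : 0 < η := by rw [hη]; linarith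
  set ε₀ : ℝ := (1 / 200 : ℝ) * (1 - σ / d) with hε₀
  have hε₀d : ε₀ * d = (d - σ) / 200 := by rw [hε₀]; field_simp
  have hσd' : σ / d < 1 := (div_lt_one hd0).2 hσd
  have hε₀0 : 0 < ε₀ := by rw [hε₀]; linarith
  have hε₀1 : ε₀ < 1 / 200 := by
    have : 0 < σ / d := by positivity
    rw [hε₀]; linarith
  set θ : ℝ := 3 / 2 * ε₀ with hθ
  have hθ0 : 0 < θ := by positivity
  obtain ⟨k, C, δ₁, hC, hδ₁, hspread⟩ := exists_spread_family hd hρ hκ' hc hη0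
  obtain ⟨n, hn⟩ := CoveredBy.exists_of_mem_generated d (3 * d + 1) k
  obtain ⟨m, hm0, hm⟩ := exists_entropyNumber_le d
  set η' : ℝ := min (2 * η) (κ * θ) with hη'
  have hη'0 : 0 < η' := lt_min (by positivity) (by positivity)
  set τ : ℝ := η' / 2 / (3 * n + 1 : ℕ) with hτ
  have hn1 : (0 : ℝ) < (3 * n + 1 : ℕ) := by positivity
  have hτ0 : 0 < τ := by positivity
  set C₀ : ℝ := 3 ^ d * 3 ^ d * m with hC₀
  have hm1 : (1 : ℝ) ≤ m := by exact_mod_cast hm0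
  have hC₀1 : 1 ≤ C₀ := by
    have : (1 : ℝ) ≤ 3 ^ d := one_le_pow₀ (by norm_num)
    rw [hC₀]
    exact one_le_mul_of_one_le_of_one_le (one_le_mul_of_one_le_of_one_le this this) hm1
  set K : ℝ := (6 * n + 7) ^ d * C₀ ^ (3 * n + 1) *
    (C * d ^ d * 3 ^ d + (2 * d + 1) ^ d * (3 ^ d * 2 ^ κ * m)) with hK
  have hK0 : 0 < K := by positivity
  obtain ⟨δ₂, hδ₂, h2⟩ := exists_mul_rpow_lt_one hK0 (half_pos hη'0)
  obtain ⟨δ₃, hδ₃, h3⟩ := exists_mul_rpow_lt_one (two_pos (α := ℝ)) (half_pos hε₀0)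
  refine ⟨τ, hτ0, min 1 (min δ₁ (min δ₂ δ₃)), by positivity,
    fun δ hδ hδlt A hA hAN hAnc μ hμ hsupp hμnc U hU => ?_⟩
  simp only [lt_min_iff] at hδlt
  obtain ⟨hδ1, hδlt1, hδlt2, hδlt3⟩ := hδlt
  by_contra! hsmall
  obtain ⟨hAA, hAb, hAu⟩ := hsmall
  have hbd := isBounded_of_subset_unitCube hA
  set P := cells δ A with hP
  have hσδ : 0 < δ ^ (-σ) := Real.rpow_pos_of_pos hδ _
  have hτδ : 1 ≤ δ ^ (-τ) := Real.one_le_rpow_of_pos_of_le_one_of_nonpos hδ hδ1.le (by linarith)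
  -- the number of cells that meet `A` is comparable to `δ ^ (-σ)`
  have hPlow : δ ^ (-σ) ≤ m * P.card := by
    rw [← hAN]
    exact_mod_cast hm δ hδ A hbd
  have hPupp : (P.card : ℝ) ≤ 3 ^ d * δ ^ (-σ) := by
    rw [← hAN]
    exact_mod_cast card_cells_le hδ hbd
  have hP0 : (0 : ℝ) < P.card :=
    (mul_pos_iff_of_pos_left (by linarith)).1 (hσδ.trans_le hPlow)
  have hPne : P.Nonempty := Finset.card_pos.1 (by exact_mod_cast hP0)
  have hAne : A.Nonempty := by
    obtain ⟨p, hp⟩ := hPne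
    obtain ⟨a, ha, -⟩ := (mem_cells hδ hbd).1 hp
    exact ⟨a, ha⟩
  set M : ℝ := C₀ * δ ^ (-τ) with hM
  have hM1 : 1 ≤ M := one_le_mul_of_one_le_of_one_le hC₀1 hτδ
  have hsum : ∀ f : LinEuc d, (entropyNumber (A + f '' A) δ : ℝ) ≤ δ ^ (-σ - τ) →
      ((cells δ (f '' A) + cells δ A).card : ℝ) ≤ M * P.card := by
    intro f hf
    have hfb : Bornology.IsBounded (f '' A) := f.lipschitz.isBounded_image hbd
    have h1 := card_cells_add_cells_le hδ hbd hfb (isBounded_add_image hbd f)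
    have h4 := card_cells_le hδ (isBounded_add_image hbd f)
    calc ((cells δ (f '' A) + cells δ A).card : ℝ)
        ≤ 3 ^ d * (3 ^ d * entropyNumber (A + f '' A) δ) := by
          rw [add_comm]
          exact_mod_cast h1.trans (Nat.mul_le_mul_left _ h4)
      _ ≤ 3 ^ d * (3 ^ d * (δ ^ (-σ) * δ ^ (-τ))) := by
          rw [← Real.rpow_add hδ, ← sub_eq_add_neg]
          gcongr
      _ ≤ 3 ^ d * (3 ^ d * (m * P.card * δ ^ (-τ))) := by gcongr
      _ = M * P.card := by rw [hM, hC₀]; ring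
  have hone : (1 : LinEuc d) '' A = A := by
    ext x
    simp
  set S : Set (LinEuc d) := μ.support ∪ U ∪ {1} with hS
  have hSsum : ∀ f ∈ S, (entropyNumber (A + f '' A) δ : ℝ) ≤ δ ^ (-σ - τ) := by
    rintro f ((hf | hf) | rfl)
    · exact hAb f hf
    · exact hAu f hf
    · rw [hone]
      exact hAA
  have hSnorm : ∀ f ∈ S, ‖f‖ ≤ 1 := by
    rintro f ((hf | hf) | rfl)
    · exact hsupp f hf
    · exact hU.norm_le f hf
    · exact ContinuousLinearMap.norm_id_le
  obtain ⟨Ω, _, _, f, hfS, hf⟩ := hspread δ hδ hδlt1 μ μ.support U S (measureReal_support μ) hsupp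
    hU
    (fun b hb => Or.inl (Or.inl hb)) (fun u hu => Or.inl (Or.inr hu)) (Or.inr rfl)
    (fun δ' h1 h2 Y hY => hμnc.measureReal_le hd hc hδ h1 h2 hY)
  have hcov := hn A δ M S hAne hM1 hδ.le hSnorm fun f hf =>
    coveredBy_of_card_cells_add_le hδ hM1 hAne hbd (f.lipschitz.isBounded_image hbd)
      (hsum f (hSsum f hf))
  have hdoub : ((cells δ A + cells δ A).card : ℝ) ≤ M * (cells δ A).card := by
    have := hsum 1 (hSsum 1 (Or.inr rfl))
    rwa [hone] at this
  -- one point of `A` in each cell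
  obtain ⟨F, hFA, hFinj, hFc⟩ := exists_one_point_per_cell hδ hbd
  set t₀ : ℝ := δ ^ θ with ht₀
  have ht₀0 : 0 < t₀ := Real.rpow_pos_of_pos hδ _
  have ht₀1 : t₀ ≤ 1 := Real.rpow_le_one hδ.le hδ1.le hθ0.le
  have hδt₀ : δ ≤ t₀ := by
    calc δ = δ ^ (1 : ℝ) := (Real.rpow_one δ).symm
      _ ≤ δ ^ θ := Real.rpow_le_rpow_of_exponent_ge hδ hδ1.le (by rw [hθ]; linarith)
  have ht₀ε : 2 * t₀ < δ ^ ε₀ := by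
    have h4 : δ ^ θ = δ ^ (ε₀ / 2) * δ ^ ε₀ := by
      rw [← Real.rpow_add hδ, hθ]
      congr 1
      ring
    rw [ht₀, h4, ← mul_assoc]
    exact mul_lt_of_lt_one_left (Real.rpow_pos_of_pos hδ _) (h3 δ hδ hδlt3)
  set Q : ℕ := ⌊3 ^ d * ((2 * t₀) ^ κ * δ ^ (-σ))⌋₊ with hQ
  have hQle : (Q : ℝ) ≤ 3 ^ d * ((2 * t₀) ^ κ * δ ^ (-σ)) := Nat.floor_le (by positivity)
  have hQF : ∀ y ∈ F, (F.filter fun y' => ‖y - y'‖ < t₀).card ≤ Q := by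
    intro y hy
    refine Nat.le_floor ?_
    obtain ⟨a, ha⟩ := exists_card_filter_norm_sub_lt_le hδ hbd hFA hFinj y t₀
    have h5 := hAnc (2 * t₀) (by linarith) ht₀ε a
    rw [hAN] at h5
    calc ((F.filter fun y' => ‖y - y'‖ < t₀).card : ℝ)
        ≤ 3 ^ d * entropyNumber (A ∩ sizeBox a (2 * t₀)) δ := by exact_mod_cast ha
      _ ≤ _ := by gcongr
  set q : ℝ := C * (d * δ / t₀) ^ d * δ ^ (-η) with hq
  have hq0 : 0 ≤ q := by positivity
  obtain ⟨ω, hω⟩ := exists_card_pow_four_le hδ hbd hFA hFinj ht₀0 hQF f hq0 fun v w hv =>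
    hf v w hv (d * δ / t₀) (by
      rw [le_div_iff₀ ht₀0, mul_comm (d : ℝ)]
      exact mul_le_mul_of_nonneg_left (ht₀1.trans hd1) hδ.le)
  have hup := (hcov (f ω) (hfS ω)).card_cells_add_le hδ hM1 hAne hbd
    (isBounded_add_image hbd (f ω)) hdoub
  rw [hFc] at hω
  refine absurd (one_le_of_sumset_bounds hδ hδ1 hP0 (Nat.cast_nonneg _) hC (by linarith) ?_
    (min_le_right _ _) (div_mul_cancel₀ _ hn1.ne') hPlow hPupp hQle hω hup)
    (not_le.2 (h2 δ hδ hδlt2))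
  -- as `θ * d` is small compared with `η`
  refine (min_le_left _ _).trans ?_
  have h6 : θ * d = 3 / 2 * ((d - σ) / 200) := by rw [← hε₀d, hθ]; ring
  rw [h6, hη]
  linarith

end LargeSumsets

theorem proposition1 (d : ℕ) (c σ κ κ' ρ : ℝ) (hc : 0 < c) (hσ : 0 < σ) (hσd : σ < d)
    (hκ : 0 < κ) (hκ' : 0 < κ') (hρ : 0 < ρ) :
    (∃ τ : ℝ, 0 < τ ∧ ∃ δ₀ : ℝ, 0 < δ₀ ∧ ∀ δ : ℝ, 0 < δ → δ < δ₀ →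
      ∀ A : Set (Euc d), A ⊆ unitCube d →
        (entropyNumber A δ : ℝ) = δ ^ (-σ) →
        NonConcentratedSet σ κ δ A →
      ∀ μ : Measure (LinEuc d), IsProbabilityMeasure μ →
        SupportedInUnitBall μ →
        NonConcentratedMeasure c κ' δ μ →
        TransversalMeasure σ ρ μ →
      ∃ b ∈ μ.support,
        (entropyNumber (A + A) δ : ℝ) + (entropyNumber (A + b '' A) δ : ℝ) > δ ^ (-σ - τ)) ∧
    (∃ τ : ℝ, 0 < τ ∧ ∃ δ₀ : ℝ, 0 < δ₀ ∧ ∀ δ : ℝ, 0 < δ → δ < δ₀ →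
      ∀ A : Set (Euc d), A ⊆ unitCube d →
        (entropyNumber A δ : ℝ) = δ ^ (-σ) →
        NonConcentratedSet σ κ δ A →
      ∀ μ : Measure (LinEuc d), IsProbabilityMeasure μ →
        SupportedInUnitBall μ →
        NonConcentratedMeasure c κ' δ μ →
      ∀ (r : ℕ) (u : Fin r → LinEuc d), TransversalFamily ρ u →
        (entropyNumber (A + A) δ : ℝ) > δ ^ (-σ - τ) ∨
        (∃ b ∈ μ.support, (entropyNumber (A + b '' A) δ : ℝ) > δ ^ (-σ - τ)) ∨
        (∃ s, (entropyNumber (A + u s '' A) δ : ℝ) > δ ^ (-σ - τ))) := by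
  have hd : 0 < d := by
    rcases Nat.eq_zero_or_pos d with rfl | h
    · rw [Nat.cast_zero] at hσd
      linarith
    · exact h
  obtain ⟨τ, hτ, δ₀, hδ₀, h⟩ := exists_large_sumset hd hc hσ hσd hκ hκ' hρ
  refine ⟨⟨τ, hτ, δ₀, hδ₀, fun δ hδ hδlt A hA hAN hAnc μ hμ hsupp hμnc htr => ?_⟩,
    ⟨τ, hτ, δ₀, hδ₀, fun δ hδ hδlt A hA hAN hAnc μ hμ hsupp hμnc r u hu => ?_⟩⟩
  · have hU := htr.transversalSet hσ hd hsupp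
    have hnn : ∀ Y : Set (Euc d), (0 : ℝ) ≤ entropyNumber Y δ := fun Y => Nat.cast_nonneg _
    rcases h δ hδ hδlt A hA hAN hAnc μ hμ hsupp hμnc _ hU with h1 | ⟨b, hb, h1⟩ | ⟨b, hb, h1⟩
    · obtain ⟨b, hb⟩ := hU.nonempty hd
      exact ⟨b, hb, by linarith [hnn (A + b '' A)]⟩
    · exact ⟨b, hb, by linarith [hnn (A + A)]⟩
    · exact ⟨b, hb, by linarith [hnn (A + A)]⟩
  · have hU : TransversalSet ρ (Set.range u) := by
      refine ⟨?_, fun v w hv hw => ?_⟩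
      · rintro _ ⟨s, rfl⟩
        exact hu.1 s
      · obtain ⟨s, hs⟩ := hu.2 v w hv hw
        exact ⟨u s, ⟨s, rfl⟩, hs.le⟩
    rcases h δ hδ hδlt A hA hAN hAnc μ hμ hsupp hμnc _ hU with h1 | h1 | ⟨_, ⟨s, rfl⟩, h1⟩
    · exact Or.inl h1
    · exact Or.inr (Or.inl h1)
    · exact Or.inr (Or.inr ⟨s, h1⟩)
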